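/- Let $k$ be an algebraically closed field of characteristic $0$, $G$ a finite group, $\chi:G\to k^\times$ a character, $g$ a central element of $G$, $n$ the order of $\chi(g)$, and $\mu\in k$. Assume $n\ge 2$, $\chi^n=1$ and $\mu(g^n-1)\neq 0$ in $kG$ (a group datum of non-nilpotent type). Let $H$ be the associated Hopf algebra: as an algebra it is generated by $y$ and the elements of $G$, subject to the relations of $kG$ and $$y^n=\mu(g^n-1),\qquad yh=\chi(h)hy\quad(h\in G),$$ with $\Delta(y)=y\otimes g+1\otimes y$, $\varepsilon(y)=0$, $S(y)=-yg^{-1}$ and $\Delta(h)=h\otimes h$, $\varepsilon(h)=1$, $S(h)=h^{-1}$ for $h\in G$. For a Hopf algebra $A$ over $k$ let $F(A)$ be the free abelian group on the isomorphism classes of finite dimensional left $A$-modules, a ring under $[M][N]=[M\otimes_k N]$. The Green ring $r(A)$ is the quotient of $F(A)$ by the relations $[M\oplus N]=[M]+[N]$, and the Grothendieck ring $G_0(A)$ is the quotient of $F(A)$ by the relations $[Y]=[X]+[Z]$ for all short exact sequences $0\to X\to Y\to Z\to 0$. Let $\phi:r(H)\to G_0(H)$, $[M]\mapsto[M]$,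 be the natural ring homomorphism. Let $(-,-)$ be the $\mathbb Z$-bilinear form on $r(H)$ with $([X],[Y])=\dim_k\operatorname{Hom}_H(X,Y^*)$, where $Y^*=\operatorname{Hom}_k(Y,k)$ with $(hf)(v)=f(S(h)v)$. Let $\mathcal P\subseteq r(H)$ be the subgroup generated by the classes of the finite dimensional indecomposable projective $H$-modules, and $\mathcal P^{\perp}=\{x\in r(H)\mid (x,y)=0\text{ for all }y\in\mathcal P\}$. Let $\{V_i\mid i\in\Omega\}$ be a complete set of simple $kG$-modules up to isomorphism. The central element $g^n$ acts on $V_i$ by a scalar $\lambda_i$; put $\Omega_0=\{i\mid\lambda_i=1\}$ and $\Omega_1=\{i\mid\lambda_i\ne1\}$. Let $a\in r(kG)$ be the class of the one-dimensional $kG$-module with character $\chi^{-1}$. Then: 1. $\ker\phi=\mathcal P^{\perp}$. Hence $\mathcal P^\perp$ is a two-sided ideal of $r(H)$, and $\phi$ induces a ring isomorphism $r(H)/\mathcal P^{\perp}\cong G_0(H)$. 2. The ring $G_0(H)$ is isomorphic to the subring of $r(kG)$ generated by the elements $[V_i]$ for $i\in\Omega_0$ and $(1+a+\cdots+a^{n-1})[V_j]$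 for $j\in\Omega_1$. -/

import Mathlib

open scoped TensorProduct

noncomputable section

/-! ## Finite dimensional modules over an algebra -/

universe u v w

/-- A finite dimensional left module over a `k`-algebra `A`. The underlying space lives in the
universe of `k`, which contains every finite dimensional `k`-space up to isomorphism. -/
structure FDModule (k : Type u) (A : Type v) [Field k] [Ring A] [Algebra k A] where
  carrier : Type u
  [addCommGroup : AddCommGroup carrier]
  [moduleBase : Module k carrier]
  [moduleAlg : Module A carrier]
  [isScalarTower : IsScalarTower k A carrier]
  [finite : Module.Finite k carrier]

namespace FDModule

section Algebra

variable {k : Type u} {A : Type v} [Field k] [Ring A] [Algebra k A]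

instance : CoeSort (FDModule k A) (Type u) := ⟨FDModule.carrier⟩

instance (M : FDModule k A) : AddCommGroup M := M.addCommGroup
instance (M : FDModule k A) : Module k M := M.moduleBase
instance (M : FDModule k A) : Module A M := M.moduleAlg
instance (M : FDModule k A) : IsScalarTower k A M := M.isScalarTower
instance (M : FDModule k A) : Module.Finite k M := M.finite

/-- The module given by an algebra homomorphism `A → End_k(V)`. -/
def ofRep (V : Type u) [AddCommGroup V] [Module k V] [Module.Finite k V]
    (ρ : A →ₐ[k] Module.End k V) : FDModule k A :=
  letI : Module A V := Module.compHom V ρ.toRingHom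
  { carrier := V
    isScalarTower := ⟨fun c a x => by
      change ρ (c • a) x = c • ρ a x
      simp⟩ }

/-- The structure map `A → End_k(M)`. -/
abbrev rep (M : FDModule k A) : A →ₐ[k] Module.End k M := Algebra.lsmul k k (M : Type u)

/-- The direct sum `M ⊕ N`. -/
def directSum (M N : FDModule k A) : FDModule k A := { carrier := M × N }

/-- `M` is indecomposable: it is nonzero and not the direct sum of two nonzero submodules. -/
def IsIndecomposable (M : FDModule k A) : Prop :=
  Nontrivial M ∧ ∀ p q : Submodule A M, IsCompl p q → p = ⊥ ∨ q = ⊥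

/-- Isomorphism of modules. -/
instance isoSetoid (k : Type u) (A : Type v) [Field k] [Ring A] [Algebra k A] :
    Setoid (FDModule k A) where
  r M N := Nonempty (M ≃ₗ[A] N)
  iseqv :=
    ⟨fun M => ⟨LinearEquiv.refl A M⟩, fun ⟨e⟩ => ⟨e.symm⟩, fun ⟨e⟩ ⟨f⟩ => ⟨e.trans f⟩⟩

/-- A `k`-linear isomorphism that respects the structure maps gives an isomorphism. -/
theorem equiv_of_rep {M N : FDModule k A} (e : M ≃ₗ[k] N)
    (h : ∀ (a : A) (x : M), e (a • x) = a • e x) : M ≈ N :=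
  ⟨{ e with map_smul' := h }⟩

end Algebra

section Rep

variable {k : Type u} {A : Type v} [Field k] [Ring A] [Bialgebra k A]
variable {V W X : Type u} [AddCommGroup V] [Module k V] [AddCommGroup W] [Module k W]
  [AddCommGroup X] [Module k X]

/-- The action of `A ⊗ A` on `V ⊗ W` given by actions of `A` on `V` and on `W`. -/
def outerRep {B : Type*} [Ring B] [Algebra k B]
    (ρ : A →ₐ[k] Module.End k V) (σ : B →ₐ[k] Module.End k W) :
    A ⊗[k] B →ₐ[k] Module.End k (V ⊗[k] W) :=
  (Module.endTensorEndAlgHom (R := k) (S := k) (A := k) (M := V) (N := W)).comp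
    (Algebra.TensorProduct.map ρ σ)

@[simp]
theorem outerRep_tmul {B : Type*} [Ring B] [Algebra k B]
    (ρ : A →ₐ[k] Module.End k V) (σ : B →ₐ[k] Module.End k W)
    (a : A) (b : B) (x : V) (y : W) :
    outerRep ρ σ (a ⊗ₜ b) (x ⊗ₜ y) = ρ a x ⊗ₜ σ b y := rfl

/-- The tensor product of two actions of a bialgebra, through the comultiplication. -/
def tensorRep (ρ : A →ₐ[k] Module.End k V) (σ : A →ₐ[k] Module.End k W) :
    A →ₐ[k] Module.End k (V ⊗[k] W) :=
  (outerRep ρ σ).comp (Bialgebra.comulAlgHom k A)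

theorem outerRep_assoc (ρ : A →ₐ[k] Module.End k V) (σ : A →ₐ[k] Module.End k W)
    (τ : A →ₐ[k] Module.End k X) (t : (A ⊗[k] A) ⊗[k] A) (x : (V ⊗[k] W) ⊗[k] X) :
    TensorProduct.assoc k V W X
        ((Module.endTensorEndAlgHom (R := k) (S := k) (A := k) (M := V ⊗[k] W) (N := X))
          (Algebra.TensorProduct.map (outerRep ρ σ) τ t) x) =
      outerRep ρ (outerRep σ τ) (TensorProduct.assoc k A A A t) (TensorProduct.assoc k V W X x) := by
  induction t using TensorProduct.induction_on with
  | zero => simp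
  | add s t hs ht => simp only [map_add, LinearMap.add_apply, hs, ht]
  | tmul s c =>
    induction s using TensorProduct.induction_on with
    | zero => simp
    | add s t hs ht => simp only [map_add, LinearMap.add_apply, TensorProduct.add_tmul, hs, ht]
    | tmul a b =>
      induction x using TensorProduct.induction_on with
      | zero => simp
      | add x y hx hy => simp only [map_add, hx, hy]
      | tmul z p =>
        induction z using TensorProduct.induction_on with
        | zero => simp
        | add x y hx hy => simp only [map_add, TensorProduct.add_tmul, hx, hy]
        | tmul m n => rfl

theorem tensorRep_assoc (ρ : A →ₐ[k] Module.End k V) (σ : A →ₐ[k] Module.End k W)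
    (τ : A →ₐ[k] Module.End k X) (a : A) (x : (V ⊗[k] W) ⊗[k] X) :
    TensorProduct.assoc k V W X (tensorRep (tensorRep ρ σ) τ a x) =
      tensorRep ρ (tensorRep σ τ) a (TensorProduct.assoc k V W X x) := by
  have h1 : ∀ t : A ⊗[k] A, outerRep (tensorRep ρ σ) τ t =
      (Module.endTensorEndAlgHom (R := k) (S := k) (A := k) (M := V ⊗[k] W) (N := X))
        (Algebra.TensorProduct.map (outerRep ρ σ) τ
          ((Coalgebra.comul (R := k)).rTensor A t)) := by
    intro t
    induction t using TensorProduct.induction_on with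
    | zero => simp
    | add s t hs ht => simp only [map_add, hs, ht]
    | tmul b c => rfl
  have h2 : ∀ t : A ⊗[k] A, outerRep ρ (tensorRep σ τ) t =
      outerRep ρ (outerRep σ τ) ((Coalgebra.comul (R := k)).lTensor A t) := by
    intro t
    induction t using TensorProduct.induction_on with
    | zero => simp
    | add s t hs ht => simp only [map_add, hs, ht]
    | tmul b c => rfl
  change TensorProduct.assoc k V W X
    (outerRep (tensorRep ρ σ) τ (Coalgebra.comul (R := k) a) x) =
      outerRep ρ (tensorRep σ τ) (Coalgebra.comul (R := k) a) _
  rw [h1, h2, outerRep_assoc, Coalgebra.coassoc_apply]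

/-- The action of `A` on `k` given by an algebra homomorphism `A → k`. -/
def charRep (f : A →ₐ[k] k) : A →ₐ[k] Module.End k k := (Algebra.lsmul k k k).comp f

theorem tensorRep_counit_left (ρ : A →ₐ[k] Module.End k V) (a : A) (x : k ⊗[k] V) :
    TensorProduct.lid k V (tensorRep (charRep (Bialgebra.counitAlgHom k A)) ρ a x) =
      ρ a (TensorProduct.lid k V x) := by
  have h : ∀ (t : A ⊗[k] A), TensorProduct.lid k V
      (outerRep (charRep (Bialgebra.counitAlgHom k A)) ρ t x) =
      ρ (TensorProduct.lid k A ((Coalgebra.counit (R := k)).rTensor A t))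
        (TensorProduct.lid k V x) := by
    intro t
    induction t using TensorProduct.induction_on with
    | zero => simp
    | add s t hs ht => simp only [map_add, LinearMap.add_apply, hs, ht]
    | tmul b c =>
      induction x using TensorProduct.induction_on with
      | zero => simp
      | add x y hx hy => simp only [map_add, hx, hy]
      | tmul r v => simp [charRep, mul_smul, smul_comm r]
  refine (h (Coalgebra.comul (R := k) a)).trans ?_
  rw [Coalgebra.rTensor_counit_comul, TensorProduct.lid_tmul, one_smul]

theorem tensorRep_counit_right (ρ : A →ₐ[k] Module.End k V) (a : A) (x : V ⊗[k] k) :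
    TensorProduct.rid k V (tensorRep ρ (charRep (Bialgebra.counitAlgHom k A)) a x) =
      ρ a (TensorProduct.rid k V x) := by
  have h : ∀ (t : A ⊗[k] A), TensorProduct.rid k V
      (outerRep ρ (charRep (Bialgebra.counitAlgHom k A)) t x) =
      ρ (TensorProduct.rid k A ((Coalgebra.counit (R := k)).lTensor A t))
        (TensorProduct.rid k V x) := by
    intro t
    induction t using TensorProduct.induction_on with
    | zero => simp
    | add s t hs ht => simp only [map_add, LinearMap.add_apply, hs, ht]
    | tmul b c =>
      induction x using TensorProduct.induction_on with
      | zero => simp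
      | add x y hx hy => simp only [map_add, hx, hy]
      | tmul v r => simp [charRep, mul_smul, smul_comm r]
  refine (h (Coalgebra.comul (R := k) a)).trans ?_
  rw [Coalgebra.lTensor_counit_comul, TensorProduct.rid_tmul, one_smul]

end Rep

section Bialgebra

variable {k : Type u} {A : Type v} [Field k] [Ring A] [Bialgebra k A]

/-- The one-dimensional module given by an algebra homomorphism `A → k`. -/
def ofChar (f : A →ₐ[k] k) : FDModule k A := ofRep k (charRep f)

/-- The trivial module `k`; `A` acts through the counit. -/
def unit (k : Type u) (A : Type v) [Field k] [Ring A] [Bialgebra k A] : FDModule k A :=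
  ofChar (Bialgebra.counitAlgHom k A)

/-- The tensor product of two modules over a bialgebra; `A` acts through the comultiplication. -/
def tensor (M N : FDModule k A) : FDModule k A :=
  ofRep ((M : Type u) ⊗[k] (N : Type u)) (tensorRep M.rep N.rep)

theorem outerRep_map {M M' N N' : FDModule k A} (f : M →ₗ[A] M') (g : N →ₗ[A] N')
    (t : A ⊗[k] A) (x : (M : Type u) ⊗[k] (N : Type u)) :
    TensorProduct.map (f.restrictScalars k) (g.restrictScalars k)
        (outerRep M.rep N.rep t x) =
      outerRep M'.rep N'.rep t
        (TensorProduct.map (f.restrictScalars k) (g.restrictScalars k) x) := by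
  induction t using TensorProduct.induction_on with
  | zero => simp
  | add s t hs ht => simp only [map_add, LinearMap.add_apply, hs, ht]
  | tmul a b =>
    induction x using TensorProduct.induction_on with
    | zero => simp
    | add x y hx hy => simp only [map_add, hx, hy]
    | tmul x y => simp

/-- The tensor product of two module homomorphisms. -/
def tensorMap {M M' N N' : FDModule k A} (f : M →ₗ[A] M') (g : N →ₗ[A] N') :
    tensor M N →ₗ[A] tensor M' N' :=
  { TensorProduct.map (f.restrictScalars k) (g.restrictScalars k) with
    map_smul' := fun _ x => outerRep_map f g _ x }

theorem tensor_congr {M M' N N' : FDModule k A} (h : M ≈ M') (h' : N ≈ N') :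
    tensor M N ≈ tensor M' N' := by
  obtain ⟨e⟩ := h
  obtain ⟨e'⟩ := h'
  exact equiv_of_rep (M := tensor M N) (N := tensor M' N')
    (TensorProduct.congr (e.restrictScalars k) (e'.restrictScalars k))
    (fun a x => outerRep_map e.toLinearMap e'.toLinearMap _ x)

theorem rep_ofRep (V : Type u) [AddCommGroup V] [Module k V] [Module.Finite k V]
    (ρ : A →ₐ[k] Module.End k V) : (ofRep V ρ).rep = ρ := rfl

theorem tensor_assoc (M N P : FDModule k A) :
    tensor (tensor M N) P ≈ tensor M (tensor N P) :=
  equiv_of_rep (M := tensor (tensor M N) P) (N := tensor M (tensor N P))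
    (TensorProduct.assoc k M N P) (fun a x => tensorRep_assoc M.rep N.rep P.rep a x)

theorem unit_tensor (M : FDModule k A) : tensor (unit k A) M ≈ M :=
  equiv_of_rep (M := tensor (unit k A) M) (N := M) (TensorProduct.lid k M)
    (fun a x => tensorRep_counit_left M.rep a x)

theorem tensor_unit (M : FDModule k A) : tensor M (unit k A) ≈ M :=
  equiv_of_rep (M := tensor M (unit k A)) (N := M) (TensorProduct.rid k M)
    (fun a x => tensorRep_counit_right M.rep a x)

/-! Tensoring distributes over direct sums and is exact. -/

theorem tensor_directSum (L M N : FDModule k A) :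
    tensor L (directSum M N) ≈ directSum (tensor L M) (tensor L N) := by
  let p : directSum M N →ₗ[A] M := LinearMap.fst A M N
  let q : directSum M N →ₗ[A] N := LinearMap.snd A M N
  let T : tensor L (directSum M N) →ₗ[A] directSum (tensor L M) (tensor L N) :=
    LinearMap.prod (tensorMap LinearMap.id p) (tensorMap LinearMap.id q)
  have hT : ∀ x : (L : Type u) ⊗[k] (M.carrier × N.carrier),
      TensorProduct.prodRight k k L M N x =
      (TensorProduct.map LinearMap.id (LinearMap.fst k M N) x,
        TensorProduct.map LinearMap.id (LinearMap.snd k M N) x) := by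
    intro x
    induction x using TensorProduct.induction_on with
    | zero => simp only [map_zero]; rfl
    | add x y hx hy => simp only [map_add, hx, hy, Prod.mk_add_mk]
    | tmul x y => simp
  have hT' : (T : tensor L (directSum M N) → directSum (tensor L M) (tensor L N)) =
      TensorProduct.prodRight k k L M N := by
    funext x
    exact (hT x).symm
  refine ⟨LinearEquiv.ofBijective T ?_⟩
  rw [hT']
  exact (TensorProduct.prodRight k k L M N).bijective

theorem directSum_tensor (L M N : FDModule k A) :
    tensor (directSum M N) L ≈ directSum (tensor M L) (tensor N L) := by
  let p : directSum M N →ₗ[A] M := LinearMap.fst A M N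
  let q : directSum M N →ₗ[A] N := LinearMap.snd A M N
  let T : tensor (directSum M N) L →ₗ[A] directSum (tensor M L) (tensor N L) :=
    LinearMap.prod (tensorMap p LinearMap.id) (tensorMap q LinearMap.id)
  have hT : ∀ x : (M.carrier × N.carrier) ⊗[k] (L : Type u),
      TensorProduct.prodLeft k k M N L x =
      (TensorProduct.map (LinearMap.fst k M N) LinearMap.id x,
        TensorProduct.map (LinearMap.snd k M N) LinearMap.id x) := by
    intro x
    induction x using TensorProduct.induction_on with
    | zero => simp only [map_zero]; rfl
    | add x y hx hy => simp only [map_add, hx, hy, Prod.mk_add_mk]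
    | tmul x y => rfl
  have hT' : (T : tensor (directSum M N) L → directSum (tensor M L) (tensor N L)) =
      TensorProduct.prodLeft k k M N L := by
    funext x
    exact (hT x).symm
  refine ⟨LinearEquiv.ofBijective T ?_⟩
  rw [hT']
  exact (TensorProduct.prodLeft k k M N L).bijective

/-- `0 → X → Y → Z → 0` is exact for some homomorphisms `X → Y` and `Y → Z`. -/
def IsExtension (X Y Z : FDModule k A) : Prop :=
  ∃ (f : X →ₗ[A] Y) (g : Y →ₗ[A] Z),
    Function.Injective f ∧ Function.Exact f g ∧ Function.Surjective g

theorem isExtension_directSum (M N : FDModule k A) : IsExtension M (directSum M N) N :=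
  ⟨LinearMap.inl A M N, LinearMap.snd A M N, LinearMap.inl_injective,
    Function.Exact.inl_snd, LinearMap.snd_surjective⟩

theorem IsExtension.tensor_left (L : FDModule k A) {X Y Z : FDModule k A}
    (h : IsExtension X Y Z) : IsExtension (tensor L X) (tensor L Y) (tensor L Z) := by
  obtain ⟨f, g, hf, hfg, hg⟩ := h
  refine ⟨tensorMap LinearMap.id f, tensorMap LinearMap.id g, ?_, ?_, ?_⟩
  · exact Module.Flat.lTensor_preserves_injective_linearMap (M := L) (f.restrictScalars k) hf
  · exact lTensor_exact (L : Type u) (f := f.restrictScalars k) (g := g.restrictScalars k) hfg hg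
  · exact LinearMap.lTensor_surjective (L : Type u) (g := g.restrictScalars k) hg

theorem IsExtension.tensor_right (L : FDModule k A) {X Y Z : FDModule k A}
    (h : IsExtension X Y Z) : IsExtension (tensor X L) (tensor Y L) (tensor Z L) := by
  obtain ⟨f, g, hf, hfg, hg⟩ := h
  refine ⟨tensorMap f LinearMap.id, tensorMap g LinearMap.id, ?_, ?_, ?_⟩
  · exact Module.Flat.rTensor_preserves_injective_linearMap (M := L) (f.restrictScalars k) hf
  · exact rTensor_exact (L : Type u) (f := f.restrictScalars k) (g := g.restrictScalars k) hfg hg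
  · exact LinearMap.rTensor_surjective (L : Type u) (g := g.restrictScalars k) hg

end Bialgebra

section Hopf

variable {k : Type u} {A : Type v} [Field k] [Ring A] [HopfAlgebra k A]

/-- The dual module `M* = Hom_k(M, k)`, with `(a f)(x) = f (S(a) x)`. -/
def dual (M : FDModule k A) : FDModule k A :=
  ofRep (Module.Dual k M)
    (AlgHom.ofLinearMap
      (Module.Dual.transpose ∘ₗ M.rep.toLinearMap ∘ₗ HopfAlgebra.antipode k)
      (by ext; simp [Module.Dual.transpose])
      (fun a b => by
        ext f x
        simp [HopfAlgebra.antipode_mul_antidistrib, Module.Dual.transpose]))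

/-- `dim_k Hom_A(M, N)`. -/
def homDim {k : Type u} {A : Type v} [Field k] [Ring A] [Algebra k A] (M N : FDModule k A) : ℤ :=
  (Module.finrank k (M →ₗ[A] N) : ℤ)

theorem homDim_congr {M M' N N' : FDModule k A} (h : M ≈ M') (h' : N ≈ N') :
    homDim M N = homDim M' N' := by
  obtain ⟨e⟩ := h
  obtain ⟨e'⟩ := h'
  let F : (M →ₗ[A] N) ≃ₗ[k] (M' →ₗ[A] N') :=
    { toFun := fun f => e'.toLinearMap ∘ₗ f ∘ₗ e.symm.toLinearMap
      invFun := fun f => e'.symm.toLinearMap ∘ₗ f ∘ₗ e.toLinearMap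
      left_inv := fun f => by ext; simp
      right_inv := fun f => by ext; simp
      map_add' := fun f g => by ext; simp
      map_smul' := fun c f => by
        ext x
        exact (e'.restrictScalars k).map_smul c _ }
  exact congrArg Nat.cast F.finrank_eq

instance (M N : FDModule k A) : Module.Finite k (M →ₗ[A] N) :=
  Module.Finite.of_injective (LinearMap.restrictScalarsₗ k A M N k)
    (LinearMap.restrictScalars_injective k)

theorem homDim_directSum_left (M M' N : FDModule k A) :
    homDim (directSum M M') N = homDim M N + homDim M' N := by
  let F : ((M →ₗ[A] N) × (M' →ₗ[A] N)) ≃ₗ[k] (directSum M M' →ₗ[A] N) :=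
    LinearMap.coprodEquiv k
  have h := F.finrank_eq
  rw [Module.finrank_prod] at h
  unfold homDim
  exact_mod_cast h.symm

theorem homDim_directSum_right (M N N' : FDModule k A) :
    homDim M (directSum N N') = homDim M N + homDim M N' := by
  let F : ((M →ₗ[A] N) × (M →ₗ[A] N')) ≃ₗ[k] (M →ₗ[A] directSum N N') :=
    LinearMap.prodEquiv k
  have h := F.finrank_eq
  rw [Module.finrank_prod] at h
  unfold homDim
  exact_mod_cast h.symm

theorem dual_congr {M N : FDModule k A} (h : M ≈ N) : dual M ≈ dual N := by
  obtain ⟨e⟩ := h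
  refine equiv_of_rep (M := dual M) (N := dual N)
    ((e.symm.restrictScalars k).dualMap) (fun a f => ?_)
  refine LinearMap.ext fun x => ?_
  change (show Module.Dual k M from f) (HopfAlgebra.antipode k a • e.symm x) =
    (show Module.Dual k M from f) (e.symm (HopfAlgebra.antipode k a • x))
  exact congrArg (show Module.Dual k M from f) (e.symm.map_smul _ _).symm

theorem dual_directSum (M N : FDModule k A) :
    dual (directSum M N) ≈ directSum (dual M) (dual N) := by
  refine Setoid.symm (equiv_of_rep (M := directSum (dual M) (dual N)) (N := dual (directSum M N))
    (Module.dualProdDualEquivDual k M N) (fun a f => ?_))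
  exact LinearMap.ext fun x => rfl

end Hopf

end FDModule

/-! ## The Green ring and the Grothendieck ring of a bialgebra -/

section Rings

variable (k : Type u) (A : Type v) [Field k] [Ring A]

/-- Isomorphism classes of finite dimensional `A`-modules. -/
def IsoClass [Algebra k A] : Type (max (u + 1) v) := Quotient (FDModule.isoSetoid k A)

variable {k A} in
/-- The isomorphism class of a module. -/
def IsoClass.of [Algebra k A] (M : FDModule k A) : IsoClass k A := Quotient.mk _ M

variable [Bialgebra k A]

/-- Isomorphism classes form a monoid under the tensor product. -/
instance : Monoid (IsoClass k A) where
  mul := Quotient.map₂ FDModule.tensor (fun _ _ h _ _ h' => FDModule.tensor_congr h h')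
  one := IsoClass.of (FDModule.unit k A)
  mul_assoc := by
    rintro ⟨M⟩ ⟨N⟩ ⟨P⟩
    exact Quotient.sound (FDModule.tensor_assoc M N P)
  one_mul := by
    rintro ⟨M⟩
    exact Quotient.sound (FDModule.unit_tensor M)
  mul_one := by
    rintro ⟨M⟩
    exact Quotient.sound (FDModule.tensor_unit M)

/-- The ring `F(A)`: the free abelian group on isomorphism classes of finite dimensional modules,
with multiplication `[M][N] = [M ⊗ N]`. -/
abbrev FreeModuleRing := FreeAbelianGroup (IsoClass k A)

variable {k A} in
/-- `[M]` in `F(A)`. -/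
def freeClass (M : FDModule k A) : FreeModuleRing k A := FreeAbelianGroup.of (IsoClass.of M)

theorem freeClass_mul (M N : FDModule k A) :
    freeClass M * freeClass N = freeClass (FDModule.tensor M N) :=
  (FreeAbelianGroup.of_mul_of _ _)

variable {k A} in
theorem freeClass_congr {M N : FDModule k A} (h : M ≈ N) : freeClass M = freeClass N :=
  congrArg FreeAbelianGroup.of (Quotient.sound h)

section ClosureIdeal

variable {X : Type*} [Monoid X] (S : Set (FreeAbelianGroup X))

theorem closure_mul_mem_left
    (h : ∀ (x : X), ∀ s ∈ S, FreeAbelianGroup.of x * s ∈ AddSubgroup.closure S)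
    (a : FreeAbelianGroup X) {b : FreeAbelianGroup X} (hb : b ∈ AddSubgroup.closure S) :
    a * b ∈ AddSubgroup.closure S := by
  induction a using FreeAbelianGroup.induction_on with
  | zero => simp
  | of x =>
    induction hb using AddSubgroup.closure_induction with
    | mem s hs => exact h x s hs
    | zero => simp
    | add s t _ _ hs ht => rw [mul_add]; exact add_mem hs ht
    | neg s _ hs => rw [mul_neg]; exact neg_mem hs
  | neg x hx => rw [neg_mul]; exact neg_mem hx
  | add x y hx hy => rw [add_mul]; exact add_mem hx hy

theorem closure_mul_mem_right
    (h : ∀ (x : X), ∀ s ∈ S, s * FreeAbelianGroup.of x ∈ AddSubgroup.closure S)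
    (a : FreeAbelianGroup X) {b : FreeAbelianGroup X} (hb : b ∈ AddSubgroup.closure S) :
    b * a ∈ AddSubgroup.closure S := by
  induction a using FreeAbelianGroup.induction_on with
  | zero => simp
  | of x =>
    induction hb using AddSubgroup.closure_induction with
    | mem s hs => exact h x s hs
    | zero => simp
    | add s t _ _ hs ht => rw [add_mul]; exact add_mem hs ht
    | neg s _ hs => rw [neg_mul]; exact neg_mem hs
  | neg x hx => rw [mul_neg]; exact neg_mem hx
  | add x y hx hy => rw [mul_add]; exact add_mem hx hy

end ClosureIdeal

/-- The relations `[M ⊕ N] = [M] + [N]`. -/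
def splitRelations : Set (FreeModuleRing k A) :=
  {s | ∃ M N : FDModule k A,
    s = freeClass (FDModule.directSum M N) - freeClass M - freeClass N}

/-- The relations `[Y] = [X] + [Z]` for all short exact sequences `0 → X → Y → Z → 0`. -/
def exactRelations : Set (FreeModuleRing k A) :=
  {s | ∃ X Y Z : FDModule k A, FDModule.IsExtension X Y Z ∧
    s = freeClass Y - freeClass X - freeClass Z}

/-- The ideal of `F(A)` given by the subgroup generated by the relations `[M ⊕ N] = [M] + [N]`. -/
def greenIdeal : Ideal (FreeModuleRing k A) :=
  { AddSubgroup.closure (splitRelations k A) with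
    smul_mem' := fun a b hb => closure_mul_mem_left _ (by
      rintro ⟨L⟩ _ ⟨M, N, rfl⟩
      refine AddSubgroup.subset_closure ⟨L.tensor M, L.tensor N, ?_⟩
      change freeClass L * _ = _
      rw [mul_sub, mul_sub, freeClass_mul, freeClass_mul, freeClass_mul,
        freeClass_congr (FDModule.tensor_directSum L M N)]) a hb }

instance : (greenIdeal k A).IsTwoSided :=
  ⟨fun {b} a hb => closure_mul_mem_right _ (by
      rintro ⟨L⟩ _ ⟨M, N, rfl⟩
      refine AddSubgroup.subset_closure ⟨M.tensor L, N.tensor L, ?_⟩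
      change _ * freeClass L = _
      rw [sub_mul, sub_mul, freeClass_mul, freeClass_mul, freeClass_mul,
        freeClass_congr (FDModule.directSum_tensor L M N)]) a hb⟩

/-- The ideal of `F(A)` given by the subgroup generated by the relations `[Y] = [X] + [Z]` for
short exact sequences. -/
def grothendieckIdeal : Ideal (FreeModuleRing k A) :=
  { AddSubgroup.closure (exactRelations k A) with
    smul_mem' := fun a b hb => closure_mul_mem_left _ (by
      rintro ⟨L⟩ _ ⟨X, Y, Z, h, rfl⟩
      refine AddSubgroup.subset_closure
        ⟨L.tensor X, L.tensor Y, L.tensor Z, h.tensor_left L, ?_⟩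
      change freeClass L * _ = _
      rw [mul_sub, mul_sub, freeClass_mul, freeClass_mul, freeClass_mul]) a hb }

instance : (grothendieckIdeal k A).IsTwoSided :=
  ⟨fun {b} a hb => closure_mul_mem_right _ (by
      rintro ⟨L⟩ _ ⟨X, Y, Z, h, rfl⟩
      refine AddSubgroup.subset_closure
        ⟨X.tensor L, Y.tensor L, Z.tensor L, h.tensor_right L, ?_⟩
      change _ * freeClass L = _
      rw [sub_mul, sub_mul, freeClass_mul, freeClass_mul, freeClass_mul]) a hb⟩

/-- The Green ring `r(A)`. -/
abbrev GreenRing := FreeModuleRing k A ⧸ greenIdeal k A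

/-- The Grothendieck ring `G₀(A)`. -/
abbrev GrothendieckRing := FreeModuleRing k A ⧸ grothendieckIdeal k A

variable {k A} in
/-- The class `[M]` in the Green ring. -/
def greenClass (M : FDModule k A) : GreenRing k A := Ideal.Quotient.mk _ (freeClass M)

variable {k A} in
/-- The class `[M]` in the Grothendieck ring. -/
def grothendieckClass (M : FDModule k A) : GrothendieckRing k A :=
  Ideal.Quotient.mk _ (freeClass M)

theorem greenIdeal_le : greenIdeal k A ≤ grothendieckIdeal k A := by
  change AddSubgroup.closure (splitRelations k A) ≤ AddSubgroup.closure (exactRelations k A)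
  refine AddSubgroup.closure_mono ?_
  rintro _ ⟨M, N, rfl⟩
  exact ⟨M, FDModule.directSum M N, N, FDModule.isExtension_directSum M N, rfl⟩

/-- The natural ring homomorphism `r(A) → G₀(A)`, `[M] ↦ [M]`. -/
def greenToGrothendieck : GreenRing k A →+* GrothendieckRing k A :=
  Ideal.Quotient.lift (greenIdeal k A) (Ideal.Quotient.mk (grothendieckIdeal k A))
    (fun _ ha => Ideal.Quotient.eq_zero_iff_mem.mpr (greenIdeal_le k A ha))

@[simp]
theorem greenToGrothendieck_class (M : FDModule k A) :
    greenToGrothendieck k A (greenClass M) = grothendieckClass M := rfl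

variable {k A} in
theorem greenClass_mul (M N : FDModule k A) :
    greenClass M * greenClass N = greenClass (M.tensor N) := by
  unfold greenClass
  rw [← map_mul, freeClass_mul]

variable {k A} in
theorem greenClass_directSum (M N : FDModule k A) :
    greenClass (M.directSum N) = greenClass M + greenClass N := by
  unfold greenClass
  rw [← map_add, Ideal.Quotient.mk_eq_mk_iff_sub_mem, ← sub_sub]
  exact AddSubgroup.subset_closure ⟨M, N, rfl⟩

/-- The subgroup `𝒫` of `r(A)` generated by the classes of the finite dimensional indecomposable
projective modules. -/
def projectiveSubgroup : AddSubgroup (GreenRing k A) :=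
  AddSubgroup.closure {x | ∃ P : FDModule k A,
    P.IsIndecomposable ∧ Module.Projective A P ∧ x = greenClass P}

variable {k A} in
/-- An additive invariant of modules descends to the Green ring. -/
def greenLift {B : Type*} [AddCommGroup B] (f : FDModule k A → B)
    (hf : ∀ M N, M ≈ N → f M = f N)
    (hadd : ∀ M N, f (FDModule.directSum M N) = f M + f N) : GreenRing k A →+ B :=
  QuotientAddGroup.lift (greenIdeal k A).toAddSubgroup
    (FreeAbelianGroup.lift (fun x : IsoClass k A => Quotient.lift f hf x)) (by
      change AddSubgroup.closure (splitRelations k A) ≤ AddMonoidHom.ker _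
      rw [AddSubgroup.closure_le]
      rintro _ ⟨M, N, rfl⟩
      have h (L : FDModule k A) : FreeAbelianGroup.lift
          (fun x : IsoClass k A => Quotient.lift f hf x) (freeClass L) = f L :=
        FreeAbelianGroup.lift_apply_of _ _
      simp only [SetLike.mem_coe, AddMonoidHom.mem_ker, map_sub, h, hadd]
      abel)

variable {k A} in
@[simp]
theorem greenLift_class {B : Type*} [AddCommGroup B] (f : FDModule k A → B)
    (hf : ∀ M N, M ≈ N → f M = f N)
    (hadd : ∀ M N, f (FDModule.directSum M N) = f M + f N) (M : FDModule k A) :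
    greenLift f hf hadd (greenClass M) = f M :=
  FreeAbelianGroup.lift_apply_of _ _

variable {k A} in
theorem green_hom_ext {B : Type*} [AddCommGroup B] {f g : GreenRing k A →+ B}
    (h : ∀ M : FDModule k A, f (greenClass M) = g (greenClass M)) : f = g := by
  have h' : f.comp (Ideal.Quotient.mk (greenIdeal k A)).toAddMonoidHom =
      g.comp (Ideal.Quotient.mk (greenIdeal k A)).toAddMonoidHom :=
    FreeAbelianGroup.lift_ext _ _ (by rintro ⟨M⟩; exact h M)
  ext x
  obtain ⟨x, rfl⟩ := Ideal.Quotient.mk_surjective x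
  exact DFunLike.congr_fun h' x

end Rings

section Form

variable (k : Type u) (A : Type v) [Field k] [Ring A] [HopfAlgebra k A]

variable {k A} in
/-- The additive map `[Y] ↦ dim Hom_A(X, Y*)` on the Green ring. -/
def greenFormRight (X : FDModule k A) : GreenRing k A →+ ℤ :=
  greenLift (fun Y => FDModule.homDim X Y.dual)
    (fun _ _ h => FDModule.homDim_congr (Setoid.refl X) (FDModule.dual_congr h))
    (fun M N => by
      rw [FDModule.homDim_congr (Setoid.refl X) (FDModule.dual_directSum M N),
        FDModule.homDim_directSum_right])

variable {k A} in
@[simp]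
theorem greenFormRight_class (X Y : FDModule k A) :
    greenFormRight X (greenClass Y) = FDModule.homDim X Y.dual :=
  greenLift_class _ _ _ Y

/-- The bilinear form on the Green ring of a Hopf algebra with
`([X], [Y]) = dim Hom_A(X, Y*)`. -/
def greenForm : GreenRing k A →+ GreenRing k A →+ ℤ :=
  greenLift greenFormRight
    (fun M N h => green_hom_ext (fun Y => by
      rw [greenFormRight_class, greenFormRight_class]
      exact FDModule.homDim_congr h (Setoid.refl _)))
    (fun M N => green_hom_ext (fun Y => by
      rw [AddMonoidHom.add_apply, greenFormRight_class, greenFormRight_class,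
        greenFormRight_class, FDModule.homDim_directSum_left]))

variable {k A} in
@[simp]
theorem greenForm_class (X Y : FDModule k A) :
    greenForm k A (greenClass X) (greenClass Y) = FDModule.homDim X Y.dual := by
  unfold greenForm
  rw [greenLift_class, greenFormRight_class]

/-- The orthogonal complement `𝒫^⊥ = {x | (x, y) = 0 for all y ∈ 𝒫}`. -/
def projectiveOrthogonal : AddSubgroup (GreenRing k A) where
  carrier := {x | ∀ y ∈ projectiveSubgroup k A, greenForm k A x y = 0}
  zero_mem' := fun y _ => by simp
  add_mem' := fun {a b} ha hb y hy => by simp [ha y hy, hb y hy]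
  neg_mem' := fun {a} ha y hy => by simp [ha y hy]

end Form

/-! ## The `q`-binomial theorem at a root of unity -/

section QBinomial

variable {k : Type u} [Field k]

/-- Gaussian binomial coefficients, by the Pascal recursion. -/
def gaussBinom (q : k) : ℕ → ℕ → k
  | _, 0 => 1
  | 0, _ + 1 => 0
  | m + 1, j + 1 => gaussBinom q m j + q ^ (j + 1) * gaussBinom q m (j + 1)

theorem gaussBinom_zero_right (q : k) (m : ℕ) : gaussBinom q m 0 = 1 := by
  cases m <;> rfl

theorem gaussBinom_of_lt (q : k) : ∀ {m j : ℕ}, m < j → gaussBinom q m j = 0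
  | 0, _ + 1, _ => rfl
  | m + 1, j + 1, h => by
    rw [gaussBinom, gaussBinom_of_lt q (by omega : m < j),
      gaussBinom_of_lt q (by omega : m < j + 1), mul_zero, add_zero]

theorem gaussBinom_self (q : k) : ∀ m : ℕ, gaussBinom q m m = 1
  | 0 => rfl
  | m + 1 => by
    rw [gaussBinom, gaussBinom_self q m, gaussBinom_of_lt q (Nat.lt_succ_self m), mul_zero,
      add_zero]

theorem gaussBinom_absorb (q : k) : ∀ m j : ℕ,
    (q ^ (j + 1) - 1) * gaussBinom q (m + 1) (j + 1) = (q ^ (m + 1) - 1) * gaussBinom q m j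
  | 0, 0 => by simp [gaussBinom]
  | 0, j + 1 => by simp [gaussBinom]
  | m + 1, 0 => by
    have h := gaussBinom_absorb q m 0
    have h3 : gaussBinom q (m + 1 + 1) (0 + 1) =
      gaussBinom q (m + 1) 0 + q ^ (0 + 1) * gaussBinom q (m + 1) (0 + 1) := rfl
    rw [h3, gaussBinom_zero_right]
    rw [gaussBinom_zero_right] at h
    linear_combination q * h
  | m + 1, j + 1 => by
    have h1 := gaussBinom_absorb q m (j + 1)
    have h2 := gaussBinom_absorb q m j
    have h3 : gaussBinom q (m + 1) (j + 1) =
      gaussBinom q m j + q ^ (j + 1) * gaussBinom q m (j + 1) := by rw [gaussBinom]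
    rw [gaussBinom]
    rw [pow_succ q (j + 1)] at *
    linear_combination q ^ (j + 1) * q * h1 + q * h2 - q * (q ^ (m + 1) - 1) * h3

variable {B : Type*} [Ring B] [Algebra k B]

theorem qcomm_pow {q : k} {a c : B} (h : c * a = q • (a * c)) (j : ℕ) :
    c * a ^ j = q ^ j • (a ^ j * c) := by
  induction j with
  | zero => simp
  | succ j ih =>
    rw [pow_succ, ← mul_assoc, ih, smul_mul_assoc, mul_assoc, h, mul_smul_comm, smul_smul,
      pow_succ, mul_assoc]

theorem qbinomial {q : k} {a c : B} (h : c * a = q • (a * c)) (m : ℕ) :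
    (a + c) ^ m = ∑ j ∈ Finset.range (m + 1), gaussBinom q m j • (a ^ j * c ^ (m - j)) := by
  induction m with
  | zero => simp [gaussBinom]
  | succ m ih =>
    rw [pow_succ', ih, add_mul, Finset.mul_sum, Finset.mul_sum]
    have h1 : ∀ j ∈ Finset.range (m + 1), a * gaussBinom q m j • (a ^ j * c ^ (m - j)) =
        gaussBinom q m j • (a ^ (j + 1) * c ^ (m - j)) := by
      intro j _
      rw [mul_smul_comm, ← mul_assoc, pow_succ']
    have h2 : ∀ j ∈ Finset.range (m + 1), c * gaussBinom q m j • (a ^ j * c ^ (m - j)) =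
        (q ^ j * gaussBinom q m j) • (a ^ j * c ^ (m + 1 - j)) := by
      intro j hj
      have : m + 1 - j = (m - j) + 1 := by
        have := Finset.mem_range.mp hj
        omega
      rw [mul_smul_comm, ← mul_assoc, qcomm_pow h, smul_mul_assoc, smul_smul, this, pow_succ' c,
        mul_assoc, mul_comm (q ^ j)]
    rw [Finset.sum_congr rfl h1, Finset.sum_congr rfl h2,
      Finset.sum_range_succ' _ (m + 1)]
    have h3 : ∑ j ∈ Finset.range (m + 1), (q ^ j * gaussBinom q m j) • (a ^ j * c ^ (m + 1 - j)) =
        ∑ j ∈ Finset.range (m + 1),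
          (q ^ (j + 1) * gaussBinom q m (j + 1)) • (a ^ (j + 1) * c ^ (m - j)) + c ^ (m + 1) := by
      have := Finset.sum_range_succ'
        (fun j => (q ^ j * gaussBinom q m j) • (a ^ j * c ^ (m + 1 - j))) (m + 1)
      rw [Finset.sum_range_succ, gaussBinom_of_lt q (Nat.lt_succ_self m)] at this
      simpa [gaussBinom_zero_right, Nat.add_sub_add_right] using this
    rw [h3, ← add_assoc, ← Finset.sum_add_distrib]
    congr 1
    · refine Finset.sum_congr rfl fun j _ => ?_
      rw [gaussBinom, add_smul, Nat.add_sub_add_right]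
    · simp [gaussBinom_zero_right]

/-- If `c a = q a c` and `q` is a primitive `n`-th root of unity, then
`(a + c)^n = a^n + c^n`. -/
theorem add_pow_of_qcomm {q : k} {n : ℕ} (hn : 0 < n) (hq : IsPrimitiveRoot q n) {a c : B}
    (h : c * a = q • (a * c)) : (a + c) ^ n = a ^ n + c ^ n := by
  obtain ⟨m, rfl⟩ : ∃ m, n = m + 1 := ⟨n - 1, by omega⟩
  rw [qbinomial h, Finset.sum_range_succ, Finset.sum_range_succ', Finset.sum_eq_zero]
  · simp [gaussBinom_zero_right, gaussBinom_self, add_comm]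
  · intro j hj
    have hj' := Finset.mem_range.mp hj
    have h1 := gaussBinom_absorb q m j
    rw [hq.pow_eq_one, sub_self, zero_mul] at h1
    have h2 : q ^ (j + 1) - 1 ≠ 0 :=
      sub_ne_zero.mpr (hq.pow_ne_one_of_pos_of_lt (by omega) (by omega))
    rw [(mul_eq_zero.mp h1).resolve_left h2, zero_smul]

theorem qcomm_mul_pow {q : k} {a c : B} (h : c * a = q • (a * c)) (m : ℕ) :
    (a * c) ^ m = q ^ (m * (m - 1) / 2) • (a ^ m * c ^ m) := by
  induction m with
  | zero => simp
  | succ m ih =>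
    have h1 : c ^ m * a = q ^ m • (a * c ^ m) := by
      clear ih
      induction m with
      | zero => simp
      | succ m ih =>
        rw [pow_succ', mul_assoc, ih, mul_smul_comm, ← mul_assoc, h, smul_mul_assoc, smul_smul,
          pow_succ, mul_assoc]
    have h2 : (m + 1) * (m + 1 - 1) / 2 = m * (m - 1) / 2 + m := by
      rw [← Finset.sum_range_id_mul_two, ← Finset.sum_range_id_mul_two, Nat.mul_div_cancel _ two_pos,
        Nat.mul_div_cancel _ two_pos, Finset.sum_range_succ]
    rw [pow_succ, ih, smul_mul_assoc, h2, pow_add, mul_smul, pow_succ a, pow_succ c]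
    congr 1
    rw [mul_assoc, ← mul_assoc (c ^ m), h1, smul_mul_assoc, mul_smul_comm]
    simp only [mul_assoc]

theorem neg_one_pow_mul_root {q : k} {n : ℕ} (hn : 0 < n) (hq : IsPrimitiveRoot q n) :
    (-1) ^ n * q ^ (n * (n - 1) / 2) = -1 := by
  rcases Nat.even_or_odd' n with ⟨m, rfl | rfl⟩
  · have h1 : q ^ m = -1 := by
      have h2 : (q ^ m) ^ 2 = 1 := by rw [← pow_mul, mul_comm, hq.pow_eq_one]
      rcases eq_or_eq_neg_of_sq_eq_sq _ _ (h2.trans (one_pow 2).symm) with h | h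
      · exact absurd h (hq.pow_ne_one_of_pos_of_lt (by omega) (by omega))
      · exact h
    have h2 : 2 * m * (2 * m - 1) / 2 = m * (2 * m - 1) := by
      rw [mul_assoc, Nat.mul_div_cancel_left _ two_pos]
    rw [h2, pow_mul q, h1, ← pow_add]
    exact Odd.neg_one_pow ⟨2 * m - 1, by omega⟩
  · have h2 : (2 * m + 1) * (2 * m + 1 - 1) / 2 = (2 * m + 1) * m := by
      rw [Nat.add_sub_cancel, mul_left_comm, Nat.mul_div_cancel_left _ two_pos]
    rw [h2, pow_mul, hq.pow_eq_one, one_pow, mul_one]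
    exact Odd.neg_one_pow ⟨m, rfl⟩

end QBinomial

/-! ## Group data and the associated Hopf algebras -/

/-- A group datum `(G, χ, g, μ)`: a character `χ` of `G`, a central element `g` and a scalar `μ`
such that `χ^n = 1` or `μ (g^n - 1) = 0` in `k[G]`, where `n` is the order of `χ(g)`. -/
structure GroupDatum (k : Type u) (G : Type w) [Field k] [Group G] where
  χ : G →* kˣ
  g : G
  g_mem_center : g ∈ Subgroup.center G
  μ : k
  compat : χ ^ orderOf (χ g) = 1 ∨
    μ • (MonoidAlgebra.of k G g ^ orderOf (χ g) - 1) = 0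

namespace GroupDatum

variable {k : Type u} {G : Type w} [Field k] [Group G] (D : GroupDatum k G)

/-- The order `n` of `χ(g)`. -/
def n : ℕ := orderOf (D.χ D.g)

/-- The datum is of non-nilpotent type: `μ (g^n - 1) ≠ 0` and `χ^n = 1`. -/
def IsNonNilpotent : Prop :=
  D.μ • (MonoidAlgebra.of k G D.g ^ D.n - 1) ≠ 0 ∧ D.χ ^ D.n = 1

/-- Free generators: `none` stands for `y` and `some h` for `h ∈ G`. -/
abbrev FreeGen (k : Type u) (G : Type w) [Field k] := FreeAlgebra k (Option G)

/-- The defining relations: those of `k[G]`, `y^n = μ (g^n - 1)` and `y h = χ(h) h y`. -/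
inductive Rel : FreeGen k G → FreeGen k G → Prop
  | one : Rel (FreeAlgebra.ι k (some 1)) 1
  | mul (h h' : G) : Rel (FreeAlgebra.ι k (some (h * h')))
      (FreeAlgebra.ι k (some h) * FreeAlgebra.ι k (some h'))
  | pow : Rel (FreeAlgebra.ι k none ^ D.n) (D.μ • (FreeAlgebra.ι k (some D.g) ^ D.n - 1))
  | comm (h : G) : Rel (FreeAlgebra.ι k none * FreeAlgebra.ι k (some h))
      ((D.χ h : k) • (FreeAlgebra.ι k (some h) * FreeAlgebra.ι k none))

/-- The algebra `H_D` generated by `y` and the elements of `G`. -/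
def Alg : Type (max u w) := RingQuot D.Rel

instance : Ring D.Alg := inferInstanceAs (Ring (RingQuot D.Rel))
instance : Algebra k D.Alg := inferInstanceAs (Algebra k (RingQuot D.Rel))

/-- The generator `y`. -/
def y : D.Alg := RingQuot.mkAlgHom k D.Rel (FreeAlgebra.ι k none)

/-- The generators `h ∈ G`. -/
def grp : G →* D.Alg where
  toFun h := RingQuot.mkAlgHom k D.Rel (FreeAlgebra.ι k (some h))
  map_one' := (RingQuot.mkAlgHom_rel k (Rel.one (D := D))).trans (map_one _)
  map_mul' h h' := (RingQuot.mkAlgHom_rel k (Rel.mul (D := D) h h')).trans (map_mul _ _ _)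

theorem y_pow : D.y ^ D.n = D.μ • (D.grp D.g ^ D.n - 1) := by
  have h := RingQuot.mkAlgHom_rel k (Rel.pow (D := D))
  rw [map_pow, map_smul, map_sub, map_pow, map_one] at h
  exact h

theorem y_mul_grp (h : G) : D.y * D.grp h = (D.χ h : k) • (D.grp h * D.y) := by
  have h := RingQuot.mkAlgHom_rel k (Rel.comm (D := D) h)
  rw [map_mul, map_smul, map_mul] at h
  exact h

section Lift

variable {B : Type*} [Ring B] [Algebra k B]

/-- The universal property of `H_D`. -/
def lift (f : G →* B) (b : B) (hpow : b ^ D.n = D.μ • (f D.g ^ D.n - 1))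
    (hcomm : ∀ h, b * f h = (D.χ h : k) • (f h * b)) : D.Alg →ₐ[k] B :=
  RingQuot.liftAlgHom k
    ⟨FreeAlgebra.lift k (fun o : Option G => o.elim b f), by
      rintro _ _ (_ | ⟨h, h'⟩ | _ | h)
      · simp
      · simp
      · simpa using hpow
      · simpa using hcomm h⟩

@[simp]
theorem lift_y (f : G →* B) (b : B) (hpow hcomm) : D.lift f b hpow hcomm D.y = b := by
  refine (RingQuot.liftAlgHom_mkAlgHom_apply _ _ _ _).trans ?_
  simp

@[simp]
theorem lift_grp (f : G →* B) (b : B) (hpow hcomm) (h : G) :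
    D.lift f b hpow hcomm (D.grp h) = f h := by
  refine (RingQuot.liftAlgHom_mkAlgHom_apply _ _ _ _).trans ?_
  simp

variable {D} in
theorem algHom_ext {φ ψ : D.Alg →ₐ[k] B} (hy : φ D.y = ψ D.y)
    (hg : ∀ h, φ (D.grp h) = ψ (D.grp h)) : φ = ψ := by
  refine RingQuot.ringQuot_ext' k φ ψ (FreeAlgebra.hom_ext (funext fun o => ?_))
  cases o with
  | none => exact hy
  | some h => exact hg h

end Lift

variable {D} in
/-- An element of `H_D` lies in every subalgebra that contains the generators. -/
theorem alg_induction {p : D.Alg → Prop} (x : D.Alg) (hy : p D.y) (hg : ∀ h, p (D.grp h))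
    (hs : ∀ c : k, p (algebraMap k D.Alg c)) (ha : ∀ a b, p a → p b → p (a + b))
    (hm : ∀ a b, p a → p b → p (a * b)) : p x := by
  let S : Subalgebra k D.Alg :=
    { carrier := {x | p x}
      mul_mem' := fun {a b} => hm a b
      add_mem' := fun {a b} => ha a b
      algebraMap_mem' := hs }
  let φ : D.Alg →ₐ[k] S := D.lift
    { toFun := fun h => ⟨D.grp h, hg h⟩
      map_one' := Subtype.ext (map_one D.grp)
      map_mul' := fun h h' => Subtype.ext (map_mul D.grp h h') }
    ⟨D.y, hy⟩ (Subtype.ext (by simpa using D.y_pow))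
    (fun h => Subtype.ext (by simpa using D.y_mul_grp h))
  have h : S.val.comp φ = AlgHom.id k D.Alg :=
    algHom_ext (by simp [φ]) (fun h => by simp [φ])
  have h2 := DFunLike.congr_fun h x
  rw [← show (φ x : D.Alg) = x from h2]
  exact (φ x).2


theorem isPrimitiveRoot : IsPrimitiveRoot (D.χ D.g : k) D.n :=
  (IsPrimitiveRoot.coe_units_iff).mpr (IsPrimitiveRoot.orderOf _)

theorem grp_g_comm (h : G) : D.grp D.g * D.grp h = D.grp h * D.grp D.g := by
  rw [← map_mul, ← map_mul, Subgroup.mem_center_iff.mp D.g_mem_center h]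

theorem grp_inv_mul_y (h : G) : D.grp h⁻¹ * D.y = (D.χ h : k) • (D.y * D.grp h⁻¹) := by
  rw [D.y_mul_grp, smul_smul, map_inv D.χ, Units.mul_inv, one_smul]

/-- `h ↦ h ⊗ h`. -/
def comulGrp : G →* D.Alg ⊗[k] D.Alg where
  toFun h := D.grp h ⊗ₜ D.grp h
  map_one' := by simp [Algebra.TensorProduct.one_def]
  map_mul' h h' := by simp

@[simp]
theorem comulGrp_apply (h : G) : D.comulGrp h = D.grp h ⊗ₜ D.grp h := rfl

/-- `h ↦ h⁻¹` as a homomorphism to the opposite algebra. -/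
def antipodeGrp : G →* D.Algᵐᵒᵖ where
  toFun h := MulOpposite.op (D.grp h⁻¹)
  map_one' := by simp
  map_mul' h h' := by simp [← MulOpposite.op_mul]

@[simp]
theorem antipodeGrp_apply (h : G) : D.antipodeGrp h = MulOpposite.op (D.grp h⁻¹) := rfl

section Hopf

variable [Finite G]

theorem n_pos : 0 < D.n := orderOf_pos_iff.mpr (MonoidHom.isOfFinOrder D.χ (isOfFinOrder_of_finite D.g))

/-- The comultiplication: `Δ(y) = y ⊗ g + 1 ⊗ y` and `Δ(h) = h ⊗ h`. -/
def comulHom : D.Alg →ₐ[k] D.Alg ⊗[k] D.Alg :=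
  D.lift D.comulGrp (D.y ⊗ₜ D.grp D.g + 1 ⊗ₜ D.y)
    (by
      rw [add_pow_of_qcomm D.n_pos D.isPrimitiveRoot]
      · rw [comulGrp_apply, Algebra.TensorProduct.tmul_pow, Algebra.TensorProduct.tmul_pow,
          Algebra.TensorProduct.tmul_pow, D.y_pow, one_pow, TensorProduct.tmul_smul,
          ← TensorProduct.smul_tmul', ← smul_add, TensorProduct.sub_tmul, TensorProduct.tmul_sub,
          Algebra.TensorProduct.one_def]
        congr 1
        abel
      · simp only [Algebra.TensorProduct.tmul_mul_tmul, one_mul, mul_one, D.y_mul_grp,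
          TensorProduct.tmul_smul])
    (fun h => by
      rw [comulGrp_apply, add_mul, mul_add, Algebra.TensorProduct.tmul_mul_tmul,
        Algebra.TensorProduct.tmul_mul_tmul, Algebra.TensorProduct.tmul_mul_tmul,
        Algebra.TensorProduct.tmul_mul_tmul, D.y_mul_grp, D.grp_g_comm, one_mul, mul_one,
        TensorProduct.tmul_smul, ← TensorProduct.smul_tmul', smul_add])

/-- The counit: `ε(y) = 0` and `ε(h) = 1`. -/
def counitHom : D.Alg →ₐ[k] k :=
  D.lift 1 0 (by simp [zero_pow D.n_pos.ne']) (fun h => by simp)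

@[simp]
theorem comulHom_y : D.comulHom D.y = D.y ⊗ₜ D.grp D.g + 1 ⊗ₜ D.y := D.lift_y _ _ _ _

@[simp]
theorem comulHom_grp (h : G) : D.comulHom (D.grp h) = D.grp h ⊗ₜ D.grp h :=
  D.lift_grp _ _ _ _ h

@[simp]
theorem counitHom_y : D.counitHom D.y = 0 := D.lift_y _ _ _ _

@[simp]
theorem counitHom_grp (h : G) : D.counitHom (D.grp h) = 1 := D.lift_grp _ _ _ _ h

instance : Bialgebra k D.Alg :=
  Bialgebra.ofAlgHom D.comulHom D.counitHom
    (algHom_ext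
      (by
        simp [TensorProduct.add_tmul, TensorProduct.tmul_add, Algebra.TensorProduct.one_def,
          add_assoc])
      (fun h => by simp))
    (algHom_ext (by simp) (fun h => by simp))
    (algHom_ext (by simp) (fun h => by simp))

/-- The antipode as an algebra homomorphism to the opposite algebra: `S(y) = -y g⁻¹` and
`S(h) = h⁻¹`. -/
def antipodeHom : D.Alg →ₐ[k] D.Algᵐᵒᵖ :=
  D.lift D.antipodeGrp (MulOpposite.op (-(D.y * D.grp D.g⁻¹)))
    (by
      apply MulOpposite.unop_injective
      rw [antipodeGrp_apply, ← MulOpposite.op_pow, ← MulOpposite.op_pow, ← MulOpposite.op_one,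
        ← MulOpposite.op_sub, ← MulOpposite.op_smul, MulOpposite.unop_op, MulOpposite.unop_op,
        neg_pow, qcomm_mul_pow (D.grp_inv_mul_y D.g), D.y_pow]
      have h1 : ((-1 : D.Alg)) ^ D.n = algebraMap k D.Alg ((-1) ^ D.n) := by simp
      have h2 : (D.grp D.g) ^ D.n * (D.grp D.g⁻¹) ^ D.n = 1 := by
        rw [← map_pow, ← map_pow, ← map_mul, inv_pow, mul_inv_cancel, map_one]
      rw [h1, ← Algebra.smul_def, smul_smul, neg_one_pow_mul_root D.n_pos D.isPrimitiveRoot,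
        smul_mul_assoc, sub_mul, h2, one_mul, neg_one_smul, ← smul_neg, neg_sub])
    (fun h => by
      apply MulOpposite.unop_injective
      rw [antipodeGrp_apply, ← MulOpposite.op_mul, ← MulOpposite.op_mul, ← MulOpposite.op_smul,
        MulOpposite.unop_op, MulOpposite.unop_op, mul_neg, neg_mul, smul_neg, ← mul_assoc,
        grp_inv_mul_y, smul_mul_assoc, mul_assoc, mul_assoc]
      congr 3
      rw [← map_mul, ← map_mul]
      congr 1
      have := Subgroup.mem_center_iff.mp (inv_mem D.g_mem_center) h⁻¹
      exact this)

/-- The antipode as a linear map. -/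
def antipodeLin : D.Alg →ₗ[k] D.Alg :=
  (MulOpposite.opLinearEquiv k).symm.toLinearMap ∘ₗ D.antipodeHom.toLinearMap

theorem antipodeLin_y : D.antipodeLin D.y = -(D.y * D.grp D.g⁻¹) :=
  congrArg MulOpposite.unop (D.lift_y _ _ _ _)

theorem antipodeLin_grp (h : G) : D.antipodeLin (D.grp h) = D.grp h⁻¹ :=
  congrArg MulOpposite.unop (D.lift_grp _ _ _ _ h)

theorem antipodeLin_mul (a b : D.Alg) :
    D.antipodeLin (a * b) = D.antipodeLin b * D.antipodeLin a :=
  congrArg MulOpposite.unop (map_mul D.antipodeHom a b)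

theorem antipodeLin_algebraMap (c : k) :
    D.antipodeLin (algebraMap k D.Alg c) = algebraMap k D.Alg c :=
  congrArg MulOpposite.unop (D.antipodeHom.commutes c)

theorem antipode_left (a : D.Alg) :
    LinearMap.mul' k D.Alg (D.antipodeLin.rTensor D.Alg (D.comulHom a)) =
      algebraMap k D.Alg (D.counitHom a) := by
  induction a using alg_induction with
  | hy =>
    have : D.grp D.g⁻¹ * D.grp D.g = 1 := by rw [← map_mul, inv_mul_cancel, map_one]
    have h1 : D.antipodeLin 1 = 1 := by simpa using D.antipodeLin_algebraMap 1
    simp [antipodeLin_y, mul_assoc, this, h1]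
  | hg h =>
    simp [antipodeLin_grp, ← map_mul]
  | hs c =>
    simp [Algebra.TensorProduct.algebraMap_apply, antipodeLin_algebraMap]
  | ha a b ha hb => simp only [map_add, ha, hb]
  | hm a b ha hb =>
    have key : ∀ s t : D.Alg ⊗[k] D.Alg, ∀ c : k,
        LinearMap.mul' k D.Alg (D.antipodeLin.rTensor D.Alg s) = algebraMap k D.Alg c →
        LinearMap.mul' k D.Alg (D.antipodeLin.rTensor D.Alg (s * t)) =
          c • LinearMap.mul' k D.Alg (D.antipodeLin.rTensor D.Alg t) := by
      intro s t c hs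
      induction t using TensorProduct.induction_on with
      | zero => simp
      | add t t' ht ht' => simp only [mul_add, map_add, smul_add, ht, ht']
      | tmul u v =>
        have h1 : LinearMap.mul' k D.Alg (D.antipodeLin.rTensor D.Alg (s * (u ⊗ₜ v))) =
            D.antipodeLin u * LinearMap.mul' k D.Alg (D.antipodeLin.rTensor D.Alg s) * v := by
          clear hs
          induction s using TensorProduct.induction_on with
          | zero => simp
          | add s s' hs hs' => simp only [add_mul, mul_add, map_add, hs, hs']
          | tmul p r => simp [antipodeLin_mul, mul_assoc]
        rw [h1, hs, ← Algebra.commutes, mul_assoc, ← Algebra.smul_def]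
        simp
    rw [map_mul, key _ _ _ ha, hb, map_mul, map_mul, Algebra.smul_def]

theorem antipode_right (a : D.Alg) :
    LinearMap.mul' k D.Alg (D.antipodeLin.lTensor D.Alg (D.comulHom a)) =
      algebraMap k D.Alg (D.counitHom a) := by
  induction a using alg_induction with
  | hy => simp [antipodeLin_y, antipodeLin_grp]
  | hg h =>
    simp [antipodeLin_grp, ← map_mul]
  | hs c =>
    have h1 : D.antipodeLin 1 = 1 := by simpa using D.antipodeLin_algebraMap 1
    simp [Algebra.TensorProduct.algebraMap_apply, h1]
  | ha a b ha hb => simp only [map_add, ha, hb]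
  | hm a b ha hb =>
    have key : ∀ s t : D.Alg ⊗[k] D.Alg, ∀ c : k,
        LinearMap.mul' k D.Alg (D.antipodeLin.lTensor D.Alg t) = algebraMap k D.Alg c →
        LinearMap.mul' k D.Alg (D.antipodeLin.lTensor D.Alg (s * t)) =
          c • LinearMap.mul' k D.Alg (D.antipodeLin.lTensor D.Alg s) := by
      intro s t c ht
      induction s using TensorProduct.induction_on with
      | zero => simp
      | add s s' hs hs' => simp only [add_mul, map_add, smul_add, hs, hs']
      | tmul u v =>
        have h1 : LinearMap.mul' k D.Alg (D.antipodeLin.lTensor D.Alg ((u ⊗ₜ v) * t)) =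
            u * LinearMap.mul' k D.Alg (D.antipodeLin.lTensor D.Alg t) * D.antipodeLin v := by
          clear ht
          induction t using TensorProduct.induction_on with
          | zero => simp
          | add t t' ht ht' => simp only [add_mul, mul_add, map_add, ht, ht']
          | tmul p r => simp [antipodeLin_mul, mul_assoc]
        rw [h1, ht, ← Algebra.commutes, mul_assoc, ← Algebra.smul_def]
        simp
    rw [map_mul, key _ _ _ hb, ha, map_mul, map_mul, Algebra.smul_def, Algebra.commutes]

instance : HopfAlgebra k D.Alg where
  antipode := D.antipodeLin
  mul_antipode_rTensor_comul := LinearMap.ext D.antipode_left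
  mul_antipode_lTensor_comul := LinearMap.ext D.antipode_right

theorem comul_y : Coalgebra.comul (R := k) D.y = D.y ⊗ₜ D.grp D.g + 1 ⊗ₜ D.y := D.comulHom_y

theorem comul_grp (h : G) : Coalgebra.comul (R := k) (D.grp h) = D.grp h ⊗ₜ D.grp h :=
  D.comulHom_grp h

theorem counit_y : Coalgebra.counit (R := k) D.y = 0 := D.counitHom_y

theorem counit_grp (h : G) : Coalgebra.counit (R := k) (D.grp h) = 1 := D.counitHom_grp h

theorem antipode_y : HopfAlgebra.antipode k D.y = -(D.y * D.grp D.g⁻¹) := D.antipodeLin_y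

theorem antipode_grp (h : G) : HopfAlgebra.antipode k (D.grp h) = D.grp h⁻¹ :=
  D.antipodeLin_grp h

end Hopf

/-! ### Simple modules over the group algebra -/

/-- `V` is a simple `k[G]`-module on which `g^n` acts as the identity (`V = V_i`, `i ∈ Ω₀`). -/
def IsSimpleZero (V : FDModule k (MonoidAlgebra k G)) : Prop :=
  IsSimpleModule (MonoidAlgebra k G) V ∧
    ∀ v : V, MonoidAlgebra.of k G (D.g ^ D.n) • v = v

/-- `V` is a simple `k[G]`-module on which `g^n` acts by a scalar `c ≠ 1`
(`V = V_j`, `j ∈ Ω₁`). -/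
def IsSimpleOne (V : FDModule k (MonoidAlgebra k G)) : Prop :=
  IsSimpleModule (MonoidAlgebra k G) V ∧
    ∃ c : k, c ≠ 1 ∧ ∀ v : V, MonoidAlgebra.of k G (D.g ^ D.n) • v = c • v

/-- The one-dimensional `k[G]`-module with character `χ⁻¹`. -/
def invCharModule : FDModule k (MonoidAlgebra k G) :=
  FDModule.ofChar (MonoidAlgebra.lift k k G ((Units.coeHom k).comp D.χ⁻¹))

/-- The class `a` of the one-dimensional module with character `χ⁻¹` in `r(k[G])`. -/
def a : GreenRing k (MonoidAlgebra k G) := greenClass D.invCharModule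

/-- The subring of `r(k[G])` generated by the `[V_i]`, `i ∈ Ω₀`, and the
`(1 + a + ⋯ + a^{n-1}) [V_j]`, `j ∈ Ω₁`. -/
def simpleSubring : Subring (GreenRing k (MonoidAlgebra k G)) :=
  Subring.closure
    ({x | ∃ V : FDModule k (MonoidAlgebra k G), D.IsSimpleZero V ∧ x = greenClass V} ∪
      {x | ∃ V : FDModule k (MonoidAlgebra k G), D.IsSimpleOne V ∧
        x = (∑ l ∈ Finset.range D.n, D.a ^ l) * greenClass V})

end GroupDatum

end

/-! Everything rests on restriction along `k[G] → H`. The group algebra is semisimple by Maschke, so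
restriction kills the relations of exact sequences, and since the elements of `G` are group-like in
`H` it gives a ring homomorphism `D.resHom : G₀(H) → r(k[G])`. The theorem follows once `D.resHom`
is known to be injective with image `D.simpleSubring`.

Injectivity comes from a block decomposition. The element `g^n` is central in `H`, because `χ(g)^n =
1`. On the part of a module `X` where `g^n = 1`, the relation gives `y^n = 0`; filtering by kernels
of `y` shows that in `G₀(H)` this part may be replaced by its restriction with `y` acting as zero
(`zeroExt_res_class`). On the complementary part, an eigenvector of `g` with eigenvalue `c`
satisfies `y^n x = μ(c^n - 1)x` with `μ(c^n - 1) ≠ 0`, so `y` is invertible there, and it multiplies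
eigenvalues of `g` by `χ(g)⁻¹`. The eigenvalues thus fall into orbits of length `n`; with one
representative chosen in each orbit, this part is induced from the sum of the representative
eigenspaces (`isExtension_repInd`). Both pieces depend only on the restriction of `X`, which yields
an additive left inverse `blockLift` of `D.resHom`.

For the image, an induced module restricts to `V ⊕ aV ⊕ ⋯ ⊕ a^{n-1}V` and a module extended by zero
restricts to itself. Together with the block decomposition this gives exactly the stated generators
(`resHom_range`).

For the form, `S²` is conjugation by `g`, so `dim Hom(X, P*) = dim Hom(P, X*)`. For projective `P`
the right side is additive on exact sequences, hence `ker φ ⊆ 𝒫^⊥`. Conversely, modules induced from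
`k[G]` are projective, and Frobenius reciprocity turns the pairing of `X` with the module induced
from `V` into `dim Hom(X, V*)` over `k[G]`. An element `[M] - [N]` of `𝒫^⊥` therefore has `M` and
`N` isomorphic over `k[G]`, and injectivity of `D.resHom` makes its image in `G₀(H)` zero. -/

noncomputable section

universe u v w

/-! ### Submodules, quotients and exactness of `Hom(P, -)` -/

namespace FDModule

section Algebra

variable {k : Type u} {A : Type v} [Field k] [Ring A] [Algebra k A]

/-- A submodule of a finite dimensional module. -/
def ofSub (M : FDModule k A) (p : Submodule A M) : FDModule k A :=
  { carrier := p
    finite := Module.Finite.of_injective (p.subtype.restrictScalars k) p.injective_subtype }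

/-- A quotient of a finite dimensional module. -/
def ofQuot (M : FDModule k A) (p : Submodule A M) : FDModule k A :=
  { carrier := (M : Type u) ⧸ p
    finite := Module.Finite.of_surjective (p.mkQ.restrictScalars k) p.mkQ_surjective }

theorem directSum_of_isCompl (M : FDModule k A) {p q : Submodule A M} (h : IsCompl p q) :
    directSum (M.ofSub p) (M.ofSub q) ≈ M :=
  ⟨Submodule.prodEquivOfIsCompl p q h⟩

theorem finrank_ofSub_lt (M : FDModule k A) {p : Submodule A M} (h : p ≠ ⊤) :
    Module.finrank k (M.ofSub p) < Module.finrank k M := by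
  have h' : p.restrictScalars k ≠ ⊤ := fun h' => h (by
    rw [eq_top_iff]
    intro x _
    have : x ∈ p.restrictScalars k := h' ▸ Submodule.mem_top
    exact this)
  exact Submodule.finrank_lt h'

/-- Projectivity makes `Hom(P, -)` exact; the count is rank-nullity for composition with `g`, whose
kernel is the image of composition with `f`. -/
theorem homDim_of_exact {P U V W : FDModule k A} (hP : Module.Projective A P) (f : U →ₗ[A] V)
    (g : V →ₗ[A] W) (hf : Function.Injective f) (hfg : Function.Exact f g)
    (hg : Function.Surjective g) : homDim P V = homDim P U + homDim P W := by
  let F : (P →ₗ[A] U) →ₗ[k] (P →ₗ[A] V) :=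
    { toFun := fun b => f ∘ₗ b
      map_add' := fun b c => by ext; simp
      map_smul' := fun r b => by
        ext x
        exact (f.restrictScalars k).map_smul r _ }
  let H : (P →ₗ[A] V) →ₗ[k] (P →ₗ[A] W) :=
    { toFun := fun b => g ∘ₗ b
      map_add' := fun b c => by ext; simp
      map_smul' := fun r b => by
        ext x
        exact (g.restrictScalars k).map_smul r _ }
  have hF : Function.Injective F := fun b c h =>
    LinearMap.ext fun x => hf (DFunLike.congr_fun h x)
  have hH : Function.Surjective H := fun b => by
    obtain ⟨c, hc⟩ := Module.projective_lifting_property g b hg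
    exact ⟨c, hc⟩
  have hFH : LinearMap.ker H = LinearMap.range F := by
    ext b
    constructor
    · intro hb
      have hb' : ∀ x, g (b x) = 0 := fun x => DFunLike.congr_fun hb x
      let e := LinearEquiv.ofInjective f hf
      let c : P →ₗ[A] LinearMap.range f := b.codRestrict _ (fun x => (hfg _).mp (hb' x))
      refine ⟨e.symm.toLinearMap ∘ₗ c, LinearMap.ext fun x => ?_⟩
      exact congrArg Subtype.val (e.apply_symm_apply (c x))
    · rintro ⟨c, rfl⟩
      exact LinearMap.ext fun x => (hfg _).mpr ⟨c x, rfl⟩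
  have h1 := LinearMap.finrank_range_add_finrank_ker H
  rw [LinearMap.range_eq_top.mpr hH, finrank_top, hFH, LinearMap.finrank_range_of_inj hF] at h1
  unfold homDim
  rw [← h1]
  push_cast
  ring

end Algebra

section Bialgebra

variable {k : Type u} {A : Type v} [Field k] [Ring A] [Bialgebra k A]

theorem isExtension_ofQuot (M : FDModule k A) (p : Submodule A M) :
    IsExtension (M.ofSub p) M (M.ofQuot p) :=
  ⟨p.subtype, p.mkQ, p.injective_subtype, LinearMap.exact_subtype_mkQ p, p.mkQ_surjective⟩

end Bialgebra

/-! ### Duality and symmetry of the form -/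

section Hopf

variable {k : Type u} {A : Type v} [Field k] [Ring A] [HopfAlgebra k A]

/-- The evaluation of an element of the dual module. -/
def dualEquiv (M : FDModule k A) : dual M ≃ₗ[k] Module.Dual k M := LinearEquiv.refl k _

theorem dualEquiv_smul (M : FDModule k A) (a : A) (f : dual M) (x : M) :
    dualEquiv M (a • f) x = dualEquiv M f (HopfAlgebra.antipode k a • x) := rfl

/-- The transpose of a module homomorphism. -/
def dualMap {M N : FDModule k A} (f : M →ₗ[A] N) : dual N →ₗ[A] dual M where
  toFun b := (dualEquiv M).symm (dualEquiv N b ∘ₗ f.restrictScalars k)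
  map_add' b c := by
    apply (dualEquiv M).injective
    ext x
    simp
  map_smul' a b := by
    apply (dualEquiv M).injective
    ext x
    simp [dualEquiv_smul]

/-- The underlying maps are ordinary transposes, so exactness is that of vector space duality: the
kernel of the transpose of `f` is the annihilator of `range f = ker g`, which is the range of the
transpose of `g`. -/
theorem isExtension_dual {X Y Z : FDModule k A} (h : IsExtension X Y Z) :
    IsExtension (dual Z) (dual Y) (dual X) := by
  obtain ⟨f, g, hf, hfg, hg⟩ := h
  refine ⟨dualMap g, dualMap f, ?_, ?_, ?_⟩
  · exact LinearMap.dualMap_injective_of_surjective (f := g.restrictScalars k) hg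
  · have h1 : LinearMap.range (f.restrictScalars k) = LinearMap.ker (g.restrictScalars k) := by
      ext x
      exact (hfg x).symm
    intro b
    have h2 := LinearMap.range_dualMap_eq_dualAnnihilator_ker (g.restrictScalars k)
    have h3 := LinearMap.ker_dualMap_eq_dualAnnihilator_range (f.restrictScalars k)
    rw [h1, ← h2] at h3
    exact SetLike.ext_iff.mp h3 b
  · exact LinearMap.dualMap_surjective_of_injective (f := f.restrictScalars k) hf

/-- A homomorphism `M → N*` is a pairing of `M` and `N`. Exchanging the variables respects the
actions only up to `S²`, and inserting `c` repairs this: `b(S(a)x)(cp) = b(x)(S²(a)cp) = b(x)(cap)`.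
Invertibility of `c` makes the assignment injective; exchanging `M` and `N` gives the opposite
inequality. -/
theorem homDim_dual_le (c : Aˣ)
    (hc : ∀ a : A, HopfAlgebra.antipode k (HopfAlgebra.antipode k a) = c * a * (c⁻¹ : Aˣ))
    (M N : FDModule k A) : homDim M (dual N) ≤ homDim N (dual M) := by
  let Φ (b : M →ₗ[A] dual N) : N →ₗ[A] dual M :=
    { toFun := fun p => (dualEquiv M).symm
        { toFun := fun x => dualEquiv N (b x) ((c : A) • p)
          map_add' := fun x y => by simp
          map_smul' := fun r x => by
            have : b (r • x) = r • b x := (b.restrictScalars k).map_smul r x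
            simp [this] }
      map_add' := fun p q => by
        apply (dualEquiv M).injective
        ext x
        simp
      map_smul' := fun a p => by
        apply (dualEquiv M).injective
        ext x
        simp only [LinearEquiv.apply_symm_apply, LinearMap.coe_mk, AddHom.coe_mk,
          RingHom.id_apply, dualEquiv_smul, map_smul, hc, smul_smul]
        simp }
  have hΦ : ∀ b p x, dualEquiv M (Φ b p) x = dualEquiv N (b x) ((c : A) • p) :=
    fun _ _ _ => rfl
  let Ψ : (M →ₗ[A] dual N) →ₗ[k] (N →ₗ[A] dual M) :=
    { toFun := Φ
      map_add' := fun b b' => by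
        ext p
        apply (dualEquiv M).injective
        ext x
        simp [hΦ]
      map_smul' := fun r b => by
        ext p
        apply (dualEquiv M).injective
        ext x
        rfl }
  have hΨ : Function.Injective Ψ := by
    intro b b' h
    ext x
    apply (dualEquiv N).injective
    ext p
    have h1 := hΦ b ((c⁻¹ : Aˣ) • p) x
    have h2 := hΦ b' ((c⁻¹ : Aˣ) • p) x
    have h3 : Φ b = Φ b' := h
    rw [h3, h2] at h1
    have h4 : (c : A) • (c⁻¹ : Aˣ) • p = p := smul_inv_smul c p
    rw [h4] at h1
    exact h1.symm
  unfold homDim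
  exact_mod_cast LinearMap.finrank_le_finrank_of_injective hΨ

/-- If the square of the antipode is inner, then the form `dim Hom(M, N*)` is symmetric. -/
theorem homDim_dual_comm (c : Aˣ)
    (hc : ∀ a : A, HopfAlgebra.antipode k (HopfAlgebra.antipode k a) = c * a * (c⁻¹ : Aˣ))
    (M N : FDModule k A) : homDim M (dual N) = homDim N (dual M) :=
  le_antisymm (homDim_dual_le c hc M N) (homDim_dual_le c hc N M)

theorem dual_dual (h : ∀ a : A, HopfAlgebra.antipode k (HopfAlgebra.antipode k a) = a)
    (M : FDModule k A) : M ≈ dual (dual M) :=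
  equiv_of_rep (M := M) (N := dual (dual M)) (Module.evalEquiv k M) (fun a x => by
    apply (dualEquiv (dual M)).injective
    ext f
    change dualEquiv M f (a • x) = dualEquiv M (HopfAlgebra.antipode k a • f) x
    rw [dualEquiv_smul, h])

end Hopf

end FDModule

open FDModule

/-! ### Classes in the Green and Grothendieck rings -/

section Rings

variable {k : Type u} {A : Type v} [Field k] [Ring A] [Bialgebra k A]

theorem greenClass_congr {M N : FDModule k A} (h : M ≈ N) : greenClass M = greenClass N :=
  congrArg (Ideal.Quotient.mk _) (freeClass_congr h)

theorem grothendieckClass_congr {M N : FDModule k A} (h : M ≈ N) :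
    grothendieckClass M = grothendieckClass N :=
  congrArg (Ideal.Quotient.mk _) (freeClass_congr h)

theorem grothendieckClass_of_isExtension {X Y Z : FDModule k A} (h : IsExtension X Y Z) :
    grothendieckClass Y = grothendieckClass X + grothendieckClass Z := by
  unfold grothendieckClass
  rw [← map_add, Ideal.Quotient.mk_eq_mk_iff_sub_mem, ← sub_sub]
  exact AddSubgroup.subset_closure ⟨X, Y, Z, h, rfl⟩

/-- For the zero module `M ⊕ M ≅ M`, so its class equals its own double. -/
theorem greenClass_eq_zero (M : FDModule k A) [Subsingleton M] : greenClass M = 0 := by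
  have h : directSum M M ≈ M :=
    ⟨{ LinearMap.fst A M M with
        invFun := fun x => (x, x)
        left_inv := fun x => Prod.ext (Subsingleton.elim _ _) (Subsingleton.elim _ _)
        right_inv := fun x => rfl }⟩
  have h1 := greenClass_congr h
  rwa [greenClass_directSum, add_eq_left] at h1

theorem grothendieckClass_eq_zero (M : FDModule k A) [Subsingleton M] :
    grothendieckClass M = 0 := by
  rw [← greenToGrothendieck_class, greenClass_eq_zero, map_zero]

theorem exists_eq_greenClass_sub (x : GreenRing k A) :
    ∃ M N : FDModule k A, x = greenClass M - greenClass N := by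
  obtain ⟨x, rfl⟩ := Ideal.Quotient.mk_surjective x
  induction x using FreeAbelianGroup.induction_on with
  | zero => exact ⟨unit k A, unit k A, by simp⟩
  | of x =>
    obtain ⟨M, rfl⟩ := Quotient.exists_rep x
    -- Padding both terms with the trivial module writes `[M]` as a difference without a zero
    -- module.
    refine ⟨directSum M (unit k A), unit k A, ?_⟩
    rw [greenClass_directSum, add_sub_cancel_right]
    rfl
  | neg x hx =>
    obtain ⟨M, N, h⟩ := hx
    exact ⟨N, M, by rw [map_neg, h, neg_sub]⟩
  | add x y hx hy =>
    obtain ⟨M, N, h⟩ := hx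
    obtain ⟨M', N', h'⟩ := hy
    refine ⟨directSum M M', directSum N N', ?_⟩
    rw [map_add, h, h', greenClass_directSum, greenClass_directSum]
    abel

theorem greenToGrothendieck_surjective : Function.Surjective (greenToGrothendieck k A) := by
  intro x
  obtain ⟨x, rfl⟩ := Ideal.Quotient.mk_surjective x
  exact ⟨Ideal.Quotient.mk _ x, rfl⟩

/-- The class of a finite dimensional projective module lies in `𝒫`. -/
theorem greenClass_mem_projectiveSubgroup (P : FDModule k A) (hP : Module.Projective A P) :
    greenClass P ∈ projectiveSubgroup k A := by
  -- A decomposable projective module splits into two summands of smaller dimension, each again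
  -- projective.
  induction h : Module.finrank k P using Nat.strong_induction_on generalizing P with
  | _ d ih =>
    subst h
    by_cases hi : P.IsIndecomposable
    · exact AddSubgroup.subset_closure ⟨P, hi, hP, rfl⟩
    rcases subsingleton_or_nontrivial P with h0 | h0
    · rw [greenClass_eq_zero]
      exact zero_mem _
    have : ∃ p q : Submodule A P, IsCompl p q ∧ p ≠ ⊥ ∧ q ≠ ⊥ := by
      by_contra! hc
      exact hi ⟨h0, fun p q hpq => or_iff_not_imp_left.mpr (hc p q hpq)⟩
    obtain ⟨p, q, hpq, hp, hq⟩ := this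
    have key : ∀ {p q : Submodule A P}, IsCompl p q → q ≠ ⊥ →
        greenClass (P.ofSub p) ∈ projectiveSubgroup k A := by
      intro p q hpq hq
      refine ih _ (P.finrank_ofSub_lt (p := p) ?_) _ ?_ rfl
      · rintro rfl
        exact hq (by simpa using hpq.disjoint.eq_bot)
      · exact Module.Projective.of_split p.subtype (p.projectionOnto q hpq)
          (LinearMap.ext fun x => p.projectionOnto_apply_left hpq x)
    rw [← greenClass_congr (P.directSum_of_isCompl hpq), greenClass_directSum]
    exact add_mem (key hpq hq) (key hpq.symm hp)

end Rings

/-! ### The kernel of `φ` is orthogonal to the projective modules -/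

section Form

variable {k : Type u} {A : Type v} [Field k] [Ring A] [HopfAlgebra k A]

/-- Symmetry moves `P` into the first argument. There `M ↦ dim Hom(P, M*)` is additive on short
exact sequences, since duality and `Hom(P, -)` are exact, so it kills every relation of `G₀`. -/
theorem greenForm_eq_zero_of_projective (c : Aˣ)
    (hc : ∀ a : A, HopfAlgebra.antipode k (HopfAlgebra.antipode k a) = c * a * (c⁻¹ : Aˣ))
    {x : GreenRing k A} (hx : greenToGrothendieck k A x = 0)
    (P : FDModule k A) (hP : Module.Projective A P) :
    greenForm k A x (greenClass P) = 0 := by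
  obtain ⟨x, rfl⟩ := Ideal.Quotient.mk_surjective x
  have hx' : x ∈ grothendieckIdeal k A := Ideal.Quotient.eq_zero_iff_mem.mp hx
  let F : FreeModuleRing k A →+ ℤ :=
    ((greenForm k A).flip (greenClass P)).comp (Ideal.Quotient.mk (greenIdeal k A)).toAddMonoidHom
  have h1 : ∀ M : FDModule k A, F (freeClass M) = homDim P (dual M) := fun M =>
    (greenForm_class M P).trans (homDim_dual_comm c hc M P)
  have h2 : AddSubgroup.closure (exactRelations k A) ≤ F.ker := by
    rw [AddSubgroup.closure_le]
    rintro _ ⟨X, Y, Z, h, rfl⟩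
    obtain ⟨f, g, hf, hfg, hg⟩ := isExtension_dual h
    rw [SetLike.mem_coe, AddMonoidHom.mem_ker, map_sub, map_sub, h1, h1, h1,
      homDim_of_exact hP f g hf hfg hg]
    ring
  exact h2 hx'

theorem ker_le_projectiveOrthogonal (c : Aˣ)
    (hc : ∀ a : A, HopfAlgebra.antipode k (HopfAlgebra.antipode k a) = c * a * (c⁻¹ : Aˣ))
    {x : GreenRing k A} (hx : greenToGrothendieck k A x = 0) :
    x ∈ projectiveOrthogonal k A := by
  have h : projectiveSubgroup k A ≤ (greenForm k A x).ker := by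
    unfold projectiveSubgroup
    rw [AddSubgroup.closure_le]
    rintro _ ⟨P, -, hP, rfl⟩
    exact greenForm_eq_zero_of_projective c hc hx P hP
  exact fun y hy => h hy

end Form

/-! ### Semisimple modules: splitting and recognition by `Hom` dimensions -/

section Semisimple

variable {k : Type u} {A : Type v} [Field k] [Ring A] [Bialgebra k A]

/-- The class of a semisimple module lies in every subgroup that contains the classes of its
simple submodules. -/
theorem greenClass_mem_of_simple (B : AddSubgroup (GreenRing k A)) (M : FDModule k A)
    [IsSemisimpleModule A M]
    (h : ∀ S : FDModule k A, IsSimpleModule A S → ∀ i : S →ₗ[A] M, Function.Injective i →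
      greenClass S ∈ B) : greenClass M ∈ B := by
  induction hd : Module.finrank k M using Nat.strong_induction_on generalizing M with
  | _ d ih =>
    subst hd
    rcases subsingleton_or_nontrivial M with h0 | h0
    · rw [greenClass_eq_zero]
      exact zero_mem _
    obtain ⟨p, hp⟩ := IsSemisimpleModule.exists_simple_submodule A M
    obtain ⟨q, hpq⟩ := exists_isCompl p
    have hq : q ≠ ⊤ := by
      rintro rfl
      have : p = ⊥ := by simpa using hpq.disjoint.eq_bot
      subst this
      exact not_nontrivial _ (IsSimpleModule.nontrivial A (⊥ : Submodule A M))
    rw [← greenClass_congr (M.directSum_of_isCompl hpq), greenClass_directSum]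
    have : IsSemisimpleModule A (M.ofSub q) := inferInstanceAs (IsSemisimpleModule A q)
    exact add_mem (h (M.ofSub p) hp p.subtype p.injective_subtype)
      (ih _ (M.finrank_ofSub_lt hq) _ (fun S hS i hi =>
        h S hS (q.subtype ∘ₗ i) (q.injective_subtype.comp hi)) rfl)

theorem directSum_congr_of_isExtension {X Y Z : FDModule k A} [IsSemisimpleModule A Y]
    (h : IsExtension X Y Z) : directSum X Z ≈ Y := by
  obtain ⟨f, g, hf, hfg, hg⟩ := h
  obtain ⟨q, hq⟩ := exists_isCompl (LinearMap.range f)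
  have h1 : LinearMap.ker g = LinearMap.range f := hfg.linearMap_ker_eq
  let e1 : X ≃ₗ[A] LinearMap.range f := LinearEquiv.ofInjective f hf
  let e2 : Z ≃ₗ[A] q := (g.quotKerEquivOfSurjective hg).symm.trans
    ((Submodule.quotEquivOfEq _ _ h1).trans (Submodule.quotientEquivOfIsCompl _ q hq))
  exact ⟨(e1.prodCongr e2).trans (Submodule.prodEquivOfIsCompl _ q hq)⟩

theorem greenClass_of_isExtension {X Y Z : FDModule k A} [IsSemisimpleModule A Y]
    (h : IsExtension X Y Z) : greenClass Y = greenClass X + greenClass Z := by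
  rw [← greenClass_congr (directSum_congr_of_isExtension h), greenClass_directSum]

end Semisimple

section SemisimpleHopf

variable {k : Type u} {A : Type v} [Field k] [Ring A] [HopfAlgebra k A]

theorem subsingleton_of_homDim_self {N : FDModule k A} (h : homDim N N = 0) : Subsingleton N := by
  have h1 : Module.finrank k (N →ₗ[A] N) = 0 := by
    unfold homDim at h
    exact_mod_cast h
  have h2 : Subsingleton (N →ₗ[A] N) := Module.finrank_zero_iff.mp h1
  refine subsingleton_of_forall_eq 0 fun x => ?_
  exact DFunLike.congr_fun (Subsingleton.elim (LinearMap.id : N →ₗ[A] N) 0) x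

/-- Over a semisimple algebra, a module is determined by the dimensions of its spaces of
homomorphisms. -/
theorem equiv_of_homDim_eq [IsSemisimpleRing A] (M N : FDModule k A)
    (h : ∀ S : FDModule k A, homDim M S = homDim N S) : M ≈ N := by
  induction hd : Module.finrank k M using Nat.strong_induction_on generalizing M N with
  | _ d ih =>
    subst hd
    rcases subsingleton_or_nontrivial M with h0 | h0
    · have h1 : Subsingleton N := by
        apply subsingleton_of_homDim_self
        rw [← h N]
        have : Subsingleton (M →ₗ[A] N) := ⟨fun f g => LinearMap.ext fun x => by
          rw [Subsingleton.elim x 0, map_zero, map_zero]⟩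
        unfold homDim
        exact_mod_cast Module.finrank_zero_of_subsingleton
      exact ⟨0⟩
    obtain ⟨p, hp⟩ := IsSemisimpleModule.exists_simple_submodule A M
    obtain ⟨q, hpq⟩ := exists_isCompl p
    have hq : q ≠ ⊤ := by
      rintro rfl
      have : p = ⊥ := by simpa using hpq.disjoint.eq_bot
      subst this
      exact not_nontrivial _ (IsSimpleModule.nontrivial A (⊥ : Submodule A M))
    -- The projection along `q` is a nonzero map from `M` to the simple module `p`. Equality of
    -- dimensions then gives a nonzero, hence surjective, map from `N` to `p`; it splits, `p` is
    -- cancelled from both modules, and the induction continues with `q` and the kernel.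
    have hMS : homDim M (M.ofSub p) ≠ 0 := by
      intro h0
      have h1 : Module.finrank k (M →ₗ[A] M.ofSub p) = 0 := by
        unfold homDim at h0
        exact_mod_cast h0
      have h2 : Subsingleton (M →ₗ[A] M.ofSub p) := Module.finrank_zero_iff.mp h1
      have h3 : (p.projectionOnto q hpq : M →ₗ[A] p) = 0 :=
        Subsingleton.elim (α := M →ₗ[A] M.ofSub p) _ _
      have h4 := IsSimpleModule.nontrivial A p
      obtain ⟨x, hx⟩ := exists_ne (0 : p)
      apply hx
      rw [← p.projectionOnto_apply_left hpq x, h3, LinearMap.zero_apply]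
    have : Nontrivial (N →ₗ[A] M.ofSub p) := by
      rw [← not_subsingleton_iff_nontrivial, ← Module.finrank_zero_iff (R := k)]
      rw [h] at hMS
      unfold homDim at hMS
      exact_mod_cast hMS
    obtain ⟨f, hf⟩ := exists_ne (0 : N →ₗ[A] M.ofSub p)
    have hp' : IsSimpleModule A (M.ofSub p) := hp
    have hfs : Function.Surjective f := LinearMap.surjective_of_ne_zero hf
    have hN : directSum (N.ofSub (LinearMap.ker f)) (M.ofSub p) ≈ N :=
      directSum_congr_of_isExtension ⟨(LinearMap.ker f).subtype, f, Submodule.injective_subtype _,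
        LinearMap.exact_subtype_ker_map f, hfs⟩
    have hM : directSum (M.ofSub q) (M.ofSub p) ≈ M := M.directSum_of_isCompl hpq.symm
    obtain ⟨e⟩ := ih _ (M.finrank_ofSub_lt hq) (M.ofSub q) (N.ofSub (LinearMap.ker f)) (fun S => by
      have h1 := h S
      rw [← homDim_congr hM (Setoid.refl S), ← homDim_congr hN (Setoid.refl S),
        homDim_directSum_left, homDim_directSum_left] at h1
      exact add_right_cancel h1) rfl
    have h2 : directSum (M.ofSub q) (M.ofSub p) ≈
        directSum (N.ofSub (LinearMap.ker f)) (M.ofSub p) :=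
      ⟨e.prodCongr (LinearEquiv.refl A _)⟩
    exact Setoid.trans (Setoid.symm hM) (Setoid.trans h2 hN)

end SemisimpleHopf

namespace FDModule

/-! ### The part fixed by a central element -/

section Cut

variable {k : Type u} {A : Type v} [Field k] [Ring A] [Algebra k A]

/-- The submodule on which a central element acts as the identity. -/
def cutSubmodule (e : A) (he : ∀ a, Commute e a) (M : FDModule k A) : Submodule A M where
  carrier := {x | e • x = x}
  add_mem' {x y} hx hy := by
    change e • (x + y) = x + y
    rw [smul_add, hx, hy]
  zero_mem' := smul_zero e
  smul_mem' a x hx := by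
    change e • a • x = a • x
    rw [← mul_smul, (he a).eq, mul_smul, hx]

/-- The part of a module on which a central element acts as the identity. -/
def cut (e : A) (he : ∀ a, Commute e a) (M : FDModule k A) : FDModule k A :=
  M.ofSub (M.cutSubmodule e he)

theorem cut_smul {e : A} {he : ∀ a, Commute e a} {M : FDModule k A} (x : M.cut e he) :
    e • x = x := Subtype.ext x.2

theorem cut_congr (e : A) (he : ∀ a, Commute e a) {M N : FDModule k A} (h : M ≈ N) :
    M.cut e he ≈ N.cut e he := by
  obtain ⟨f⟩ := h
  refine ⟨f.ofSubmodules (M.cutSubmodule e he) (N.cutSubmodule e he) ?_⟩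
  ext x
  constructor
  · rintro ⟨y, hy, rfl⟩
    change e • f y = f y
    rw [← map_smul, show e • y = y from hy]
  · intro hx
    refine ⟨f.symm x, ?_, f.apply_symm_apply x⟩
    change e • f.symm x = f.symm x
    rw [← map_smul, show e • x = x from hx]

theorem cut_directSum (e : A) (he : ∀ a, Commute e a) (M N : FDModule k A) :
    (directSum M N).cut e he ≈ directSum (M.cut e he) (N.cut e he) :=
  ⟨{ toFun := fun x => (⟨x.1.1, congrArg Prod.fst x.2⟩, ⟨x.1.2, congrArg Prod.snd x.2⟩)
     invFun := fun x => ⟨(x.1.1, x.2.1), Prod.ext x.1.2 x.2.2⟩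
     map_add' := fun _ _ => rfl
     map_smul' := fun _ _ => rfl
     left_inv := fun _ => rfl
     right_inv := fun _ => rfl }⟩

end Cut

end FDModule

/-! ### Spectral projections of elements of finite order -/

section Eigen

variable {k : Type u} {A : Type v} [Field k] [Ring A] [Algebra k A]
  {M : Type*} [AddCommGroup M] [Module k M] [Module A M] [IsScalarTower k A M]

theorem aeval_smul_of_smul_eq {a : A} {c : k} {x : M} (h : a • x = c • x)
    (P : Polynomial k) : Polynomial.aeval a P • x = P.eval c • x := by
  -- Scalars of `k` act through the centre of `A`, so the two actions commute.
  have hc : SMulCommClass A k M := ⟨fun b r y => by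
    rw [← algebraMap_smul A r y, ← algebraMap_smul A r (b • y), ← mul_smul, ← mul_smul,
      Algebra.commutes]⟩
  induction P using Polynomial.induction_on' with
  | add P Q hP hQ => rw [map_add, add_smul, hP, hQ, Polynomial.eval_add, add_smul]
  | monomial m r =>
    rw [Polynomial.aeval_monomial, mul_smul, algebraMap_smul, Polynomial.eval_monomial, mul_smul]
    congr 1
    induction m with
    | zero => simp
    | succ m ih =>
      rw [pow_succ, mul_smul, h, smul_comm, ih, smul_smul, pow_succ, mul_comm]

open Classical in
/-- A polynomial in `a` which, if `a^N = 1`, acts as the projection to the eigenvectors of `a`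
whose eigenvalues satisfy `p`. -/
def spectralProj (N : ℕ) (a : A) (p : k → Prop) : A :=
  Polynomial.aeval a (Lagrange.interpolate (Polynomial.nthRootsFinset N (1 : k)) id
    (fun c => if p c then 1 else 0))

/-- The projection is a polynomial in `a` with coefficients depending only on `N` and `p`, so
algebra homomorphisms preserve it. This carries the block idempotents from `k[G]` into `H`. -/
theorem map_spectralProj {B : Type*} [Ring B] [Algebra k B] (f : A →ₐ[k] B) (N : ℕ) (a : A)
    (p : k → Prop) : f (spectralProj N a p) = spectralProj N (f a) p :=
  (Polynomial.aeval_algHom_apply f a _).symm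

theorem commute_spectralProj (N : ℕ) {a b : A} (h : Commute a b) (p : k → Prop) :
    Commute (spectralProj N a p) b := by
  have h1 : Algebra.adjoin k {a} ≤ Subalgebra.centralizer k {b} := by
    rw [Algebra.adjoin_le_iff, Set.singleton_subset_iff, SetLike.mem_coe,
      Subalgebra.mem_centralizer_iff]
    rintro _ rfl
    exact h.symm
  exact ((Subalgebra.mem_centralizer_iff k).mp
    (h1 (Polynomial.aeval_mem_adjoin_singleton k a)) b rfl).symm

theorem pow_smul_of_smul_eq {a : A} {c : k} {x : M} (h : a • x = c • x) (m : ℕ) :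
    a ^ m • x = c ^ m • x := by
  simpa using aeval_smul_of_smul_eq h (Polynomial.X ^ m)

open Classical in
-- On a nonzero eigenvector `a^N = 1` forces `c^N = 1`. Thus `c` is a node of the interpolation,
-- where the polynomial takes the value 1 or 0 according to `p c`.
theorem spectralProj_smul {N : ℕ} (hN : 0 < N) {a : A} (ha : a ^ N = 1) (p : k → Prop)
    {c : k} {x : M} (h : a • x = c • x) :
    spectralProj N a p • x = if p c then x else 0 := by
  rcases eq_or_ne x 0 with rfl | hx
  · simp
  have h1 : c ^ N = 1 := by
    have h2 := pow_smul_of_smul_eq h N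
    rw [ha, one_smul] at h2
    have h3 : (c ^ N - 1) • x = 0 := by rw [sub_smul, ← h2, one_smul, sub_self]
    exact sub_eq_zero.mp ((smul_eq_zero.mp h3).resolve_right hx)
  have h2 : c ∈ Polynomial.nthRootsFinset N (1 : k) :=
    (Polynomial.mem_nthRootsFinset hN 1).mpr h1
  unfold spectralProj
  rw [aeval_smul_of_smul_eq h]
  have h3 := Lagrange.eval_interpolate_at_node (fun c : k => if p c then (1 : k) else 0)
    (v := id) (Set.injOn_id _) h2
  rw [id] at h3
  rw [h3]
  split_ifs <;> simp

/-- A property that holds for the eigenvectors of an element of finite order holds everywhere. -/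
theorem eigen_induction [IsAlgClosed k] [CharZero k] [Module.Finite k M] {N : ℕ} (hN : 0 < N)
    {a : A} (ha : a ^ N = 1) {P : M → Prop} (hz : P 0) (hadd : ∀ x y, P x → P y → P (x + y))
    (he : ∀ (c : k) (x : M), a • x = c • x → P x) (x : M) : P x := by
  have hc : SMulCommClass A k M := ⟨fun b r y => by
    rw [← algebraMap_smul A r y, ← algebraMap_smul A r (b • y), ← mul_smul, ← mul_smul,
      Algebra.commutes]⟩
  let f : Module.End k M := Algebra.lsmul k k M a
  -- The endomorphism is killed by `X^N - 1`, which is separable in characteristic 0; over an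
  -- algebraically closed field its eigenspaces therefore span.
  have hf : f.IsSemisimple := by
    refine Module.End.isSemisimple_of_squarefree_aeval_eq_zero
      (p := Polynomial.X ^ N - Polynomial.C 1) ?_ ?_
    · exact (Polynomial.separable_X_pow_sub_C (1 : k) (Nat.cast_ne_zero.mpr hN.ne')
        one_ne_zero).squarefree
    · simp only [map_sub, map_pow, Polynomial.aeval_X, map_one]
      rw [← map_pow, ha, map_one, sub_self]
  have htop := hf.iSup_eigenspace_eq_top
  have hx : x ∈ ⨆ c : k, f.eigenspace c := htop ▸ Submodule.mem_top
  induction hx using Submodule.iSup_induction' with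
  | mem c x hx => exact he c x (Module.End.mem_eigenspace_iff.mp hx)
  | zero => exact hz
  | add x y _ _ hx hy => exact hadd x y hx hy

end Eigen

/-! ### The Hopf structure of `k[G]` on group elements -/

namespace MonoidAlgebra

variable {k : Type u} {G : Type w} [Field k] [Group G]

theorem antipode_of (h : G) : HopfAlgebra.antipode k (of k G h) = of k G h⁻¹ := by
  rw [of_apply, of_apply, antipode_single, CommSemiring.antipode_eq_id]
  rfl

theorem comul_of (h : G) : Coalgebra.comul (R := k) (of k G h) = of k G h ⊗ₜ of k G h := by
  simp [of_apply]

theorem counit_of (h : G) : Coalgebra.counit (R := k) (of k G h) = 1 := by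
  simp [of_apply]

theorem linear_ext_of {V : Type*} [AddCommGroup V] [Module k V]
    {f f' : MonoidAlgebra k G →ₗ[k] V} (h : ∀ x, f (of k G x) = f' (of k G x)) : f = f' := by
  apply MonoidAlgebra.lhom_ext'
  intro x
  apply LinearMap.ext_ring
  exact h x

theorem algHom_ext_of {B : Type*} [Ring B] [Algebra k B] {f f' : MonoidAlgebra k G →ₐ[k] B}
    (h : ∀ x, f (of k G x) = f' (of k G x)) : f = f' :=
  AlgHom.toLinearMap_injective (linear_ext_of h)

theorem antipode_antipode (a : MonoidAlgebra k G) :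
    HopfAlgebra.antipode k (HopfAlgebra.antipode k a) = a := by
  have : HopfAlgebra.antipode k ∘ₗ HopfAlgebra.antipode k =
      (LinearMap.id : MonoidAlgebra k G →ₗ[k] MonoidAlgebra k G) :=
    linear_ext_of fun x => by
      rw [LinearMap.comp_apply, antipode_of, antipode_of, inv_inv, LinearMap.id_apply]
  exact DFunLike.congr_fun this a

theorem map_smul_of_of {V W : Type*} [AddCommGroup V] [Module k V] [Module (MonoidAlgebra k G) V]
    [IsScalarTower k (MonoidAlgebra k G) V] [AddCommGroup W] [Module k W]
    [Module (MonoidAlgebra k G) W] [IsScalarTower k (MonoidAlgebra k G) W] (f : V →ₗ[k] W)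
    (h : ∀ (x : G) (v : V), f (of k G x • v) = of k G x • f v) (a : MonoidAlgebra k G) (v : V) :
    f (a • v) = a • f v := by
  have : f ∘ₗ (LinearMap.toSpanSingleton (MonoidAlgebra k G) V v).restrictScalars k =
      (LinearMap.toSpanSingleton (MonoidAlgebra k G) W (f v)).restrictScalars k :=
    linear_ext_of fun x => h x v
  exact DFunLike.congr_fun this a

end MonoidAlgebra

/-! ### Commutation rules in `H` -/

namespace GroupDatum

open MonoidAlgebra

variable {k : Type u} {G : Type w} [Field k] [Group G] (D : GroupDatum k G)

/-- The inclusion of the group algebra. -/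
def incl : MonoidAlgebra k G →ₐ[k] D.Alg := MonoidAlgebra.lift k D.Alg G D.grp

@[simp]
theorem incl_of (h : G) : D.incl (of k G h) = D.grp h := MonoidAlgebra.lift_of _ _

variable {D} in
theorem map_smul_of_generators {V W : Type*} [AddCommGroup V] [Module k V] [Module D.Alg V]
    [IsScalarTower k D.Alg V] [AddCommGroup W] [Module k W]
    [Module D.Alg W] [IsScalarTower k D.Alg W] (f : V →ₗ[k] W)
    (hy : ∀ v : V, f (D.y • v) = D.y • f v)
    (hg : ∀ (x : G) (v : V), f (D.grp x • v) = D.grp x • f v) (a : D.Alg) (v : V) :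
    f (a • v) = a • f v := by
  induction a using alg_induction generalizing v with
  | hy => exact hy v
  | hg h => exact hg h v
  | hs c => rw [algebraMap_smul, algebraMap_smul, map_smul]
  | ha a b ha hb => rw [add_smul, add_smul, map_add, ha, hb]
  | hm a b ha hb => rw [mul_smul, mul_smul, ha, hb]

theorem y_pow_mul_grp (i : ℕ) (h : G) :
    D.y ^ i * D.grp h = ((D.χ h ^ i : kˣ) : k) • (D.grp h * D.y ^ i) := by
  induction i with
  | zero => simp
  | succ i ih =>
    rw [pow_succ, mul_assoc, D.y_mul_grp, mul_smul_comm, ← mul_assoc, ih, smul_mul_assoc, smul_smul,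
      mul_assoc, pow_succ, Units.val_mul, mul_comm]

theorem grp_mul_y_pow (i : ℕ) (h : G) :
    D.grp h * D.y ^ i = (((D.χ h)⁻¹ ^ i : kˣ) : k) • (D.y ^ i * D.grp h) := by
  rw [y_pow_mul_grp, smul_smul, ← Units.val_mul, inv_pow, inv_mul_cancel, Units.val_one, one_smul]

theorem χ_g_pow_n : D.χ D.g ^ D.n = 1 := pow_orderOf_eq_one _

/-- Moving `y` past `g^n` costs the factor `χ(g)^n = 1`, and `g` is central in `G`. Hence splitting
a module by the eigenvalues of `g^n` respects the action of all of `H`. -/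
theorem grp_pow_commute (a : D.Alg) : Commute (D.grp (D.g ^ D.n)) a := by
  induction a using alg_induction with
  | hy =>
    have h := D.y_mul_grp (D.g ^ D.n)
    rw [map_pow D.χ, χ_g_pow_n, Units.val_one, one_smul] at h
    exact h.symm
  | hg h =>
    rw [Commute, SemiconjBy, ← map_mul, ← map_mul,
      Subgroup.mem_center_iff.mp (pow_mem D.g_mem_center D.n) h]
  | hs c => exact (Algebra.commutes c _).symm
  | ha a b ha hb => exact ha.add_right hb
  | hm a b ha hb => exact ha.mul_right hb

/-! ### Restriction to the group algebra -/

/-- The restriction of a module to the group algebra. -/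
def res (X : FDModule k D.Alg) : FDModule k (MonoidAlgebra k G) := ofRep X (X.rep.comp D.incl)

/-- The identity map from a module to its restriction. -/
def resEquiv (X : FDModule k D.Alg) : X ≃ₗ[k] D.res X := LinearEquiv.refl k X

theorem resEquiv_smul (X : FDModule k D.Alg) (a : MonoidAlgebra k G) (x : X) :
    D.resEquiv X (D.incl a • x) = a • D.resEquiv X x := rfl

theorem resEquiv_grp_smul (X : FDModule k D.Alg) (h : G) (x : X) :
    D.resEquiv X (D.grp h • x) = of k G h • D.resEquiv X x := by
  rw [← resEquiv_smul, incl_of]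

/-- Restriction of homomorphisms. -/
def resMap {X Y : FDModule k D.Alg} (f : X →ₗ[D.Alg] Y) : D.res X →ₗ[MonoidAlgebra k G] D.res Y where
  toFun x := D.resEquiv Y (f ((D.resEquiv X).symm x))
  map_add' x y := by simp
  map_smul' a x := f.map_smul (D.incl a) ((D.resEquiv X).symm x)

theorem res_congr {X Y : FDModule k D.Alg} (h : X ≈ Y) : D.res X ≈ D.res Y := by
  obtain ⟨e⟩ := h
  exact ⟨{ D.resMap e.toLinearMap with
    invFun := D.resMap e.symm.toLinearMap
    left_inv := e.symm_apply_apply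
    right_inv := e.apply_symm_apply }⟩

variable [Finite G]

theorem res_isExtension {X Y Z : FDModule k D.Alg} (h : IsExtension X Y Z) :
    IsExtension (D.res X) (D.res Y) (D.res Z) := by
  obtain ⟨f, g, hf, hfg, hg⟩ := h
  exact ⟨D.resMap f, D.resMap g, hf, hfg, hg⟩

theorem res_unit : D.res (unit k D.Alg) ≈ unit k (MonoidAlgebra k G) := by
  refine equiv_of_rep (M := D.res (unit k D.Alg)) (N := unit k (MonoidAlgebra k G))
    (LinearEquiv.refl k k) fun a x => ?_
  have h : (Bialgebra.counitAlgHom k D.Alg).comp D.incl =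
      Bialgebra.counitAlgHom k (MonoidAlgebra k G) :=
    MonoidAlgebra.algHom_ext_of fun h => by
      change Coalgebra.counit (R := k) (D.incl (of k G h)) =
        Coalgebra.counit (R := k) (of k G h)
      rw [incl_of, counit_grp, counit_of]
  exact congrArg (fun c : k => c • (x : k)) (DFunLike.congr_fun h a)

/-- Elements of `G` are group-like in both algebras, so the two actions on the same space `X ⊗ Y`
agree on `G`. This makes restriction multiplicative. -/
theorem res_tensor (X Y : FDModule k D.Alg) :
    D.res (X.tensor Y) ≈ (D.res X).tensor (D.res Y) := by
  refine equiv_of_rep (M := D.res (X.tensor Y)) (N := (D.res X).tensor (D.res Y))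
    (LinearEquiv.refl k _) fun a x => ?_
  have h : (tensorRep X.rep Y.rep).comp D.incl =
      tensorRep (X.rep.comp D.incl) (Y.rep.comp D.incl) :=
    MonoidAlgebra.algHom_ext_of fun h => by
      change outerRep X.rep Y.rep (Coalgebra.comul (R := k) (D.incl (of k G h))) =
        outerRep _ _ (Coalgebra.comul (R := k) (of k G h))
      rw [incl_of, comul_grp, comul_of]
      refine TensorProduct.ext' fun x y => ?_
      rw [outerRep_tmul, outerRep_tmul, AlgHom.comp_apply, AlgHom.comp_apply, incl_of]
  exact DFunLike.congr_fun (DFunLike.congr_fun h a) x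

theorem incl_antipode (a : MonoidAlgebra k G) :
    D.incl (HopfAlgebra.antipode k a) = HopfAlgebra.antipode k (D.incl a) := by
  have : D.incl.toLinearMap ∘ₗ HopfAlgebra.antipode k =
      HopfAlgebra.antipode k ∘ₗ D.incl.toLinearMap :=
    linear_ext_of fun x => by
      simp only [LinearMap.comp_apply, AlgHom.toLinearMap_apply, antipode_of, incl_of, antipode_grp]
  exact DFunLike.congr_fun this a

theorem res_dual (X : FDModule k D.Alg) : D.res X.dual ≈ (D.res X).dual := by
  refine equiv_of_rep (M := D.res X.dual) (N := (D.res X).dual)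
    (LinearEquiv.refl k (Module.Dual k X)) fun a f => ?_
  refine LinearMap.ext fun (x : X) => ?_
  change dualEquiv X ((D.resEquiv X.dual).symm f) (HopfAlgebra.antipode k (D.incl a) • x) =
    dualEquiv X ((D.resEquiv X.dual).symm f) (D.incl (HopfAlgebra.antipode k a) • x)
  rw [incl_antipode]

/-- The square of the antipode is conjugation by `g`. -/
theorem antipode_antipode (a : D.Alg) :
    HopfAlgebra.antipode k (HopfAlgebra.antipode k a) =
      D.grp D.g * a * D.grp D.g⁻¹ := by
  have h1 : D.grp D.g * D.grp D.g⁻¹ = 1 := by rw [← map_mul, mul_inv_cancel, map_one]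
  have h2 : D.grp D.g⁻¹ * D.grp D.g = 1 := by rw [← map_mul, inv_mul_cancel, map_one]
  induction a using alg_induction with
  | hy =>
    rw [antipode_y, map_neg, HopfAlgebra.antipode_mul_antidistrib, antipode_y, antipode_grp, inv_inv,
      mul_neg, neg_neg, mul_assoc]
  | hg h =>
    rw [antipode_grp, antipode_grp, inv_inv, grp_g_comm, mul_assoc, h1, mul_one]
  | hs c =>
    have h : HopfAlgebra.antipode k (algebraMap k D.Alg c) = algebraMap k D.Alg c :=
      D.antipodeLin_algebraMap c
    rw [h, h, ← Algebra.commutes, mul_assoc, h1, mul_one]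
  | ha a b ha hb => rw [map_add, map_add, ha, hb, mul_add, add_mul]
  | hm a b ha hb =>
    rw [HopfAlgebra.antipode_mul_antidistrib, HopfAlgebra.antipode_mul_antidistrib, ha, hb]
    simp only [mul_assoc]
    rw [← mul_assoc (D.grp D.g⁻¹), h2, one_mul]

/-- The unit `g` of the algebra. -/
def gUnit : D.Algˣ := Units.map D.grp (toUnits D.g)

theorem antipode_antipode_gUnit (a : D.Alg) :
    HopfAlgebra.antipode k (HopfAlgebra.antipode k a) =
      D.gUnit * a * (D.gUnit⁻¹ : D.Algˣ) := by
  rw [D.antipode_antipode]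
  rfl

/-- The restriction `F(H) → r(k[G])`. -/
def resFree : FreeModuleRing k D.Alg →+* GreenRing k (MonoidAlgebra k G) :=
  FreeAbelianGroup.liftMonoid
    { toFun := Quotient.lift (fun X => greenClass (D.res X))
        (fun _ _ h => greenClass_congr (D.res_congr h))
      map_one' := greenClass_congr D.res_unit
      map_mul' := by
        rintro ⟨X⟩ ⟨Y⟩
        exact (greenClass_congr (D.res_tensor X Y)).trans (greenClass_mul _ _).symm }

theorem resFree_class (X : FDModule k D.Alg) : D.resFree (freeClass X) = greenClass (D.res X) :=
  FreeAbelianGroup.lift_apply_of _ _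

/-- The restriction `G₀(H) → r(k[G])`. -/
def resHom [CharZero k] : GrothendieckRing k D.Alg →+* GreenRing k (MonoidAlgebra k G) :=
  -- The order of `G` is invertible in `k`, so Maschke applies: restricted short exact sequences
  -- split, and their relations vanish already in the Green ring.
  haveI : NeZero (Nat.card G : k) := ⟨Nat.cast_ne_zero.mpr Nat.card_pos.ne'⟩
  Ideal.Quotient.lift (grothendieckIdeal k D.Alg) D.resFree (by
    intro x hx
    have h : AddSubgroup.closure (exactRelations k D.Alg) ≤ D.resFree.toAddMonoidHom.ker := by
      rw [AddSubgroup.closure_le]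
      rintro _ ⟨X, Y, Z, h, rfl⟩
      change D.resFree _ = 0
      rw [map_sub, map_sub, resFree_class, resFree_class, resFree_class,
        greenClass_of_isExtension (D.res_isExtension h)]
      abel
    exact h hx)

@[simp]
theorem resHom_class [CharZero k] (X : FDModule k D.Alg) :
    D.resHom (grothendieckClass X) = greenClass (D.res X) :=
  D.resFree_class X

end GroupDatum

/-! ### Operators on the induced module -/

namespace GroupDatum

open MonoidAlgebra

variable {k : Type u} {G : Type w} [Field k] [Group G] (D : GroupDatum k G)

section

variable (V : FDModule k (MonoidAlgebra k G))

/-- The action of `y^n` on the induced module. -/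
def indTop : Module.End k V := D.μ • (V.rep (of k G D.g) ^ D.n - 1)

/-- The action of `h ∈ G` on the induced module. -/
def indGrp (h : G) : Module.End k (Fin D.n → V) :=
  -- Coordinate `i` stands for `y^i ⊗ V`, and `h y^i = χ(h)⁻ⁱ y^i h`.
  LinearMap.pi fun i =>
    (((D.χ h)⁻¹ ^ (i : ℕ) : kˣ) : k) • (V.rep (of k G h) ∘ₗ LinearMap.proj i)

theorem indGrp_single (h : G) (i : Fin D.n) (v : V) :
    D.indGrp V h (Pi.single i v) =
      Pi.single i ((((D.χ h)⁻¹ ^ (i : ℕ) : kˣ) : k) • of k G h • v) := by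
  ext j
  rcases eq_or_ne j i with rfl | hj
  · simp [indGrp]
  · simp [indGrp, hj]

theorem g_smul_comm (a : MonoidAlgebra k G) : Commute (of k G D.g) a := by
  have h : LinearMap.mulLeft k (of k G D.g) = LinearMap.mulRight k (of k G D.g) :=
    linear_ext_of fun x => by
      rw [LinearMap.mulLeft_apply, LinearMap.mulRight_apply, ← map_mul, ← map_mul,
        Subgroup.mem_center_iff.mp D.g_mem_center]
  exact DFunLike.congr_fun h a

theorem indTop_apply (v : V) : D.indTop V v = D.μ • (of k G (D.g ^ D.n) • v - v) := by
  unfold indTop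
  rw [← map_pow, ← map_pow]
  rfl

theorem of_smul_smul (h : G) (c : k) (v : V) : of k G h • c • v = c • of k G h • v :=
  (V.rep (of k G h)).map_smul c v

theorem indTop_of_smul (h : G) (v : V) :
    D.indTop V (of k G h • v) = of k G h • D.indTop V v := by
  rw [indTop_apply, indTop_apply, of_smul_smul, smul_sub (of k G h), ← mul_smul, ← mul_smul, ← map_mul,
    ← map_mul, Subgroup.mem_center_iff.mp (pow_mem D.g_mem_center D.n)]

theorem χ_inv_pow (hχ : D.χ ^ D.n = 1) (h : G) : (D.χ h)⁻¹ ^ D.n = 1 := by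
  rw [inv_pow, ← MonoidHom.pow_apply, hχ, MonoidHom.one_apply, inv_one]

end

variable [Finite G]

/-! ### Extension by zero -/

/-- The module on which `y` acts by zero. -/
def zeroExt (V : FDModule k (MonoidAlgebra k G))
    (hV : ∀ v : V, of k G (D.g ^ D.n) • v = v) : FDModule k D.Alg :=
  ofRep V (D.lift ((V.rep : MonoidAlgebra k G →* Module.End k V).comp (of k G)) 0
    -- With `y = 0` the relation `y^n = μ(g^n - 1)` holds because both sides vanish: `n > 0`, and
    -- `g^n` acts as the identity.
    (by
      have h : V.rep (of k G D.g) ^ D.n = 1 := by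
        rw [← map_pow, ← map_pow]
        exact LinearMap.ext hV
      change (0 : Module.End k V) ^ D.n = D.μ • (V.rep (of k G D.g) ^ D.n - 1)
      rw [h, sub_self, smul_zero, zero_pow D.n_pos.ne'])
    (fun h => by rw [zero_mul, mul_zero, smul_zero]))

/-- The identity map from a module to its extension by zero. -/
def zeroExtEquiv (V : FDModule k (MonoidAlgebra k G)) (hV) : V ≃ₗ[k] D.zeroExt V hV :=
  LinearEquiv.refl k V

theorem grp_smul_zeroExtEquiv (V : FDModule k (MonoidAlgebra k G)) (hV) (h : G) (v : V) :
    D.grp h • D.zeroExtEquiv V hV v = D.zeroExtEquiv V hV (of k G h • v) :=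
  DFunLike.congr_fun (D.lift_grp _ _ _ _ h) v

theorem y_smul_zeroExtEquiv (V : FDModule k (MonoidAlgebra k G)) (hV) (v : V) :
    D.y • D.zeroExtEquiv V hV v = 0 :=
  DFunLike.congr_fun (D.lift_y _ _ _ _) v

/-- The extension by zero of a homomorphism. -/
def zeroExtMap {V W : FDModule k (MonoidAlgebra k G)} (hV) (hW)
    (f : V →ₗ[MonoidAlgebra k G] W) : D.zeroExt V hV →ₗ[D.Alg] D.zeroExt W hW :=
  let F : D.zeroExt V hV →ₗ[k] D.zeroExt W hW :=
    (D.zeroExtEquiv W hW).toLinearMap ∘ₗ f.restrictScalars k ∘ₗ (D.zeroExtEquiv V hV).symm.toLinearMap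
  { F with
    map_smul' := by
      have hF : ∀ v, F (D.zeroExtEquiv V hV v) = D.zeroExtEquiv W hW (f v) := fun _ => rfl
      refine map_smul_of_generators F (fun v => ?_) (fun h v => ?_)
      · obtain ⟨v, rfl⟩ := (D.zeroExtEquiv V hV).surjective v
        rw [y_smul_zeroExtEquiv, hF, y_smul_zeroExtEquiv, map_zero]
      · obtain ⟨v, rfl⟩ := (D.zeroExtEquiv V hV).surjective v
        rw [grp_smul_zeroExtEquiv, hF, hF, grp_smul_zeroExtEquiv, map_smul] }

theorem zeroExt_congr {V W : FDModule k (MonoidAlgebra k G)} (hV) (hW) (h : V ≈ W) :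
    D.zeroExt V hV ≈ D.zeroExt W hW := by
  obtain ⟨e⟩ := h
  exact ⟨{ D.zeroExtMap hV hW e.toLinearMap with
    invFun := D.zeroExtMap hW hV e.symm.toLinearMap
    left_inv := e.symm_apply_apply
    right_inv := e.apply_symm_apply }⟩

theorem zeroExt_isExtension {X Y Z : FDModule k (MonoidAlgebra k G)} (hX) (hY) (hZ)
    (h : IsExtension X Y Z) :
    IsExtension (D.zeroExt X hX) (D.zeroExt Y hY) (D.zeroExt Z hZ) := by
  obtain ⟨f, g, hf, hfg, hg⟩ := h
  exact ⟨D.zeroExtMap hX hY f, D.zeroExtMap hY hZ g, hf, hfg, hg⟩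

theorem res_zeroExt (V : FDModule k (MonoidAlgebra k G)) (hV) :
    D.res (D.zeroExt V hV) ≈ V := by
  refine Setoid.symm (equiv_of_rep (M := V) (N := D.res (D.zeroExt V hV))
    ((D.zeroExtEquiv V hV).trans (D.resEquiv _)) (map_smul_of_of _ fun h v => ?_))
  rw [LinearEquiv.coe_coe, LinearEquiv.trans_apply, LinearEquiv.trans_apply,
    ← grp_smul_zeroExtEquiv, resEquiv_grp_smul]

theorem zeroExt_res (X : FDModule k D.Alg) (hX) (hy : ∀ x : X, D.y • x = 0) :
    D.zeroExt (D.res X) hX ≈ X := by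
  refine Setoid.symm (equiv_of_rep (M := X) (N := D.zeroExt (D.res X) hX)
    ((D.resEquiv X).trans (D.zeroExtEquiv _ hX)) (map_smul_of_generators _ (fun x => ?_)
      fun h x => ?_))
  · rw [LinearEquiv.coe_coe, LinearEquiv.trans_apply, LinearEquiv.trans_apply, hy, map_zero,
      map_zero, y_smul_zeroExtEquiv]
  · rw [LinearEquiv.coe_coe, LinearEquiv.trans_apply, LinearEquiv.trans_apply,
      grp_smul_zeroExtEquiv, resEquiv_grp_smul]

/-! ### Induction from the group algebra -/

section Ind

variable (hχ : D.χ ^ D.n = 1) (V : FDModule k (MonoidAlgebra k G))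

/-- The action of `y` on the induced module. -/
def indY : Module.End k (Fin D.n → V) :=
  LinearMap.lsum k (fun _ : Fin D.n => (V : Type u)) k (fun i =>
    -- The operator shifts coordinates cyclically; the last one wraps around as `y · y^{n-1} ⊗ v = 1
    -- ⊗ μ(g^n - 1)v`.
    if h : (i : ℕ) + 1 < D.n then LinearMap.single k (fun _ : Fin D.n => (V : Type u)) ⟨i + 1, h⟩
    else LinearMap.single k (fun _ : Fin D.n => (V : Type u)) ⟨0, D.n_pos⟩ ∘ₗ D.indTop V)

theorem indY_single_of_lt (i : Fin D.n) (h : (i : ℕ) + 1 < D.n) (v : V) :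
    D.indY V (Pi.single i v) = Pi.single ⟨i + 1, h⟩ v := by
  unfold indY
  rw [← LinearMap.single_apply (R := k), LinearMap.lsum_apply]
  simp only [LinearMap.sum_apply, LinearMap.comp_apply, LinearMap.proj_apply]
  rw [Finset.sum_eq_single i]
  · rw [dif_pos h]
    simp
  · intro j _ hj
    rw [LinearMap.single_apply, Pi.single_eq_of_ne hj, map_zero]
  · simp

theorem indY_single_last (i : Fin D.n) (h : ¬ (i : ℕ) + 1 < D.n) (v : V) :
    D.indY V (Pi.single i v) = Pi.single ⟨0, D.n_pos⟩ (D.indTop V v) := by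
  unfold indY
  rw [← LinearMap.single_apply (R := k), LinearMap.lsum_apply]
  simp only [LinearMap.sum_apply, LinearMap.comp_apply, LinearMap.proj_apply]
  rw [Finset.sum_eq_single i]
  · rw [dif_neg h]
    simp
  · intro j _ hj
    rw [LinearMap.single_apply, Pi.single_eq_of_ne hj, map_zero]
  · simp

theorem indY_pow_single (i : ℕ) (h : i < D.n) (v : V) :
    (D.indY V ^ i) (Pi.single ⟨0, D.n_pos⟩ v) = Pi.single ⟨i, h⟩ v := by
  induction i with
  | zero => rfl
  | succ i ih => rw [pow_succ', Module.End.mul_apply, ih (by omega), indY_single_of_lt _ _ _ h]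

/-- One full turn of the cycle passes the wrap-around exactly once. It is computed from coordinate
0; coordinate `i` follows since `y^n` commutes with `y^i`. -/
theorem indY_pow_n_single (i : Fin D.n) (v : V) :
    (D.indY V ^ D.n) (Pi.single i v) = Pi.single i (D.indTop V v) := by
  have h0 : (D.indY V ^ D.n) (Pi.single ⟨0, D.n_pos⟩ v) =
      Pi.single ⟨0, D.n_pos⟩ (D.indTop V v) := by
    have hn := D.n_pos
    have h1 : D.n = D.n - 1 + 1 := by omega
    have h2 : D.indY V ^ D.n = D.indY V * D.indY V ^ (D.n - 1) := by
      rw [← pow_succ', ← h1]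
    rw [h2, Module.End.mul_apply, indY_pow_single _ _ _ (by omega), indY_single_last]
    change ¬ D.n - 1 + 1 < D.n
    omega
  rw [← D.indY_pow_single V i i.2, ← Module.End.mul_apply, ← pow_add, add_comm, pow_add,
    Module.End.mul_apply, h0, indY_pow_single]

/-- The action on the induced module. -/
def indRep : D.Alg →ₐ[k] Module.End k (Fin D.n → V) :=
  D.lift
    { toFun := D.indGrp V
      map_one' := LinearMap.pi_ext fun i v => by
        rw [indGrp_single, map_one, map_one, inv_one, one_pow, Units.val_one, one_smul, one_smul]
        rfl
      map_mul' := fun h h' => LinearMap.pi_ext fun i v => by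
        rw [Module.End.mul_apply, indGrp_single, indGrp_single, indGrp_single, map_mul, map_mul,
          of_smul_smul, smul_smul, mul_smul, ← Units.val_mul, ← mul_pow, mul_inv] }
    (D.indY V)
    (LinearMap.pi_ext fun i v => by
      rw [indY_pow_n_single]
      change _ = D.μ • ((D.indGrp V D.g ^ D.n) (Pi.single i v) - Pi.single i v)
      -- The `m`-th power of `g` carries the scalar `χ(g)^{-im}`, which disappears at `m = n`.
      have h : ∀ m : ℕ, (D.indGrp V D.g ^ m) (Pi.single i v) =
          Pi.single i (((((D.χ D.g)⁻¹ ^ (i : ℕ)) ^ m : kˣ) : k) • of k G (D.g ^ m) • v) := by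
        intro m
        induction m with
        | zero => rw [pow_zero, pow_zero, pow_zero, map_one, Units.val_one, one_smul, one_smul]; rfl
        | succ m ih =>
          rw [pow_succ', Module.End.mul_apply, ih, indGrp_single, of_smul_smul, smul_smul,
            ← mul_smul, ← map_mul, ← pow_succ', ← Units.val_mul, ← pow_succ']
      rw [h, ← pow_mul, mul_comm, pow_mul, inv_pow, χ_g_pow_n, inv_one, one_pow, Units.val_one,
        one_smul, indTop_apply, ← Pi.single_sub, ← Pi.single_smul])
    (fun h => LinearMap.pi_ext fun i v => by
      change D.indY V (D.indGrp V h _) = (D.χ h : k) • D.indGrp V h (D.indY V _)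
      rw [indGrp_single]
      by_cases hi : (i : ℕ) + 1 < D.n
      · rw [indY_single_of_lt _ _ _ hi, indY_single_of_lt _ _ _ hi, indGrp_single,
          ← Pi.single_smul, smul_smul, ← Units.val_mul, pow_succ', mul_inv_cancel_left]
      · rw [indY_single_last _ _ _ hi, indY_single_last _ _ _ hi, indGrp_single,
          ← Pi.single_smul, smul_smul, ← Units.val_mul, map_smul, indTop_of_smul]
        -- At the wrap-around `y h = χ(h) h y` requires `χ(h)^{-(n-1)} = χ(h)`; this is the
        -- condition `χ^n = 1`.
        have hi' : (i : ℕ) + 1 = D.n := by omega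
        have h1 : (D.χ h)⁻¹ ^ (i : ℕ) = D.χ h := by
          have h2 := D.χ_inv_pow hχ h
          rw [← hi', pow_succ] at h2
          exact mul_inv_eq_one.mp h2
        rw [h1, pow_zero, mul_one])

/-- The module `H ⊗_{k[G]} V`. -/
def ind : FDModule k D.Alg := ofRep (Fin D.n → V) (D.indRep hχ V)

/-- The element `y^i ⊗ v` of the induced module. -/
def indMk (i : Fin D.n) : V →ₗ[k] D.ind hχ V :=
  LinearMap.single k (fun _ : Fin D.n => (V : Type u)) i

theorem grp_smul_indMk (h : G) (i : Fin D.n) (v : V) :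
    D.grp h • D.indMk hχ V i v =
      D.indMk hχ V i ((((D.χ h)⁻¹ ^ (i : ℕ) : kˣ) : k) • of k G h • v) := by
  change D.indRep hχ V (D.grp h) (Pi.single i v) = Pi.single _ _
  rw [indRep, lift_grp]
  exact D.indGrp_single V h i v

theorem y_smul_indMk_of_lt (i : Fin D.n) (h : (i : ℕ) + 1 < D.n) (v : V) :
    D.y • D.indMk hχ V i v = D.indMk hχ V ⟨i + 1, h⟩ v := by
  change D.indRep hχ V D.y (Pi.single i v) = Pi.single _ _
  rw [indRep, lift_y]
  exact D.indY_single_of_lt V i h v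

theorem y_smul_indMk_last (i : Fin D.n) (h : ¬ (i : ℕ) + 1 < D.n) (v : V) :
    D.y • D.indMk hχ V i v = D.indMk hχ V ⟨0, D.n_pos⟩ (D.indTop V v) := by
  change D.indRep hχ V D.y (Pi.single i v) = Pi.single _ _
  rw [indRep, lift_y]
  exact D.indY_single_last V i h v

theorem ind_ext {W : Type*} [AddCommGroup W] [Module k W] {f f' : D.ind hχ V →ₗ[k] W}
    (h : ∀ i v, f (D.indMk hχ V i v) = f' (D.indMk hχ V i v)) : f = f' :=
  LinearMap.pi_ext (M := W) h

theorem y_pow_smul_indMk (i : ℕ) (hi : i < D.n) (v : V) :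
    D.y ^ i • D.indMk hχ V ⟨0, D.n_pos⟩ v = D.indMk hχ V ⟨i, hi⟩ v := by
  induction i with
  | zero => rw [pow_zero, one_smul]
  | succ i ih => rw [pow_succ', mul_smul, ih (by omega), y_smul_indMk_of_lt _ _ _ _ hi]

section Lift

variable {V} {W : Type*} [AddCommGroup W] [Module k W] [Module D.Alg W] [IsScalarTower k D.Alg W]

/-- The `k`-linear map underlying `indLift`. -/
def indLiftLin (φ : V →ₗ[k] W) : D.ind hχ V →ₗ[k] W :=
  LinearMap.lsum k (fun _ : Fin D.n => (V : Type u)) k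
    (fun i => Algebra.lsmul k k W (D.y ^ (i : ℕ)) ∘ₗ φ)

theorem indLiftLin_apply (φ : V →ₗ[k] W) (x : Fin D.n → V) :
    D.indLiftLin hχ φ x = ∑ i : Fin D.n, D.y ^ (i : ℕ) • φ (x i) := by
  have h : LinearMap.lsum k (fun _ : Fin D.n => (V : Type u)) k
      (fun i => Algebra.lsmul k k W (D.y ^ (i : ℕ)) ∘ₗ φ) x =
      ∑ i : Fin D.n, D.y ^ (i : ℕ) • φ (x i) := by
    rw [LinearMap.lsum_apply, LinearMap.sum_apply]
    rfl
  exact h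

theorem indLiftLin_mk (φ : V →ₗ[k] W) (i : Fin D.n) (v : V) :
    D.indLiftLin hχ φ (D.indMk hχ V i v) = D.y ^ (i : ℕ) • φ v := by
  refine (D.indLiftLin_apply hχ φ (Pi.single i v)).trans ?_
  rw [Finset.sum_eq_single i]
  · rw [Pi.single_eq_same]
  · intro j _ hj
    rw [Pi.single_eq_of_ne hj, map_zero, smul_zero]
  · simp

/-- The universal property of the induced module. -/
def indLift (φ : V →ₗ[k] W) (hφ : ∀ h v, φ (of k G h • v) = D.grp h • φ v) :
    D.ind hχ V →ₗ[D.Alg] W :=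
  { D.indLiftLin hχ φ with
    map_smul' := by
      refine map_smul_of_generators (D.indLiftLin hχ φ) ?_ ?_
      · have : D.indLiftLin hχ φ ∘ₗ Algebra.lsmul k k _ D.y =
            Algebra.lsmul k k _ D.y ∘ₗ D.indLiftLin hχ φ := D.ind_ext hχ V fun i v => by
          change D.indLiftLin hχ φ (D.y • D.indMk hχ V i v) =
            D.y • D.indLiftLin hχ φ (D.indMk hχ V i v)
          rw [indLiftLin_mk]
          by_cases hi : (i : ℕ) + 1 < D.n
          · rw [y_smul_indMk_of_lt _ _ _ _ hi, indLiftLin_mk, pow_succ', mul_smul]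
          -- At the wrap-around both sides are `y^n φ(v) = μ(g^n - 1)φ(v)`, by the relation in `H`
          -- acting on `W`.
          · have hi' : (i : ℕ) + 1 = D.n := by omega
            rw [y_smul_indMk_last _ _ _ _ hi, indLiftLin_mk, ← mul_smul, ← pow_succ', hi', y_pow,
              indTop_apply, map_smul, map_sub, hφ, pow_zero, one_smul, smul_assoc, sub_smul,
              one_smul, map_pow]
        exact DFunLike.congr_fun this
      · intro h
        have : D.indLiftLin hχ φ ∘ₗ Algebra.lsmul k k _ (D.grp h) =
            Algebra.lsmul k k _ (D.grp h) ∘ₗ D.indLiftLin hχ φ := D.ind_ext hχ V fun i v => by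
          change D.indLiftLin hχ φ (D.grp h • D.indMk hχ V i v) =
            D.grp h • D.indLiftLin hχ φ (D.indMk hχ V i v)
          rw [grp_smul_indMk, indLiftLin_mk, indLiftLin_mk, map_smul, hφ, ← mul_smul,
            grp_mul_y_pow, smul_assoc, mul_smul]
          exact ((Algebra.lsmul k k W (D.y ^ (i : ℕ))).map_smul _ _)
        exact DFunLike.congr_fun this }

theorem indLift_mk (φ : V →ₗ[k] W) (hφ) (i : Fin D.n) (v : V) :
    D.indLift hχ φ hφ (D.indMk hχ V i v) = D.y ^ (i : ℕ) • φ v :=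
  D.indLiftLin_mk hχ φ i v

theorem indLift_apply (φ : V →ₗ[k] W) (hφ) (x : Fin D.n → V) :
    D.indLift hχ φ hφ x = ∑ i : Fin D.n, D.y ^ (i : ℕ) • φ (x i) :=
  D.indLiftLin_apply hχ φ x

/-- The induced module is generated by `1 ⊗ V`, since `y^i ⊗ v = y^i · (1 ⊗ v)`. -/
theorem ind_hom_ext {f f' : D.ind hχ V →ₗ[D.Alg] W}
    (h : ∀ v, f (D.indMk hχ V ⟨0, D.n_pos⟩ v) = f' (D.indMk hχ V ⟨0, D.n_pos⟩ v)) : f = f' := by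
  have : f.restrictScalars k = f'.restrictScalars k := D.ind_ext hχ V fun i v => by
    change f _ = f' _
    rw [← D.y_pow_smul_indMk hχ V i i.2, map_smul, map_smul, h]
  exact LinearMap.restrictScalars_injective k this

theorem of_smul_indMk_zero (h : G) (v : V) :
    D.indMk hχ V ⟨0, D.n_pos⟩ (of k G h • v) = D.grp h • D.indMk hχ V ⟨0, D.n_pos⟩ v := by
  rw [grp_smul_indMk, pow_zero, Units.val_one, one_smul]

end Lift

/-- Frobenius reciprocity: restriction to `1 ⊗ V` is inverse to `indLift`. -/
theorem homDim_ind (X : FDModule k D.Alg) : homDim (D.ind hχ V) X = homDim V (D.res X) := by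
  let e : (D.ind hχ V →ₗ[D.Alg] X) ≃ₗ[k] (V →ₗ[MonoidAlgebra k G] D.res X) :=
    { toFun := fun f =>
        let F : V →ₗ[k] D.res X :=
          (D.resEquiv X).toLinearMap ∘ₗ f.restrictScalars k ∘ₗ D.indMk hχ V ⟨0, D.n_pos⟩
        { F with
          map_smul' := map_smul_of_of F fun h v => by
            change D.resEquiv X (f (D.indMk hχ V _ (of k G h • v))) =
              of k G h • D.resEquiv X (f (D.indMk hχ V _ v))
            rw [of_smul_indMk_zero, map_smul, resEquiv_grp_smul] }
      invFun := fun φ => D.indLift hχ ((D.resEquiv X).symm.toLinearMap ∘ₗ φ.restrictScalars k)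
        (fun h v => by
          apply (D.resEquiv X).injective
          rw [resEquiv_grp_smul]
          exact φ.map_smul _ _)
      left_inv := fun f => D.ind_hom_ext hχ fun v => by
        rw [indLift_mk, pow_zero, one_smul]
        rfl
      right_inv := fun φ => LinearMap.ext fun v => by
        change D.resEquiv X (D.indLift hχ _ _ (D.indMk hχ V _ v)) = _
        rw [indLift_mk, pow_zero, one_smul]
        rfl
      map_add' := fun f f' => rfl
      map_smul' := fun c f => rfl }
  exact congrArg Nat.cast e.finrank_eq

/-- Induction is left adjoint to the exact functor of restriction, and every `k[G]`-module is
projective. Concretely, `1 ⊗ V` is lifted over `k[G]` and the lift is extended to `H` by `indLift`.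
-/
theorem ind_projective [CharZero k] : Module.Projective D.Alg (D.ind hχ V) := by
  have : NeZero (Nat.card G : k) := ⟨Nat.cast_ne_zero.mpr Nat.card_pos.ne'⟩
  refine Module.Projective.of_lifting_property'' fun f hf => ?_
  let X := D.ind hχ V
  let W := (X : Type u) →₀ D.Alg
  -- The free cover `W` need not be finite dimensional, so it is restricted to `k[G]` directly and
  -- not through `res`.
  let _ : Module (MonoidAlgebra k G) W := Module.compHom W D.incl.toRingHom
  have hW : ∀ (a : MonoidAlgebra k G) (w : W), a • w = D.incl a • w := fun _ _ => rfl
  let F : W →ₗ[MonoidAlgebra k G] D.res X :=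
    { toFun := fun x => D.resEquiv X (f x)
      map_add' := fun x y => by rw [map_add, map_add]
      map_smul' := fun a x => by rw [hW, map_smul, resEquiv_smul, RingHom.id_apply] }
  let ι : V →ₗ[MonoidAlgebra k G] D.res X :=
    let I : V →ₗ[k] D.res X := (D.resEquiv X).toLinearMap ∘ₗ D.indMk hχ V ⟨0, D.n_pos⟩
    { I with
      map_smul' := map_smul_of_of I fun h v => by
        change D.resEquiv X (D.indMk hχ V _ (of k G h • v)) =
          of k G h • D.resEquiv X (D.indMk hχ V _ v)
        rw [of_smul_indMk_zero, resEquiv_grp_smul] }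
  have hV : Module.Projective (MonoidAlgebra k G) V := Module.projective_of_isSemisimpleRing _ _
  obtain ⟨φ, hφ⟩ := Module.projective_lifting_property F ι hf
  have hφ' : ∀ v, f (φ v) = D.indMk hχ V ⟨0, D.n_pos⟩ v := DFunLike.congr_fun hφ
  have : IsScalarTower k (MonoidAlgebra k G) W := ⟨fun c a w => by
    rw [hW, hW, map_smul, smul_assoc]⟩
  refine ⟨D.indLift hχ (φ.restrictScalars k) (fun h v => ?_), D.ind_hom_ext hχ fun v => ?_⟩
  · rw [LinearMap.restrictScalars_apply, map_smul, hW, incl_of]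
    rfl
  · rw [LinearMap.comp_apply, indLift_mk, pow_zero, one_smul]
    exact hφ' v

end Ind

end GroupDatum

set_option linter.unusedSectionVars false

/-- A choice of representatives of the orbits of multiplication by a root of unity. -/
theorem exists_orbit_representatives {k : Type u} [Field k] {q : k} {n : ℕ} (hn : 0 < n)
    (hq : IsPrimitiveRoot q n) :
    ∃ R : k → Prop, (∀ c, ∃ l < n, R (q ^ l * c)) ∧
      ∀ c ≠ 0, ∀ l < n, ∀ m < n, R (q ^ l * c) → R (q ^ m * c) → l = m := by
  let s : Setoid k :=
    { r := fun c d => ∃ i : ℕ, d = q ^ i * c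
      iseqv :=
        { refl := fun c => ⟨0, by simp⟩
          symm := by
            rintro c _ ⟨i, rfl⟩
            -- The exponent `i(n - 1)` is congruent to `-i` modulo `n`.
            refine ⟨i * (n - 1), ?_⟩
            have h : i * (n - 1) + i = n * i := by
              obtain ⟨m, rfl⟩ : ∃ m, n = m + 1 := ⟨n - 1, by omega⟩
              rw [Nat.add_sub_cancel]
              ring
            rw [← mul_assoc, ← pow_add, h, pow_mul, hq.pow_eq_one, one_pow, one_mul]
          trans := by
            rintro c _ _ ⟨i, rfl⟩ ⟨j, rfl⟩
            exact ⟨j + i, by rw [pow_add, mul_assoc]⟩ } }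
  have hs : ∀ (c : k) (i : ℕ), (Quotient.mk s (q ^ i * c)).out = (Quotient.mk s c).out :=
    fun c i => congrArg Quotient.out (Quotient.sound (s := s) (Setoid.symm ⟨i, rfl⟩))
  -- `R c` says that `c` is the chosen element of its orbit. The orbit of 0 is a single point, which
  -- is why uniqueness of the exponent needs `c ≠ 0`.
  refine ⟨fun c => (Quotient.mk s c).out = c, fun c => ?_, fun c hc l hl m hm h1 h2 => ?_⟩
  · obtain ⟨i, hi⟩ : s.r c (Quotient.mk s c).out := Setoid.symm (Quotient.mk_out c)
    refine ⟨i % n, Nat.mod_lt _ hn, ?_⟩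
    change (Quotient.mk s (q ^ (i % n) * c)).out = _
    rw [hs, hi]
    congr 1
    conv_lhs => rw [← Nat.mod_add_div i n, pow_add, pow_mul, hq.pow_eq_one, one_pow, mul_one]
  · exact hq.pow_inj hl hm (mul_right_cancel₀ hc
      (h1.symm.trans ((hs c l).trans ((hs c m).symm.trans h2))))

/-! ### Functoriality and exactness of induction -/

namespace GroupDatum

open MonoidAlgebra

variable {k : Type u} {G : Type w} [Field k] [Group G] (D : GroupDatum k G) [Finite G]

section Ind

variable (hχ : D.χ ^ D.n = 1)

/-- Induction of homomorphisms. -/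
def indMap {V W : FDModule k (MonoidAlgebra k G)} (f : V →ₗ[MonoidAlgebra k G] W) :
    D.ind hχ V →ₗ[D.Alg] D.ind hχ W :=
  D.indLift hχ (D.indMk hχ W ⟨0, D.n_pos⟩ ∘ₗ f.restrictScalars k) (fun h v => by
    rw [LinearMap.comp_apply, LinearMap.restrictScalars_apply, map_smul, of_smul_indMk_zero]
    rfl)

theorem indMap_mk {V W : FDModule k (MonoidAlgebra k G)} (f : V →ₗ[MonoidAlgebra k G] W)
    (i : Fin D.n) (v : V) : D.indMap hχ f (D.indMk hχ V i v) = D.indMk hχ W i (f v) :=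
  (D.indLift_mk hχ _ _ i v).trans (D.y_pow_smul_indMk hχ W i i.2 (f v))

/-- The coordinates of an element of the induced module. -/
def indEquiv (V : FDModule k (MonoidAlgebra k G)) : D.ind hχ V ≃ₗ[k] (Fin D.n → V) :=
  LinearEquiv.refl k _

/-- An induced map acts coordinatewise, so injectivity, surjectivity and exactness all pass from `V
→ W` to the induced modules. -/
theorem indEquiv_indMap {V W : FDModule k (MonoidAlgebra k G)} (f : V →ₗ[MonoidAlgebra k G] W)
    (x : D.ind hχ V) (i : Fin D.n) :
    D.indEquiv hχ W (D.indMap hχ f x) i = f (D.indEquiv hχ V x i) := by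
  let F : (Fin D.n → V) →ₗ[k] (Fin D.n → W) :=
    LinearMap.pi fun i => f.restrictScalars k ∘ₗ LinearMap.proj i
  have h : (D.indEquiv hχ W).toLinearMap ∘ₗ (D.indMap hχ f).restrictScalars k =
      F ∘ₗ (D.indEquiv hχ V).toLinearMap := D.ind_ext hχ V fun i v => by
    refine (D.indMap_mk hχ f i v).trans ?_
    change Pi.single i (f v) = fun j => f (Pi.single (M := fun _ => (V : Type u)) i v j)
    ext j
    rcases eq_or_ne j i with rfl | hj
    · simp
    · simp [hj]
  exact congrFun (DFunLike.congr_fun h x) i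

theorem indMap_injective {V W : FDModule k (MonoidAlgebra k G)} {f : V →ₗ[MonoidAlgebra k G] W}
    (hf : Function.Injective f) : Function.Injective (D.indMap hχ f) := fun x y hxy =>
  (D.indEquiv hχ V).injective (funext fun i => hf (by
    rw [← indEquiv_indMap, hxy, indEquiv_indMap]))

theorem indMap_surjective {V W : FDModule k (MonoidAlgebra k G)} {f : V →ₗ[MonoidAlgebra k G] W}
    (hf : Function.Surjective f) : Function.Surjective (D.indMap hχ f) := fun x => by
  choose y hy using fun i => hf (D.indEquiv hχ W x i)
  refine ⟨(D.indEquiv hχ V).symm y, (D.indEquiv hχ W).injective (funext fun i => ?_)⟩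
  rw [indEquiv_indMap, LinearEquiv.apply_symm_apply, hy]

theorem ind_isExtension {X Y Z : FDModule k (MonoidAlgebra k G)} (h : IsExtension X Y Z) :
    IsExtension (D.ind hχ X) (D.ind hχ Y) (D.ind hχ Z) := by
  obtain ⟨f, g, hf, hfg, hg⟩ := h
  refine ⟨D.indMap hχ f, D.indMap hχ g, D.indMap_injective hχ hf, fun x => ⟨fun hx => ?_, ?_⟩,
    D.indMap_surjective hχ hg⟩
  · have h : ∀ i, g (D.indEquiv hχ Y x i) = 0 := fun i => by
      rw [← indEquiv_indMap, hx, map_zero, Pi.zero_apply]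
    choose y hy using fun i => (hfg _).mp (h i)
    refine ⟨(D.indEquiv hχ X).symm y, (D.indEquiv hχ Y).injective (funext fun i => ?_)⟩
    rw [indEquiv_indMap, LinearEquiv.apply_symm_apply, hy]
  · rintro ⟨y, rfl⟩
    refine (D.indEquiv hχ Z).injective (funext fun i => ?_)
    rw [indEquiv_indMap, indEquiv_indMap, hfg.apply_apply_eq_zero, map_zero, Pi.zero_apply]

theorem ind_congr {V W : FDModule k (MonoidAlgebra k G)} (h : V ≈ W) :
    D.ind hχ V ≈ D.ind hχ W := by
  obtain ⟨e⟩ := h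
  exact ⟨LinearEquiv.ofBijective (D.indMap hχ e.toLinearMap)
    ⟨D.indMap_injective hχ e.injective, D.indMap_surjective hχ e.surjective⟩⟩

end Ind

/-! ### Modules on which `g^n` acts trivially -/

/-- Since `g^n = 1` on `W`, the relation gives `y^n = 0`. The kernel `K` of `y` is a submodule,
nonzero unless `W` is zero, on which `y` already acts as zero, and `W/K` has smaller dimension. By
induction, replacing `y` by zero does not change the class in `G₀(H)`. -/
theorem zeroExt_res_class {W : FDModule k D.Alg}
    (hW : ∀ v : D.res W, of k G (D.g ^ D.n) • v = v) :
    grothendieckClass (D.zeroExt (D.res W) hW) = grothendieckClass W := by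
  induction hd : Module.finrank k W using Nat.strong_induction_on generalizing W with
  | _ d ih =>
    subst hd
    rcases subsingleton_or_nontrivial W with h0 | h0
    · have : Subsingleton (D.zeroExt (D.res W) hW) := h0
      rw [grothendieckClass_eq_zero, grothendieckClass_eq_zero]
    let K : Submodule D.Alg W :=
      { carrier := {x | D.y • x = 0}
        add_mem' := fun {x y} hx hy => by
          rw [Set.mem_ofPred_eq] at *
          rw [smul_add, hx, hy, add_zero]
        zero_mem' := smul_zero _
        smul_mem' := fun a x hx => by
          rw [Set.mem_ofPred_eq] at *
          -- The kernel of `y` is stable because `y` commutes with each generator up to a scalar.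
          induction a using alg_induction generalizing x with
          | hy => rw [hx, smul_zero]
          | hg h => rw [← mul_smul, y_mul_grp, smul_assoc, mul_smul, hx, smul_zero, smul_zero]
          | hs c => rw [← mul_smul, ← Algebra.commutes, mul_smul, hx, smul_zero]
          | ha a b ha hb => rw [add_smul, smul_add, ha x hx, hb x hx, add_zero]
          | hm a b ha hb => rw [mul_smul, ha _ (hb _ hx)] }
    have hyn : ∀ x : W, D.y ^ D.n • x = 0 := fun x => by
      have h1 : D.grp (D.g ^ D.n) • x = x := by
        apply (D.resEquiv W).injective
        rw [resEquiv_grp_smul, hW]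
      rw [y_pow, smul_assoc, sub_smul, one_smul, ← map_pow, h1, sub_self, smul_zero]
    have hK : K ≠ ⊥ := by
      intro hK
      -- If `y` were injective then so would be `y^n = 0`, contradicting `W ≠ 0`.
      have h1 : ∀ (m : ℕ) (x : W), D.y ^ m • x = 0 → x = 0 := by
        intro m
        induction m with
        | zero => intro x hx; rwa [pow_zero, one_smul] at hx
        | succ m ih =>
          intro x hx
          rw [pow_succ', mul_smul] at hx
          have : D.y ^ m • x ∈ K := hx
          rw [hK, Submodule.mem_bot] at this
          exact ih x this
      obtain ⟨x, hx⟩ := exists_ne (0 : W)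
      exact hx (h1 _ x (hyn x))
    have hlt : Module.finrank k (W.ofQuot K) < Module.finrank k W := by
      let π : W →ₗ[k] W.ofQuot K := K.mkQ.restrictScalars k
      have h1 := LinearMap.finrank_range_add_finrank_ker π
      have h2 : LinearMap.range π = ⊤ := LinearMap.range_eq_top.mpr K.mkQ_surjective
      rw [h2, finrank_top] at h1
      have h3 : 0 < Module.finrank k (LinearMap.ker π) := by
        obtain ⟨x, hx, hx0⟩ := K.exists_mem_ne_zero_of_ne_bot hK
        have : Nontrivial (LinearMap.ker π) :=
          ⟨⟨⟨x, (Submodule.Quotient.mk_eq_zero K).mpr hx⟩, 0, fun h => hx0 (congrArg Subtype.val h)⟩⟩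
        exact Module.finrank_pos
      omega
    have hext := isExtension_ofQuot W K
    have hK1 : ∀ v : D.res (W.ofSub K), of k G (D.g ^ D.n) • v = v := fun v =>
      Subtype.ext (hW (D.resEquiv W ((show K from v) : W)))
    have hK2 : ∀ v : D.res (W.ofQuot K), of k G (D.g ^ D.n) • v = v := fun v => by
      obtain ⟨x, rfl⟩ := K.mkQ_surjective v
      exact congrArg K.mkQ (hW (D.resEquiv W x))
    rw [grothendieckClass_of_isExtension hext, grothendieckClass_of_isExtension
      (D.zeroExt_isExtension hK1 hW hK2 (D.res_isExtension hext)), ih _ hlt hK2 rfl,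
      grothendieckClass_congr (D.zeroExt_res (W.ofSub K) hK1 (fun x => Subtype.ext x.2))]

/-! ### The blocks of `k[G]`-modules -/

/-- The idempotent of `k[G]` that projects to the part on which `g^n` acts trivially. -/
def zeroIdem : MonoidAlgebra k G :=
  spectralProj (orderOf D.g) (of k G (D.g ^ D.n)) (fun c : k => c = 1)

/-- Representatives of the orbits of multiplication by `χ(g)`. -/
def IsRep : k → Prop := Classical.choose (exists_orbit_representatives D.n_pos D.isPrimitiveRoot)

theorem exists_isRep (c : k) : ∃ l < D.n, D.IsRep ((D.χ D.g : k) ^ l * c) :=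
  (Classical.choose_spec (exists_orbit_representatives D.n_pos D.isPrimitiveRoot)).1 c

theorem isRep_unique {c : k} (hc : c ≠ 0) {l m : ℕ} (hl : l < D.n) (hm : m < D.n)
    (h : D.IsRep ((D.χ D.g : k) ^ l * c)) (h' : D.IsRep ((D.χ D.g : k) ^ m * c)) : l = m :=
  (Classical.choose_spec (exists_orbit_representatives D.n_pos D.isPrimitiveRoot)).2
    c hc l hl m hm h h'

/-- The scalars `c` that represent their orbit and satisfy `c^n ≠ 1`. -/
def IsRepOne (c : k) : Prop := c ^ D.n ≠ 1 ∧ D.IsRep c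

/-- The idempotent of `k[G]` that projects to the part on which the eigenvalues of `g` satisfy
`IsRepOne`. -/
def repIdem : MonoidAlgebra k G := spectralProj (orderOf D.g) (of k G D.g) D.IsRepOne

theorem orderOf_g_pos : 0 < orderOf D.g := orderOf_pos D.g

theorem of_g_pow : of k G D.g ^ orderOf D.g = 1 := by
  rw [← map_pow, pow_orderOf_eq_one, map_one]

theorem of_g_pow_n_pow : of k G (D.g ^ D.n) ^ orderOf D.g = 1 := by
  rw [← map_pow, ← pow_mul, mul_comm, pow_mul, pow_orderOf_eq_one, one_pow, map_one]

theorem zeroIdem_comm (a : MonoidAlgebra k G) : Commute D.zeroIdem a := by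
  refine commute_spectralProj _ ?_ _
  rw [map_pow]
  exact (D.g_smul_comm a).pow_left _

theorem repIdem_comm (a : MonoidAlgebra k G) : Commute D.repIdem a :=
  commute_spectralProj _ (D.g_smul_comm a) _

/-- A polynomial in the central element `g^n` is central in `H`, so this block is an `H`-submodule.
By contrast `repIdem` is a polynomial in `g`, which commutes with `y` only up to `χ(g)`; it cuts out
only a `k[G]`-submodule. -/
theorem incl_zeroIdem_comm (a : D.Alg) : Commute (D.incl D.zeroIdem) a := by
  unfold zeroIdem
  rw [map_spectralProj, incl_of]
  exact commute_spectralProj _ (D.grp_pow_commute a) _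

/-- The part of a module on which `g^n` acts trivially. -/
def zeroPart (V : FDModule k (MonoidAlgebra k G)) : FDModule k (MonoidAlgebra k G) :=
  V.cut D.zeroIdem D.zeroIdem_comm

/-- The part of a module on which the eigenvalues of `g` satisfy `IsRepOne`. -/
def repPart (V : FDModule k (MonoidAlgebra k G)) : FDModule k (MonoidAlgebra k G) :=
  V.cut D.repIdem D.repIdem_comm

section Module

variable {V : FDModule k (MonoidAlgebra k G)}

open Classical in
theorem zeroIdem_smul {c : k} {v : V} (h : of k G (D.g ^ D.n) • v = c • v) :
    D.zeroIdem • v = if c = 1 then v else 0 :=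
  spectralProj_smul D.orderOf_g_pos D.of_g_pow_n_pow _ h

open Classical in
theorem repIdem_smul {c : k} {v : V} (h : of k G D.g • v = c • v) :
    D.repIdem • v = if D.IsRepOne c then v else 0 :=
  spectralProj_smul D.orderOf_g_pos D.of_g_pow _ h

theorem g_pow_n_smul {c : k} {v : V} (h : of k G D.g • v = c • v) :
    of k G (D.g ^ D.n) • v = c ^ D.n • v := by
  rw [map_pow]
  exact pow_smul_of_smul_eq h _

variable [IsAlgClosed k] [CharZero k]

theorem g_pow_n_zeroIdem_smul (v : V) :
    of k G (D.g ^ D.n) • D.zeroIdem • v = D.zeroIdem • v := by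
  classical
  induction v using eigen_induction (k := k) (M := V) D.orderOf_g_pos D.of_g_pow_n_pow with
  | hz => simp only [smul_zero]
  | hadd x y hx hy => simp only [smul_add, hx, hy]
  | he c x h =>
    rw [D.zeroIdem_smul h]
    split_ifs with hc
    · rw [h, hc, one_smul]
    · rw [smul_zero]

theorem zeroIdem_smul_zeroIdem_smul (v : V) : D.zeroIdem • D.zeroIdem • v = D.zeroIdem • v := by
  rw [D.zeroIdem_smul (c := 1), if_pos rfl]
  rw [g_pow_n_zeroIdem_smul, one_smul]

/-- The two idempotents select disjoint eigenvalues of `g`: `c^n = 1` for the first, `c^n ≠ 1` for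
the second. -/
theorem zeroIdem_smul_repIdem_smul (v : V) : D.zeroIdem • D.repIdem • v = 0 := by
  classical
  induction v using eigen_induction (k := k) (M := V) D.orderOf_g_pos D.of_g_pow with
  | hz => simp only [smul_zero]
  | hadd x y hx hy => simp only [smul_add, hx, hy, add_zero]
  | he c x h =>
    rw [D.repIdem_smul h]
    split_ifs with hc
    · rw [D.zeroIdem_smul (D.g_pow_n_smul h), if_neg hc.1]
    · rw [smul_zero]

theorem g_pow_n_smul_zeroPart (v : D.zeroPart V) : of k G (D.g ^ D.n) • v = v := by
  have h : D.zeroIdem • v = v := cut_smul v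
  rw [← h, g_pow_n_zeroIdem_smul]

end Module

/-- The inverse of the restriction map. -/
def blockLift [IsAlgClosed k] [CharZero k] (hχ : D.χ ^ D.n = 1) :
    GreenRing k (MonoidAlgebra k G) →+ GrothendieckRing k D.Alg :=
  -- On the block `g^n = 1`, `y` is made zero; on the rest, one eigenspace of `g` per orbit is
  -- induced up. The map is only additive, and serves as a left inverse of `resHom`.
  greenLift (fun V => grothendieckClass (D.zeroExt (D.zeroPart V) D.g_pow_n_smul_zeroPart) +
      grothendieckClass (D.ind hχ (D.repPart V)))
    (fun V W h => congrArg₂ _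
      (grothendieckClass_congr (D.zeroExt_congr _ _ (cut_congr _ _ h)))
      (grothendieckClass_congr (D.ind_congr hχ (cut_congr _ _ h))))
    (fun V W => by
      have hV : ∀ v : directSum (D.zeroPart V) (D.zeroPart W),
          of k G (D.g ^ D.n) • v = v := fun v =>
        Prod.ext (D.g_pow_n_smul_zeroPart v.1) (D.g_pow_n_smul_zeroPart v.2)
      have h1 : D.zeroPart (directSum V W) ≈ directSum (D.zeroPart V) (D.zeroPart W) :=
        cut_directSum _ _ _ _
      have h2 : D.repPart (directSum V W) ≈ directSum (D.repPart V) (D.repPart W) :=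
        cut_directSum _ _ _ _
      rw [grothendieckClass_congr (D.zeroExt_congr _ hV h1),
        grothendieckClass_congr (D.ind_congr hχ h2),
        grothendieckClass_of_isExtension (D.zeroExt_isExtension D.g_pow_n_smul_zeroPart hV
          D.g_pow_n_smul_zeroPart (isExtension_directSum _ _)),
        grothendieckClass_of_isExtension (D.ind_isExtension hχ (isExtension_directSum _ _))]
      abel)

/-! ### The block decomposition of an `H`-module and injectivity of restriction -/

section Main

variable [IsAlgClosed k] [CharZero k] (hχ : D.χ ^ D.n = 1) (X : FDModule k D.Alg)

/-- The part of a module on which `g^n` acts trivially. -/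
def algZeroPart : FDModule k D.Alg := X.cut (D.incl D.zeroIdem) D.incl_zeroIdem_comm

/-- The inclusion of `repPart`. -/
def repIncl : D.repPart (D.res X) →ₗ[k] X :=
  (D.resEquiv X).symm.toLinearMap ∘ₗ
    ((D.res X).cutSubmodule D.repIdem D.repIdem_comm).subtype.restrictScalars k

theorem repIncl_injective : Function.Injective (D.repIncl X) := Subtype.val_injective

theorem resEquiv_repIncl (v : D.repPart (D.res X)) :
    D.repIdem • D.resEquiv X (D.repIncl X v) = D.resEquiv X (D.repIncl X v) := v.2

theorem repIncl_smul (h : G) (v : D.repPart (D.res X)) :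
    D.repIncl X (of k G h • v) = D.grp h • D.repIncl X v := by
  apply (D.resEquiv X).injective
  rw [resEquiv_grp_smul]
  rfl

/-- The map from an induced module to `X`. -/
def repInd : D.ind hχ (D.repPart (D.res X)) →ₗ[D.Alg] X :=
  D.indLift hχ (D.repIncl X) (D.repIncl_smul X)

/-- The projection to the part on which `g^n` acts trivially. -/
def toAlgZeroPart : X →ₗ[D.Alg] D.algZeroPart X where
  toFun x := ⟨D.incl D.zeroIdem • x, D.zeroIdem_smul_zeroIdem_smul (D.resEquiv X x)⟩
  map_add' x y := Subtype.ext (smul_add _ _ _)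
  map_smul' a x := Subtype.ext (by
    change D.incl D.zeroIdem • a • x = a • D.incl D.zeroIdem • x
    rw [← mul_smul, (D.incl_zeroIdem_comm a).eq, mul_smul])

theorem toAlgZeroPart_eq_zero_iff (x : X) :
    D.toAlgZeroPart X x = 0 ↔ D.zeroIdem • D.resEquiv X x = 0 := Subtype.ext_iff

theorem toAlgZeroPart_surjective : Function.Surjective (D.toAlgZeroPart X) := fun x =>
  ⟨x.1, Subtype.ext x.2⟩

variable {X}

/-- From `g y = χ(g)⁻¹ y g`, each application of `y` multiplies the eigenvalue of `g` by `χ(g)⁻¹`.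
-/
theorem g_smul_y_pow_smul {c : k} {x : X} (h : of k G D.g • D.resEquiv X x = c • D.resEquiv X x)
    (i : ℕ) : of k G D.g • D.resEquiv X (D.y ^ i • x) =
      ((((D.χ D.g)⁻¹ ^ i : kˣ) : k) * c) • D.resEquiv X (D.y ^ i • x) := by
  have h' : D.grp D.g • x = c • x := by
    apply (D.resEquiv X).injective
    rw [resEquiv_grp_smul, h, map_smul]
  rw [← resEquiv_grp_smul, ← map_smul, ← mul_smul, grp_mul_y_pow, smul_assoc, mul_smul, h',
    mul_smul]
  congr 2
  exact (Algebra.lsmul k k X (D.y ^ i)).map_smul c x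

theorem repInd_mk (i : Fin D.n) (v : D.repPart (D.res X)) :
    D.repInd hχ X (D.indMk hχ _ i v) = D.y ^ (i : ℕ) • D.repIncl X v :=
  D.indLift_mk hχ _ _ i v

theorem toAlgZeroPart_comp_repInd : D.toAlgZeroPart X ∘ₗ D.repInd hχ X = 0 :=
  D.ind_hom_ext hχ fun v => by
    rw [LinearMap.comp_apply, repInd_mk, pow_zero, one_smul, LinearMap.zero_apply,
      toAlgZeroPart_eq_zero_iff, ← resEquiv_repIncl, zeroIdem_smul_repIdem_smul]

/-- It suffices to treat an eigenvector `x` of `g` with eigenvalue `c`, `c^n ≠ 1`. If `χ(g)^l c`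
represents the orbit of `c`, then `y^{n-l}x` lies in the representative part, and `y^l` brings it
back to `y^n x = μ(c^n - 1)x`, a nonzero multiple of `x`. -/
theorem sub_mem_range_repInd (hμ : D.μ ≠ 0) (x : D.res X) :
    (D.resEquiv X).symm (x - D.zeroIdem • x) ∈ LinearMap.range (D.repInd hχ X) := by
  classical
  induction x using eigen_induction (k := k) (M := D.res X) D.orderOf_g_pos D.of_g_pow with
  | hz => simp only [smul_zero, sub_zero, map_zero, zero_mem]
  | hadd x y hx hy =>
    rw [smul_add, add_sub_add_comm, map_add]
    exact add_mem hx hy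
  | he c x h =>
    rw [D.zeroIdem_smul (D.g_pow_n_smul h)]
    split_ifs with hc
    · rw [sub_self, map_zero]
      exact zero_mem _
    rw [sub_zero]
    obtain ⟨x, rfl⟩ := (D.resEquiv X).surjective x
    rw [LinearEquiv.symm_apply_apply]
    obtain ⟨l, hl, hr⟩ := D.exists_isRep c
    have h1 : ((((D.χ D.g)⁻¹ ^ (D.n - l) : kˣ) : k)) = (D.χ D.g : k) ^ l := by
      rw [← Units.val_pow_eq_pow_val, inv_pow, Units.val_inj, inv_eq_iff_mul_eq_one, ← pow_add,
        Nat.sub_add_cancel hl.le, χ_g_pow_n]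
    have h2 := D.g_smul_y_pow_smul h (D.n - l)
    rw [h1] at h2
    -- The `n`-th power is constant on an orbit, so `c^n ≠ 1` passes to the representative.
    have h3 : D.IsRepOne ((D.χ D.g : k) ^ l * c) := by
      refine ⟨?_, hr⟩
      rwa [mul_pow, ← pow_mul, mul_comm l, pow_mul, D.isPrimitiveRoot.pow_eq_one, one_pow, one_mul]
    have h4 := D.repIdem_smul h2
    rw [if_pos h3] at h4
    let v : D.repPart (D.res X) := ⟨D.resEquiv X (D.y ^ (D.n - l) • x), h4⟩
    have h5 : D.repInd hχ X (D.indMk hχ _ ⟨l, hl⟩ v) = (D.μ * (c ^ D.n - 1)) • x := by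
      rw [repInd_mk]
      change D.y ^ l • D.y ^ (D.n - l) • x = _
      rw [← mul_smul, ← pow_add, Nat.add_sub_cancel' hl.le, y_pow, smul_assoc, sub_smul, one_smul,
        ← map_pow, mul_smul, sub_smul, one_smul]
      congr 2
      apply (D.resEquiv X).injective
      rw [resEquiv_grp_smul, D.g_pow_n_smul h, map_smul]
    have h6 : D.μ * (c ^ D.n - 1) ≠ 0 := mul_ne_zero hμ (sub_ne_zero.mpr hc)
    have h7 : x = (D.μ * (c ^ D.n - 1))⁻¹ • D.repInd hχ X (D.indMk hχ _ ⟨l, hl⟩ v) := by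
      rw [h5, smul_smul, inv_mul_cancel₀ h6, one_smul]
    rw [h7, ← algebraMap_smul D.Alg]
    exact Submodule.smul_mem _ _ ⟨_, rfl⟩

open Classical in
-- If `c` is a representative, `y^i` moves it to `χ(g)⁻ⁱc`, and multiplication by `χ(g)^l` returns
-- to a representative only for `l = i`. These projections therefore separate the summands of `∑ y^i
-- v_i`.
theorem spectralProj_smul_y_pow_smul {l : ℕ} (hl : l < D.n) {i : ℕ} (hi : i < D.n) (x : D.res X) :
    spectralProj (orderOf D.g) (of k G D.g) (fun c => D.IsRepOne ((D.χ D.g : k) ^ l * c)) •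
        D.resEquiv X (D.y ^ i • (D.resEquiv X).symm (D.repIdem • x)) =
      if i = l then D.resEquiv X (D.y ^ i • (D.resEquiv X).symm (D.repIdem • x)) else 0 := by
  induction x using eigen_induction (k := k) (M := D.res X) D.orderOf_g_pos D.of_g_pow with
  | hz => simp
  | hadd x y hx hy =>
    simp only [smul_add, map_add, hx, hy]
    split_ifs <;> simp
  | he c x h =>
    rw [D.repIdem_smul h]
    by_cases hc : D.IsRepOne c
    swap
    · simp [hc]
    rw [if_pos hc]
    rcases eq_or_ne x 0 with rfl | hx
    · simp
    -- An element of finite order has no eigenvalue 0; uniqueness of representatives needs this.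
    have hc0 : c ≠ 0 := by
      rintro rfl
      apply hx
      have := pow_smul_of_smul_eq h (orderOf D.g)
      rwa [of_g_pow, one_smul, zero_pow D.orderOf_g_pos.ne', zero_smul] at this
    obtain ⟨x, rfl⟩ := (D.resEquiv X).surjective x
    rw [LinearEquiv.symm_apply_apply, spectralProj_smul D.orderOf_g_pos D.of_g_pow _
      (D.g_smul_y_pow_smul h i)]
    set q := D.χ D.g with hq
    have h1 : (q : k) ^ i * (((q⁻¹ ^ i : kˣ) : k) * c) = c := by
      rw [← mul_assoc, ← Units.val_pow_eq_pow_val, ← Units.val_mul, inv_pow, mul_inv_cancel,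
        Units.val_one, one_mul]
    refine if_congr ⟨fun h2 => ?_, ?_⟩ rfl rfl
    · refine D.isRep_unique (c := ((q⁻¹ ^ i : kˣ) : k) * c) (mul_ne_zero (Units.ne_zero _) hc0)
        hi hl ?_ h2.2
      rw [h1]
      exact hc.2
    · rintro rfl
      rwa [h1]

/-- Projecting `∑ y^i v_i = 0` isolates `y^l v_l = 0`, hence `y^n v_l = μ(g^n - 1)v_l = 0`. As `μ ≠
0`, the vector `v_l` is fixed by `g^n`; it also lies in the representative part, which meets the
block `g^n = 1` only in 0. -/
theorem repInd_injective (hμ : D.μ ≠ 0) : Function.Injective (D.repInd hχ X) := by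
  classical
  refine (injective_iff_map_eq_zero _).mpr fun f hf => ?_
  let v : Fin D.n → D.repPart (D.res X) := f
  have h1 : ∑ i : Fin D.n, D.y ^ (i : ℕ) • D.repIncl X (v i) = 0 :=
    (D.indLift_apply hχ _ _ v).symm.trans hf
  refine funext fun l => ?_
  have h2 : D.y ^ (l : ℕ) • D.repIncl X (v l) = 0 := by
    have h3 := congrArg (fun x => spectralProj (orderOf D.g) (of k G D.g)
      (fun c => D.IsRepOne ((D.χ D.g : k) ^ (l : ℕ) * c)) • D.resEquiv X x) h1
    simp only [map_sum, Finset.smul_sum, map_zero, smul_zero] at h3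
    rw [Finset.sum_eq_single l] at h3
    · have h4 := D.spectralProj_smul_y_pow_smul l.2 l.2 (D.resEquiv X (D.repIncl X (v l)))
      rw [resEquiv_repIncl, LinearEquiv.symm_apply_apply, if_pos rfl, h3] at h4
      exact (D.resEquiv X).injective (h4.symm.trans (map_zero _).symm)
    · intro i _ hi
      have h4 := D.spectralProj_smul_y_pow_smul l.2 i.2 (D.resEquiv X (D.repIncl X (v i)))
      rwa [resEquiv_repIncl, LinearEquiv.symm_apply_apply,
        if_neg (fun h => hi (Fin.ext h))] at h4
    · simp
  have h3 : D.y ^ D.n • D.repIncl X (v l) = 0 := by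
    rw [← Nat.sub_add_cancel l.2.le, pow_add, mul_smul, h2, smul_zero]
  rw [y_pow, smul_assoc, sub_smul, one_smul, ← map_pow, smul_eq_zero, or_iff_right hμ,
    sub_eq_zero] at h3
  have h4 : of k G (D.g ^ D.n) • D.resEquiv X (D.repIncl X (v l)) =
      (1 : k) • D.resEquiv X (D.repIncl X (v l)) := by
    rw [← resEquiv_grp_smul, h3, one_smul]
  have h5 := D.zeroIdem_smul h4
  rw [if_pos rfl, ← resEquiv_repIncl, zeroIdem_smul_repIdem_smul, resEquiv_repIncl] at h5
  apply D.repIncl_injective X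
  apply (D.resEquiv X).injective
  rw [← h5]
  rfl

theorem isExtension_repInd (hμ : D.μ ≠ 0) :
    IsExtension (D.ind hχ (D.repPart (D.res X))) X (D.algZeroPart X) := by
  refine ⟨D.repInd hχ X, D.toAlgZeroPart X, D.repInd_injective hχ hμ, fun x => ⟨fun hx => ?_, ?_⟩,
    D.toAlgZeroPart_surjective X⟩
  · have h := D.sub_mem_range_repInd hχ hμ (D.resEquiv X x)
    rw [toAlgZeroPart_eq_zero_iff] at hx
    rwa [hx, sub_zero, LinearEquiv.symm_apply_apply] at h
  · rintro ⟨f, rfl⟩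
    exact DFunLike.congr_fun (D.toAlgZeroPart_comp_repInd hχ) f

/-- The extension splits `[X]` into an induced class and the class of the block `g^n = 1`, where `y`
may be made zero. Both are determined by the restriction of `X`. -/
theorem blockLift_res (hμ : D.μ ≠ 0) (X : FDModule k D.Alg) :
    D.blockLift hχ (greenClass (D.res X)) = grothendieckClass X := by
  unfold blockLift
  have hz : ∀ v : D.res (D.algZeroPart X), of k G (D.g ^ D.n) • v = v := fun v =>
    D.g_pow_n_smul_zeroPart (V := D.res X) v
  rw [greenLift_class, grothendieckClass_of_isExtension (D.isExtension_repInd (X := X) hχ hμ),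
    ← D.zeroExt_res_class hz, add_comm]
  -- Cutting by the idempotent and restricting to `k[G]` give the same module in either order, by
  -- definition.
  congr 1

/-- `blockLift` is a left inverse. This is checked on classes of modules in `r(H)`, which surjects
onto `G₀(H)`. -/
theorem resHom_injective (hχ : D.χ ^ D.n = 1) (hμ : D.μ ≠ 0) : Function.Injective D.resHom := by
  refine Function.LeftInverse.injective (g := D.blockLift hχ) fun x => ?_
  obtain ⟨x, rfl⟩ := greenToGrothendieck_surjective x
  have h : ((D.blockLift hχ).comp D.resHom.toAddMonoidHom).comp
      (greenToGrothendieck k D.Alg).toAddMonoidHom =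
      (greenToGrothendieck k D.Alg).toAddMonoidHom := green_hom_ext fun X => by
    change D.blockLift hχ (D.resHom (greenToGrothendieck k D.Alg (greenClass X))) =
      greenToGrothendieck k D.Alg (greenClass X)
    rw [greenToGrothendieck_class, resHom_class, D.blockLift_res hχ hμ]
  exact DFunLike.congr_fun h x

end Main

end GroupDatum

namespace GroupDatum

open MonoidAlgebra

variable {k : Type u} {G : Type w} [Field k] [Group G] (D : GroupDatum k G) [Finite G]

/-! ### The restriction of an induced module -/

section Twist

variable (V : FDModule k (MonoidAlgebra k G))

/-- The module `V` with the action multiplied by `χ⁻ˡ`. -/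
def twist (l : ℕ) : FDModule k (MonoidAlgebra k G) :=
  ofRep V (MonoidAlgebra.lift k (Module.End k V) G
    { toFun := fun h => (((D.χ h)⁻¹ ^ l : kˣ) : k) • V.rep (of k G h)
      map_one' := by
        rw [map_one, map_one, map_one, inv_one, one_pow, Units.val_one, one_smul]
      map_mul' := fun h h' => by
        rw [map_mul, map_mul, map_mul, mul_inv, mul_pow, Units.val_mul, smul_mul_smul_comm] })

/-- The identity map from a module to its twist. -/
def twistEquiv (l : ℕ) : V ≃ₗ[k] D.twist V l := LinearEquiv.refl k V

theorem of_smul_twistEquiv (l : ℕ) (h : G) (v : V) :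
    of k G h • D.twistEquiv V l v =
      D.twistEquiv V l ((((D.χ h)⁻¹ ^ l : kˣ) : k) • of k G h • v) := by
  change MonoidAlgebra.lift k (Module.End k V) G _ (of k G h) v = _
  rw [MonoidAlgebra.lift_of]
  rfl

theorem twist_zero : D.twist V 0 ≈ V :=
  Setoid.symm (equiv_of_rep (M := V) (N := D.twist V 0) (D.twistEquiv V 0)
    (map_smul_of_of (D.twistEquiv V 0).toLinearMap fun h v => by
      rw [LinearEquiv.coe_coe, of_smul_twistEquiv, pow_zero, Units.val_one, one_smul]))

theorem twist_succ (l : ℕ) : D.twist V (l + 1) ≈ D.invCharModule.tensor (D.twist V l) := by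
  let e : D.twist V (l + 1) ≃ₗ[k] D.invCharModule.tensor (D.twist V l) :=
    ((D.twistEquiv V (l + 1)).symm.trans (D.twistEquiv V l)).trans
      (TensorProduct.lid k (D.twist V l)).symm
  have he : ∀ v, e (D.twistEquiv V (l + 1) v) =
      (1 : k) ⊗ₜ[k] D.twistEquiv V l v := fun _ => rfl
  refine equiv_of_rep (M := D.twist V (l + 1)) e (map_smul_of_of e.toLinearMap fun h v => ?_)
  obtain ⟨v, rfl⟩ := (D.twistEquiv V (l + 1)).surjective v
  rw [LinearEquiv.coe_coe, of_smul_twistEquiv, he, he]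
  change _ = outerRep D.invCharModule.rep (D.twist V l).rep
    (Coalgebra.comul (R := k) (of k G h)) ((1 : k) ⊗ₜ[k] D.twistEquiv V l v)
  rw [comul_of]
  refine Eq.trans ?_ (outerRep_tmul D.invCharModule.rep (D.twist V l).rep (of k G h) (of k G h)
    (1 : k) (D.twistEquiv V l v)).symm
  have h1 : D.invCharModule.rep (of k G h) (1 : k) = (((D.χ h)⁻¹ : kˣ) : k) := by
    change MonoidAlgebra.lift k k G ((Units.coeHom k).comp D.χ⁻¹) (of k G h) • (1 : k) = _
    rw [MonoidAlgebra.lift_of, smul_eq_mul, mul_one]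
    rfl
  have h2 : (D.twist V l).rep (of k G h) (D.twistEquiv V l v) =
      D.twistEquiv V l ((((D.χ h)⁻¹ ^ l : kˣ) : k) • of k G h • v) := D.of_smul_twistEquiv V l h v
  rw [h2]
  have h3 : ∀ w : D.twist V l, (1 : k) ⊗ₜ[k] ((((D.χ h)⁻¹ : kˣ) : k) • w) =
      (((D.χ h)⁻¹ : kˣ) : k) ⊗ₜ[k] w := fun w => by
    rw [TensorProduct.tmul_smul, TensorProduct.smul_tmul', smul_eq_mul, mul_one]
  rw [pow_succ', Units.val_mul, mul_smul, map_smul]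
  refine (h3 _).trans ?_
  exact congrArg (fun c : k => c ⊗ₜ[k] _) h1.symm

theorem greenClass_twist (l : ℕ) : greenClass (D.twist V l) = D.a ^ l * greenClass V := by
  induction l with
  | zero => rw [pow_zero, one_mul, greenClass_congr (D.twist_zero V)]
  | succ l ih =>
    rw [greenClass_congr (D.twist_succ V l), ← greenClass_mul, ih, pow_succ', mul_assoc]
    rfl

/-- The direct sum of the first `m` twists. -/
def twistSum (m : ℕ) : FDModule k (MonoidAlgebra k G) :=
  ofRep (Fin m → V) (MonoidAlgebra.lift k (Module.End k (Fin m → V)) G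
    { toFun := fun h => LinearMap.pi fun i =>
        (((D.χ h)⁻¹ ^ (i : ℕ) : kˣ) : k) • (V.rep (of k G h) ∘ₗ LinearMap.proj i)
      map_one' := by
        refine LinearMap.ext fun f => funext fun i => ?_
        change (((D.χ 1)⁻¹ ^ (i : ℕ) : kˣ) : k) • of k G 1 • f i = f i
        rw [map_one, map_one, inv_one, one_pow, Units.val_one, one_smul, one_smul]
      map_mul' := fun h h' => by
        refine LinearMap.ext fun f => funext fun i => ?_
        change (((D.χ (h * h'))⁻¹ ^ (i : ℕ) : kˣ) : k) • of k G (h * h') • f i =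
          (((D.χ h)⁻¹ ^ (i : ℕ) : kˣ) : k) • of k G h •
            (((D.χ h')⁻¹ ^ (i : ℕ) : kˣ) : k) • of k G h' • f i
        rw [of_smul_smul, smul_smul, ← Units.val_mul, ← mul_pow, ← mul_inv, ← map_mul,
          map_mul (of k G), mul_smul] })

/-- The coordinates of an element of `twistSum`. -/
def twistSumEquiv (m : ℕ) : D.twistSum V m ≃ₗ[k] (Fin m → V) := LinearEquiv.refl k _

theorem twistSumEquiv_of_smul (m : ℕ) (h : G) (x : D.twistSum V m) (i : Fin m) :
    D.twistSumEquiv V m (of k G h • x) i =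
      (((D.χ h)⁻¹ ^ (i : ℕ) : kˣ) : k) • of k G h • D.twistSumEquiv V m x i := by
  change MonoidAlgebra.lift k (Module.End k (Fin m → V)) G _ (of k G h)
    (D.twistSumEquiv V m x) i = _
  rw [MonoidAlgebra.lift_of]
  rfl

theorem twistSum_succ (m : ℕ) :
    D.twistSum V (m + 1) ≈ directSum (D.twistSum V m) (D.twist V m) := by
  let e : D.twistSum V (m + 1) ≃ₗ[k] directSum (D.twistSum V m) (D.twist V m) :=
    { toFun := fun x => ((D.twistSumEquiv V m).symm fun i => D.twistSumEquiv V (m + 1) x i.castSucc,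
        D.twistEquiv V m (D.twistSumEquiv V (m + 1) x (Fin.last m)))
      invFun := fun x => (D.twistSumEquiv V (m + 1)).symm
        (Fin.snoc (α := fun _ => (V : Type u)) (D.twistSumEquiv V m x.1)
          ((D.twistEquiv V m).symm x.2))
      map_add' := fun x y => rfl
      map_smul' := fun c x => rfl
      left_inv := fun x => by
        apply (D.twistSumEquiv V (m + 1)).injective
        ext i
        refine Fin.lastCases ?_ (fun i => ?_) i
        · simp
        · simp
      right_inv := fun x => by
        refine Prod.ext ?_ ?_
        · apply (D.twistSumEquiv V m).injective
          ext i
          simp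
        · simp }
  refine equiv_of_rep (M := D.twistSum V (m + 1)) e (map_smul_of_of e.toLinearMap fun h x => ?_)
  refine Prod.ext ?_ ?_
  · apply (D.twistSumEquiv V m).injective
    funext i
    change D.twistSumEquiv V (m + 1) (of k G h • x) i.castSucc =
      D.twistSumEquiv V m (of k G h • (D.twistSumEquiv V m).symm
        fun i => D.twistSumEquiv V (m + 1) x i.castSucc) i
    rw [twistSumEquiv_of_smul, twistSumEquiv_of_smul, LinearEquiv.apply_symm_apply]
    rfl
  · change D.twistEquiv V m (D.twistSumEquiv V (m + 1) (of k G h • x) (Fin.last m)) =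
      of k G h • D.twistEquiv V m (D.twistSumEquiv V (m + 1) x (Fin.last m))
    rw [twistSumEquiv_of_smul, of_smul_twistEquiv]
    rfl

theorem greenClass_twistSum (m : ℕ) :
    greenClass (D.twistSum V m) = (∑ l ∈ Finset.range m, D.a ^ l) * greenClass V := by
  induction m with
  | zero =>
    have : Subsingleton (D.twistSum V 0) := (D.twistSumEquiv V 0).toEquiv.subsingleton
    rw [greenClass_eq_zero, Finset.range_zero, Finset.sum_empty, zero_mul]
  | succ m ih =>
    rw [greenClass_congr (D.twistSum_succ V m), greenClass_directSum, ih, greenClass_twist,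
      Finset.sum_range_succ, add_mul]

/-- The summand `y^i ⊗ V` is `V` twisted by `χ⁻ⁱ`, because `h y^i = χ(h)⁻ⁱ y^i h`. -/
theorem res_ind (hχ : D.χ ^ D.n = 1) : D.res (D.ind hχ V) ≈ D.twistSum V D.n := by
  let e : D.res (D.ind hχ V) ≃ₗ[k] D.twistSum V D.n :=
    ((D.resEquiv _).symm.trans (D.indEquiv hχ V)).trans (D.twistSumEquiv V D.n).symm
  refine equiv_of_rep (M := D.res (D.ind hχ V)) e (map_smul_of_of e.toLinearMap fun h => ?_)
  have : ((e.toLinearMap ∘ₗ (D.res (D.ind hχ V)).rep (of k G h)) ∘ₗ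
      (D.resEquiv (D.ind hχ V)).toLinearMap) =
      ((D.twistSum V D.n).rep (of k G h) ∘ₗ e.toLinearMap) ∘ₗ (D.resEquiv _).toLinearMap :=
    D.ind_ext hχ V fun i v => by
      change e (of k G h • D.resEquiv _ (D.indMk hχ V i v)) =
        of k G h • e (D.resEquiv _ (D.indMk hχ V i v))
      rw [← resEquiv_grp_smul, grp_smul_indMk]
      apply (D.twistSumEquiv V D.n).injective
      funext j
      rw [twistSumEquiv_of_smul]
      change Pi.single (M := fun _ => (V : Type u)) i _ j =
        _ • of k G h • Pi.single (M := fun _ => (V : Type u)) i v j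
      rcases eq_or_ne j i with rfl | hj
      · rw [Pi.single_eq_same, Pi.single_eq_same]
      · rw [Pi.single_eq_of_ne hj, Pi.single_eq_of_ne hj, smul_zero, smul_zero]
  exact fun x => DFunLike.congr_fun this ((D.resEquiv _).symm x)

theorem greenClass_res_ind (hχ : D.χ ^ D.n = 1) : greenClass (D.res (D.ind hχ V)) =
    (∑ l ∈ Finset.range D.n, D.a ^ l) * greenClass V := by
  rw [greenClass_congr (D.res_ind V hχ), greenClass_twistSum]

end Twist

/-! ### The image of restriction -/

section Range

variable [IsAlgClosed k] [CharZero k]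

/-- As in Schur's lemma: an eigenspace of the central element `g` is a nonzero submodule, hence
everything. -/
theorem exists_g_smul_eq (S : FDModule k (MonoidAlgebra k G))
    (hS : IsSimpleModule (MonoidAlgebra k G) S) :
    ∃ c : k, ∀ v : S, of k G D.g • v = c • v := by
  have : Nontrivial S := IsSimpleModule.nontrivial (MonoidAlgebra k G) S
  obtain ⟨c, hc⟩ := Module.End.exists_eigenvalue (S.rep (of k G D.g))
  obtain ⟨v, hv, hv0⟩ := hc.exists_hasEigenvector
  let p : Submodule (MonoidAlgebra k G) S :=
    { carrier := {x | of k G D.g • x = c • x}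
      add_mem' := fun {x y} hx hy => by
        rw [Set.mem_ofPred_eq] at *
        rw [smul_add, smul_add, hx, hy]
      zero_mem' := by
        rw [Set.mem_ofPred_eq, smul_zero, smul_zero]
      smul_mem' := fun a x hx => by
        rw [Set.mem_ofPred_eq] at *
        rw [← mul_smul, (D.g_smul_comm a).eq, mul_smul, hx]
        exact (S.rep a).map_smul c x }
  have hp : p ≠ ⊥ := fun h => hv0 (by
    have : v ∈ p := Module.End.mem_eigenspace_iff.mp hv
    rwa [h, Submodule.mem_bot] at this)
  have hp' : p = ⊤ := (eq_bot_or_eq_top p).resolve_left hp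
  refine ⟨c, fun x => ?_⟩
  have : x ∈ p := hp' ▸ Submodule.mem_top
  exact this

theorem greenClass_zeroPart_mem (V : FDModule k (MonoidAlgebra k G)) :
    greenClass (D.zeroPart V) ∈ D.simpleSubring := by
  have : NeZero (Nat.card G : k) := ⟨Nat.cast_ne_zero.mpr Nat.card_pos.ne'⟩
  refine greenClass_mem_of_simple D.simpleSubring.toAddSubgroup _ fun S hS i hi => ?_
  refine Subring.subset_closure (Or.inl ⟨S, ⟨hS, fun v => hi ?_⟩, rfl⟩)
  rw [map_smul, g_pow_n_smul_zeroPart]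

theorem greenClass_repPart_mem (V : FDModule k (MonoidAlgebra k G)) :
    (∑ l ∈ Finset.range D.n, D.a ^ l) * greenClass (D.repPart V) ∈ D.simpleSubring := by
  classical
  have : NeZero (Nat.card G : k) := ⟨Nat.cast_ne_zero.mpr Nat.card_pos.ne'⟩
  -- The elements whose product with `1 + a + ⋯ + a^{n-1}` lies in the subring form a subgroup,
  -- which reduces the claim to simple submodules.
  refine greenClass_mem_of_simple (D.simpleSubring.toAddSubgroup.comap
    (AddMonoidHom.mulLeft (∑ l ∈ Finset.range D.n, D.a ^ l))) _ fun S hS i hi => ?_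
  refine Subring.subset_closure (Or.inr ⟨S, ⟨hS, ?_⟩, rfl⟩)
  obtain ⟨c, hc⟩ := D.exists_g_smul_eq S hS
  refine ⟨c ^ D.n, ?_, fun v => D.g_pow_n_smul (hc v)⟩
  have : Nontrivial S := IsSimpleModule.nontrivial (MonoidAlgebra k G) S
  obtain ⟨v, hv⟩ := exists_ne (0 : S)
  have h1 : D.repIdem • v = v := hi (by
    rw [map_smul]
    exact cut_smul (i v))
  rw [D.repIdem_smul (hc v)] at h1
  by_cases h2 : D.IsRepOne c
  · exact h2.1
  · rw [if_neg h2] at h1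
    exact absurd h1.symm hv

/-- Writing `[X]` through `blockLift` exhibits its restriction as a sum of elements of the subring.
Conversely each generator is the restriction of a module extended by zero or of an induced module.
-/
theorem resHom_range (hχ : D.χ ^ D.n = 1) (hμ : D.μ ≠ 0) : D.resHom.range = D.simpleSubring := by
  refine le_antisymm ?_ ?_
  · rintro _ ⟨x, rfl⟩
    obtain ⟨x, rfl⟩ := greenToGrothendieck_surjective x
    have h : ∀ X : FDModule k D.Alg,
        D.resHom (greenToGrothendieck k D.Alg (greenClass X)) ∈ D.simpleSubring := fun X => by
      rw [greenToGrothendieck_class, ← D.blockLift_res hχ hμ X, blockLift, greenLift_class,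
        map_add, resHom_class, resHom_class, greenClass_congr (D.res_zeroExt _ _),
        greenClass_res_ind]
      exact add_mem (D.greenClass_zeroPart_mem _) (D.greenClass_repPart_mem _)
    obtain ⟨M, N, rfl⟩ := exists_eq_greenClass_sub x
    rw [map_sub, map_sub]
    exact sub_mem (h M) (h N)
  · unfold simpleSubring
    rw [Subring.closure_le]
    rintro _ (⟨V, hV, rfl⟩ | ⟨V, hV, rfl⟩)
    · refine ⟨grothendieckClass (D.zeroExt V hV.2), ?_⟩
      rw [resHom_class, greenClass_congr (D.res_zeroExt V hV.2)]
    · refine ⟨grothendieckClass (D.ind hχ V), ?_⟩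
      rw [resHom_class, greenClass_res_ind]

/-- Elements orthogonal to the projective modules vanish in the Grothendieck ring. -/
theorem greenToGrothendieck_eq_zero (hχ : D.χ ^ D.n = 1) (hμ : D.μ ≠ 0) {x : GreenRing k D.Alg}
    (hx : x ∈ projectiveOrthogonal k D.Alg) : greenToGrothendieck k D.Alg x = 0 := by
  have : NeZero (Nat.card G : k) := ⟨Nat.cast_ne_zero.mpr Nat.card_pos.ne'⟩
  obtain ⟨M, N, rfl⟩ := exists_eq_greenClass_sub x
  -- The form is symmetric over `H`, where `S²` is conjugation by `g`, and over `k[G]`, where `S² =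
  -- 1`; Frobenius reciprocity is applied in between.
  have hform : ∀ (X : FDModule k D.Alg) (V : FDModule k (MonoidAlgebra k G)),
      greenForm k D.Alg (greenClass X) (greenClass (D.ind hχ V)) =
        homDim (D.res X) V.dual := fun X V => by
    rw [greenForm_class, homDim_dual_comm D.gUnit D.antipode_antipode_gUnit, homDim_ind,
      homDim_congr (Setoid.refl V) (D.res_dual X),
      homDim_dual_comm 1 fun a => by
        rw [MonoidAlgebra.antipode_antipode, Units.val_one, inv_one, Units.val_one, one_mul,
          mul_one]]
  -- Testing against the module induced from `S*`, with `S** ≅ S`, compares the maps from both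
  -- restrictions to every `S`.
  have hMN : D.res M ≈ D.res N := equiv_of_homDim_eq _ _ fun S => by
    have h1 := hx _ (greenClass_mem_projectiveSubgroup (D.ind hχ S.dual)
      (D.ind_projective hχ S.dual))
    rw [map_sub, AddMonoidHom.sub_apply, hform, hform, sub_eq_zero] at h1
    have h2 := dual_dual MonoidAlgebra.antipode_antipode S
    rw [homDim_congr (Setoid.refl _) h2, h1]
    exact homDim_congr (Setoid.refl _) (Setoid.symm h2)
  apply D.resHom_injective hχ hμ
  rw [map_sub, map_sub, map_zero, greenToGrothendieck_class, greenToGrothendieck_class,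
    resHom_class, resHom_class, greenClass_congr hMN, sub_self]

end Range

end GroupDatum

end

/-! ### The theorem -/

theorem mainTheorem5 {k : Type*} [Field k] [IsAlgClosed k] [CharZero k]
    {G : Type*} [Group G] [Finite G] (D : GroupDatum k G) (hD : D.IsNonNilpotent)
    (hn : 2 ≤ D.n) :
    (RingHom.ker (greenToGrothendieck k D.Alg) : Set (GreenRing k D.Alg)) =
        projectiveOrthogonal k D.Alg ∧
      (∃ (I : Ideal (GreenRing k D.Alg)) (_ : I.IsTwoSided),
        (I : Set (GreenRing k D.Alg)) = projectiveOrthogonal k D.Alg ∧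
        ∃ e : (GreenRing k D.Alg ⧸ I) ≃+* GrothendieckRing k D.Alg,
          ∀ x : GreenRing k D.Alg, e (Ideal.Quotient.mk I x) = greenToGrothendieck k D.Alg x) ∧
      Nonempty (GrothendieckRing k D.Alg ≃+* D.simpleSubring) := by
  have hχ : D.χ ^ D.n = 1 := hD.2
  have hμ : D.μ ≠ 0 := fun h => hD.1 (by rw [h, zero_smul])
  have hker : (RingHom.ker (greenToGrothendieck k D.Alg) : Set (GreenRing k D.Alg)) =
      projectiveOrthogonal k D.Alg := Set.ext fun x =>
    ⟨fun hx => ker_le_projectiveOrthogonal D.gUnit D.antipode_antipode_gUnit hx,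
      fun hx => D.greenToGrothendieck_eq_zero hχ hμ hx⟩
  -- The ideal is `ker φ` itself, so the isomorphism is the one induced by the surjection `φ`.
  refine ⟨hker, ⟨RingHom.ker (greenToGrothendieck k D.Alg), inferInstance, hker,
    RingHom.quotientKerEquivOfSurjective greenToGrothendieck_surjective, fun x => rfl⟩, ?_⟩
  exact ⟨(RingEquiv.ofBijective D.resHom.rangeRestrict
    ⟨fun x y h => D.resHom_injective hχ hμ (congrArg Subtype.val h),
      D.resHom.rangeRestrict_surjective⟩).trans (RingEquiv.subringCongr (D.resHom_range hχ hμ))⟩
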